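/- Let $k$ be a field, let $\mathbf I$ be a $k$-linear category with countable direct sums, and let $\mathscr B$ be a pretriangulated dg-category over $k$ such that $H^0(\mathscr B)$ has countable direct sums. (All categories are small with respect to a fixed universe.) Let $C_{dg}(\mathbf I)$ be the dg-category of complexes over $\mathbf I$, let $C^+_{dg}(\mathbf I)$ be its full dg-subcategory of strictly bounded below complexes, and let $i'\colon C^+_{dg}(\mathbf I)\to C_{dg}(\mathbf I)$ be the inclusion dg-functor. A quasi-functor $F\colon\mathscr A\to\mathscr B$ is a dg-functor $F$ from $\mathscr A$ to the dg-category of right dg-modules over $\mathscr B$ such that for every object $A$ of $\mathscr A$ there are an object $\Phi_F(A)$ of $\mathscr B$ and a quasi-isomorphism $\mathscr B(-,\Phi_F(A))\to F(A)$; it induces a functor $H^0(F)\colon H^0(\mathscr A)\to H^0(\mathscr B)$, $A\mapsto\Phi_F(A)$. An isomorphism of quasi-functors $F\cong G$ is an isomorphism between $F$ and $G$ in the derived category of $\mathscr A$-$\mathscr B$-dg-bimodules, i.e. in the localization of the homotopy category of dg-functors from $\mathscr A$ to right $\mathscr B$-dg-modules at the (objectwise) quasi-isomorphisms. Restriction along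 a dg-functor $\mathscr A'\to\mathscr A$ is defined on quasi-functors and on their isomorphisms. Let $F,G\colon C_{dg}(\mathbf I)\to\mathscr B$ be quasi-functors such that $H^0(F)$ and $H^0(G)$ preserve countable direct sums. Then for every isomorphism of quasi-functors $\varphi_0\colon F\circ i'\xrightarrow{\sim}G\circ i'$ there is an isomorphism of quasi-functors $\varphi\colon F\xrightarrow{\sim}G$ such that $\varphi\circ i'=\varphi_0$. -/

import Mathlib

open CategoryTheory Limits

universe w v v₁ v₂ v₃ u u₁ u₂ u₃

/-! ### dg-categories -/

set_option linter.checkUnivs false in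
/-- A dg-category over the field `k`: a category enriched over cochain complexes of `k`-modules.
`Hom X Y n` is the degree `n` part of the complex of morphisms `X → Y`, with differential
`d n (n + 1)` (`d n m` is zero for `m ≠ n + 1`). Compositions are written in
diagrammatic order: `comp h f g` is `g ∘ f`, so that the Leibniz rule
`d (g ∘ f) = d g ∘ f + (-1) ^ |g| g ∘ d f` takes the form of the field `leibniz`. -/
structure DGCat (k : Type w) [Field k] where
  Obj : Type u
  Hom : Obj → Obj → ℤ → Type v
  [addCommGroup : ∀ X Y n, AddCommGroup (Hom X Y n)]
  [module : ∀ X Y n, Module k (Hom X Y n)]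
  d : ∀ {X Y : Obj} (n m : ℤ), Hom X Y n →ₗ[k] Hom X Y m
  d_shape : ∀ {X Y : Obj} (n m : ℤ), n + 1 ≠ m → (d n m : Hom X Y n →ₗ[k] Hom X Y m) = 0
  d_d : ∀ {X Y : Obj} (n m l : ℤ) (f : Hom X Y n), n + 1 = m → m + 1 = l → d m l (d n m f) = 0
  id : ∀ X : Obj, Hom X X 0
  comp : ∀ {X Y Z : Obj} {p q n : ℤ}, p + q = n →
    (Hom X Y p →ₗ[k] Hom Y Z q →ₗ[k] Hom X Z n)
  id_comp : ∀ {X Y : Obj} {n : ℤ} (f : Hom X Y n), comp (zero_add n) (id X) f = f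
  comp_id : ∀ {X Y : Obj} {n : ℤ} (f : Hom X Y n), comp (add_zero n) f (id Y) = f
  assoc : ∀ {X Y Z T : Obj} {p q r pq qr n : ℤ} (f : Hom X Y p) (g : Hom Y Z q) (h : Hom Z T r)
    (h₁ : p + q = pq) (h₂ : pq + r = n) (h₃ : q + r = qr) (h₄ : p + qr = n),
    comp h₂ (comp h₁ f g) h = comp h₄ f (comp h₃ g h)
  leibniz : ∀ {X Y Z : Obj} {p q n p' q' n' : ℤ} (f : Hom X Y p) (g : Hom Y Z q)
    (h : p + q = n) (_ : p + 1 = p') (_ : q + 1 = q') (_ : n + 1 = n')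
    (h₁ : p + q' = n') (h₂ : p' + q = n'),
    d n n' (comp h f g) = comp h₁ f (d q q' g) + q.negOnePow • comp h₂ (d p p' f) g

attribute [instance] DGCat.addCommGroup DGCat.module

namespace DGCat

section basic

variable {k : Type w} [Field k] (A : DGCat.{w, v, u} k)

lemma comp_units_smul {X Y Z : A.Obj} {p q n : ℤ} (h : p + q = n) (f : A.Hom X Y p)
    (a : ℤˣ) (g : A.Hom Y Z q) : A.comp h f (a • g) = a • A.comp h f g := by
  simp only [Units.smul_def, map_zsmul]

lemma units_smul_comp {X Y Z : A.Obj} {p q n : ℤ} (h : p + q = n) (f : A.Hom X Y p)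
    (a : ℤˣ) (g : A.Hom Y Z q) : A.comp h (a • f) g = a • A.comp h f g := by
  simp only [Units.smul_def, map_zsmul, LinearMap.smul_apply]

lemma d_units_smul {X Y : A.Obj} (n m : ℤ) (a : ℤˣ) (f : A.Hom X Y n) :
    A.d n m (a • f) = a • A.d n m f := by
  simp only [Units.smul_def, map_zsmul]

lemma d_id (X : A.Obj) : A.d 0 1 (A.id X) = 0 := by
  have h := A.leibniz (A.id X) (A.id X) (add_zero 0) (zero_add 1) (zero_add 1) (zero_add 1)
    (zero_add 1) (add_zero 1)
  rw [A.id_comp, A.id_comp, A.comp_id, Int.negOnePow_zero, one_smul] at h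
  simpa using h

/-- The complex of `k`-modules of morphisms `X → Y`. -/
def homComplex (X Y : A.Obj) : CochainComplex (ModuleCat.{v} k) ℤ where
  X n := ModuleCat.of k (A.Hom X Y n)
  d n m := ModuleCat.ofHom (A.d n m)
  shape n m h := by rw [A.d_shape n m h]; rfl
  d_comp_d' n m l h₁ h₂ := by
    ext f
    exact A.d_d n m l f h₁ h₂

/-- The category `Z⁰(A)`: same objects as `A`, closed morphisms of degree `0`. -/
structure Z0 where
  obj : A.Obj

instance : Category.{v} A.Z0 where
  Hom X Y := { f : A.Hom X.obj Y.obj 0 // A.d 0 1 f = 0 }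
  id X := ⟨A.id X.obj, A.d_id X.obj⟩
  comp f g := ⟨A.comp (add_zero 0) f.1 g.1, by
    rw [A.leibniz f.1 g.1 (add_zero 0) (zero_add 1) (zero_add 1) (zero_add 1)
      (zero_add 1) (add_zero 1), f.2, g.2]
    simp⟩
  id_comp f := Subtype.ext (A.id_comp f.1)
  comp_id f := Subtype.ext (A.comp_id f.1)
  assoc f g h := Subtype.ext (A.assoc f.1 g.1 h.1 _ _ _ _)

/-- Two closed morphisms of degree `0` are homotopic if they differ by a coboundary. -/
def homotopic : HomRel A.Z0 :=
  fun X Y f g => ∃ h : A.Hom X.obj Y.obj (-1), f.1 - g.1 = A.d (-1) 0 h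

instance : Congruence A.homotopic where
  equivalence :=
    { refl := fun f => ⟨0, by simp⟩
      symm := by
        rintro f g ⟨h, hh⟩
        exact ⟨-h, by rw [map_neg, ← hh, neg_sub]⟩
      trans := by
        rintro f g l ⟨h, hh⟩ ⟨h', hh'⟩
        exact ⟨h + h', by rw [map_add, ← hh, ← hh', sub_add_sub_cancel]⟩ }
  comp_left := by
    rintro X Y Z f g g' ⟨h, hh⟩
    refine ⟨A.comp (zero_add (-1)) f.1 h, ?_⟩
    rw [A.leibniz f.1 h (zero_add (-1)) (zero_add 1) (neg_add_cancel 1) (neg_add_cancel 1)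
      (zero_add 0) (add_neg_cancel 1), f.2, ← hh]
    simp only [map_sub, map_zero, LinearMap.zero_apply, smul_zero, add_zero]
    rfl
  comp_right := by
    rintro X Y Z f f' g ⟨h, hh⟩
    refine ⟨A.comp (add_zero (-1)) h g.1, ?_⟩
    rw [A.leibniz h g.1 (add_zero (-1)) (neg_add_cancel 1) (zero_add 1) (neg_add_cancel 1)
      (neg_add_cancel 1) (zero_add 0), g.2, ← hh]
    simp only [map_sub, map_zero, LinearMap.sub_apply, Int.negOnePow_zero, one_smul, zero_add]
    rfl

/-- The homotopy category `H⁰(A)`: same objects as `A`, and morphisms the zeroth cohomology of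
the complexes of morphisms of `A`. -/
abbrev H0 : Type u := CategoryTheory.Quotient A.homotopic

/-- The projection `Z⁰(A) ⥤ H⁰(A)`. -/
abbrev toH0 : A.Z0 ⥤ A.H0 := CategoryTheory.Quotient.functor A.homotopic

/-- The full dg-subcategory spanned by the objects that satisfy `P`. -/
def fullSub (P : A.Obj → Prop) : DGCat.{w, v, u} k where
  Obj := { X : A.Obj // P X }
  Hom X Y n := A.Hom X.1 Y.1 n
  d := A.d
  d_shape := A.d_shape
  d_d := A.d_d
  id X := A.id X.1
  comp := A.comp
  id_comp := A.id_comp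
  comp_id := A.comp_id
  assoc := A.assoc
  leibniz := A.leibniz

/-- The opposite dg-category, with composition `f ∘ᵒᵖ g = (-1) ^ (|f| |g|) g ∘ f`. -/
def op : DGCat.{w, v, u} k where
  Obj := A.Obj
  Hom X Y n := A.Hom Y X n
  d := A.d
  d_shape := A.d_shape
  d_d := A.d_d
  id := A.id
  comp {X Y Z p q n} h := (p * q).negOnePow • (A.comp ((add_comm q p).trans h)).flip
  id_comp f := by simp [A.comp_id]
  comp_id f := by simp [A.id_comp]
  assoc {X Y Z T p q r pq qr n} f g h h₁ h₂ h₃ h₄ := by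
    subst h₁ h₃
    simp only [Units.smul_def, LinearMap.smul_apply, LinearMap.flip_apply, map_zsmul]
    rw [A.assoc (pq := q + r) (qr := p + q) h g f (by omega) (by omega) (by omega) (by omega),
      smul_smul, smul_smul]
    congr 1
    rw [← Units.val_mul, ← Units.val_mul, ← Int.negOnePow_add, ← Int.negOnePow_add]
    congr 2
    ring
  leibniz {X Y Z p q n p' q' n'} f g h hp hq hn h₁ h₂ := by
    subst hp hq
    simp only [Units.smul_def, LinearMap.smul_apply, LinearMap.flip_apply, map_zsmul]
    rw [A.leibniz g f (by omega) rfl rfl hn (by omega) (by omega), smul_add, add_comm]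
    simp only [Units.smul_def, smul_smul, ← Units.val_mul, ← Int.negOnePow_add]
    congr 3
    · congr 1
      ring_nf
    · rw [show q + (p + 1) * q = p * q + 2 * q by ring, Int.negOnePow_add, Int.negOnePow_two_mul,
        mul_one]

end basic

end DGCat

/-! ### dg-functors and dg-natural transformations -/

/-- A dg-functor. -/
structure DGFunctor {k : Type w} [Field k] (A : DGCat.{w, v₁, u₁} k) (C : DGCat.{w, v₂, u₂} k) where
  obj : A.Obj → C.Obj
  map : ∀ {X Y : A.Obj} {n : ℤ}, A.Hom X Y n →ₗ[k] C.Hom (obj X) (obj Y) n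
  map_id : ∀ X : A.Obj, map (A.id X) = C.id (obj X)
  map_comp : ∀ {X Y Z : A.Obj} {p q n : ℤ} (h : p + q = n) (f : A.Hom X Y p) (g : A.Hom Y Z q),
    map (A.comp h f g) = C.comp h (map f) (map g)
  map_d : ∀ {X Y : A.Obj} (n m : ℤ) (_ : n + 1 = m) (f : A.Hom X Y n),
    map (A.d n m f) = C.d n m (map f)

namespace DGFunctor

variable {k : Type w} [Field k]

section

variable {A : DGCat.{w, v₁, u₁} k} {B : DGCat.{w, v₂, u₂} k} {C : DGCat.{w, v₃, u₃} k}

/-- The composition `G ∘ F` of dg-functors. -/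
def comp (F : DGFunctor A B) (G : DGFunctor B C) : DGFunctor A C where
  obj X := G.obj (F.obj X)
  map := G.map.comp F.map
  map_id X := by simp [F.map_id, G.map_id]
  map_comp h f g := by simp [F.map_comp, G.map_comp]
  map_d n m h f := by simp [F.map_d n m h, G.map_d n m h]

/-- The functor `Z⁰(F) : Z⁰(A) ⥤ Z⁰(B)`. -/
def mapZ0 (F : DGFunctor A B) : A.Z0 ⥤ B.Z0 where
  obj X := ⟨F.obj X.obj⟩
  map f := ⟨F.map f.1, by rw [← F.map_d 0 1 (zero_add 1), f.2, map_zero]⟩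
  map_id X := Subtype.ext (F.map_id X.obj)
  map_comp f g := Subtype.ext (F.map_comp (add_zero 0) f.1 g.1)

/-- The functor `H⁰(F) : H⁰(A) ⥤ H⁰(B)`. -/
def mapH0 (F : DGFunctor A B) : A.H0 ⥤ B.H0 :=
  CategoryTheory.Quotient.lift _ (F.mapZ0 ⋙ B.toH0) (by
    rintro X Y f g ⟨h, hh⟩
    refine CategoryTheory.Quotient.sound _ ⟨F.map h, ?_⟩
    exact (map_sub F.map f.1 g.1).symm.trans
      ((congrArg F.map hh).trans (F.map_d (-1) 0 (neg_add_cancel 1) h)))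

end

/-- The inclusion of a full dg-subcategory. -/
def ofFullSub (A : DGCat.{w, v, u} k) (P : A.Obj → Prop) : DGFunctor (A.fullSub P) A where
  obj X := X.1
  map := LinearMap.id
  map_id _ := rfl
  map_comp _ _ _ := rfl
  map_d _ _ _ _ := rfl

/-- A dg-functor that takes values in a full dg-subcategory, as a dg-functor to it. -/
def toFullSub {A : DGCat.{w, v₁, u₁} k} {C : DGCat.{w, v₂, u₂} k} (F : DGFunctor A C)
    (P : C.Obj → Prop) (hP : ∀ X, P (F.obj X)) : DGFunctor A (C.fullSub P) where
  obj X := ⟨F.obj X, hP X⟩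
  map := F.map
  map_id := F.map_id
  map_comp := F.map_comp
  map_d := F.map_d

section

variable {A : DGCat.{w, v, u₁} k} {C : DGCat.{w, v, u₂} k} (F : DGFunctor A C)

/-- The action of a dg-functor on complexes of morphisms. -/
def mapComplex (X Y : A.Obj) : A.homComplex X Y ⟶ C.homComplex (F.obj X) (F.obj Y) where
  f n := ModuleCat.ofHom F.map
  comm' n m h := by
    ext f
    exact (F.map_d n m h f).symm

/-- A quasi-equivalence: a dg-functor that induces quasi-isomorphisms on complexes of morphisms
and an essentially surjective functor on homotopy categories. -/
def IsQuasiEquivalence : Prop :=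
  (∀ X Y : A.Obj, QuasiIso (F.mapComplex X Y)) ∧ F.mapH0.EssSurj

end

section

variable {A : DGCat.{w, v₁, u₁} k} {C : DGCat.{w, v₂, u₂} k}

/-- The natural transformations of degree `n` between dg-functors:
`G f ∘ φ X = (-1) ^ (n p) φ Y ∘ F f` for `f : X → Y` of degree `p`. -/
def natTrans (F G : DGFunctor A C) (n : ℤ) :
    Submodule k (∀ X : A.Obj, C.Hom (F.obj X) (G.obj X) n) where
  carrier := { φ | ∀ ⦃X Y : A.Obj⦄ ⦃p m : ℤ⦄ (h₁ : n + p = m) (h₂ : p + n = m)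
    (f : A.Hom X Y p), C.comp h₁ (φ X) (G.map f) =
      (n * p).negOnePow • C.comp h₂ (F.map f) (φ Y) }
  add_mem' {φ ψ} hφ hψ X Y p m h₁ h₂ f := by
    simp only [Pi.add_apply, map_add, LinearMap.add_apply, hφ h₁ h₂ f, hψ h₁ h₂ f, smul_add]
  zero_mem' X Y p m h₁ h₂ f := by simp
  smul_mem' a φ hφ X Y p m h₁ h₂ f := by
    simp only [Pi.smul_apply, map_smul, LinearMap.smul_apply, hφ h₁ h₂ f]
    rw [smul_comm]

lemma natTrans_comm {F G : DGFunctor A C} {n : ℤ} (φ : F.natTrans G n) {X Y : A.Obj} {p m : ℤ}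
    (h₁ : n + p = m) (h₂ : p + n = m) (f : A.Hom X Y p) :
    C.comp h₁ (φ.1 X) (G.map f) = (n * p).negOnePow • C.comp h₂ (F.map f) (φ.1 Y) :=
  φ.2 h₁ h₂ f

end

end DGFunctor

namespace DGCat

section

variable {k : Type w} [Field k] (A : DGCat.{w, v₁, u₁} k) (C : DGCat.{w, v₂, u₂} k)

/-- The dg-category `Fun_dg(A, C)` of dg-functors. -/
def dgFun : DGCat.{w, max u₁ v₂, max u₁ v₁ u₂ v₂} k where
  Obj := DGFunctor A C
  Hom F G n := F.natTrans G n
  d {F G} n m :=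
    { toFun φ := ⟨fun X => C.d n m (φ.1 X), fun X Y p l h₁ h₂ f => by
        by_cases hnm : n + 1 = m
        · have h := congrArg (C.d (n + p) l) (DGFunctor.natTrans_comm φ rfl (add_comm p n) f)
          have h' := DGFunctor.natTrans_comm φ (p := p + 1) (m := l) (by omega) (by omega)
            (A.d p (p + 1) f)
          rw [C.d_units_smul, C.leibniz (φ.1 X) (G.map f) rfl hnm rfl (by omega) (by omega) h₁,
            C.leibniz (F.map f) (φ.1 Y) (add_comm p n) rfl hnm (by omega) h₂ (by omega),
            ← F.map_d p _ rfl, ← G.map_d p _ rfl, h', mul_add, mul_one, Int.negOnePow_add,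
            smul_add, smul_smul, add_comm, add_right_cancel_iff] at h
          have e : (m * p).negOnePow = p.negOnePow * (n * p).negOnePow := by
            rw [← hnm, add_mul, one_mul, Int.negOnePow_add, mul_comm]
          rw [e, ← smul_smul, ← h, smul_smul, ← Int.negOnePow_add,
            Int.negOnePow_even _ ⟨p, rfl⟩, one_smul]
        · simp [C.d_shape n m hnm]⟩
      map_add' φ ψ := Subtype.ext (funext fun X => map_add _ _ _)
      map_smul' a φ := Subtype.ext (funext fun X => map_smul _ _ _) }
  d_shape {F G} n m h := LinearMap.ext fun φ => Subtype.ext (funext fun X => by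
    simp [C.d_shape n m h])
  d_d {F G} n m l φ h₁ h₂ := Subtype.ext (funext fun X => C.d_d n m l _ h₁ h₂)
  id F := ⟨fun X => C.id (F.obj X), fun X Y p m h₁ h₂ f => by
    obtain rfl : p = m := by omega
    rw [C.id_comp, C.comp_id, zero_mul, Int.negOnePow_zero, one_smul]⟩
  comp {F G H p q n} h := LinearMap.mk₂ k
    (fun φ ψ => ⟨fun X => C.comp h (φ.1 X) (ψ.1 X), fun X Y r m h₁ h₂ f => by
      rw [C.assoc (qr := q + r) (φ.1 X) (ψ.1 X) (H.map f) h h₁ rfl (by omega),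
        DGFunctor.natTrans_comm ψ rfl (add_comm r q) f, C.comp_units_smul,
        ← C.assoc (pq := p + r) (φ.1 X) (G.map f) (ψ.1 Y) rfl (by omega) (by omega) (by omega),
        DGFunctor.natTrans_comm φ rfl (add_comm r p) f, C.units_smul_comp,
        C.assoc (qr := n) (F.map f) (φ.1 Y) (ψ.1 Y) (by omega) (by omega) h h₂, smul_smul,
        ← Int.negOnePow_add, ← add_mul, add_comm q p, h]⟩)
    (fun _ _ _ => Subtype.ext (funext fun X => by simp))
    (fun _ _ _ => Subtype.ext (funext fun X => by simp))
    (fun _ _ _ => Subtype.ext (funext fun X => by simp))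
    (fun _ _ _ => Subtype.ext (funext fun X => by simp))
  id_comp φ := Subtype.ext (funext fun X => C.id_comp _)
  comp_id φ := Subtype.ext (funext fun X => C.comp_id _)
  assoc φ ψ χ h₁ h₂ h₃ h₄ := Subtype.ext (funext fun X => C.assoc _ _ _ h₁ h₂ h₃ h₄)
  leibniz φ ψ h hp hq hn h₁ h₂ :=
    Subtype.ext (funext fun X => C.leibniz (φ.1 X) (ψ.1 X) h hp hq hn h₁ h₂)

end

end DGCat

/-! ### dg-categories of complexes -/

open CochainComplex.HomComplex in
/-- The dg-category `C_dg(I)` of complexes over a `k`-linear category `I`: its complexes of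
morphisms are the usual ones, with `d f = d ∘ f - (-1) ^ n f ∘ d` for `f` of degree `n`. -/
def Cdg (k : Type w) [Field k] (I : Type u) [Category.{v} I] [Preadditive I] [Linear k I] :
    DGCat.{w, v, max u v} k where
  Obj := CochainComplex I ℤ
  Hom K L n := Cochain K L n
  d {K L} n m := δ_hom k K L n m
  d_shape n m h := LinearMap.ext fun z => δ_shape n m h z
  d_d n m l f _ _ := δ_δ n m l f
  id K := Cochain.ofHom (𝟙 K)
  comp h := LinearMap.mk₂ k (fun f g => f.comp g h)
    (fun f f' g => Cochain.add_comp f f' g h) (fun a f g => Cochain.smul_comp a f g h)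
    (fun f g g' => Cochain.comp_add f g g' h) (fun a f g => Cochain.comp_smul f a g h)
  id_comp f := Cochain.id_comp f
  comp_id f := Cochain.comp_id f
  assoc f g h h₁ h₂ h₃ h₄ := Cochain.comp_assoc f g h h₁ h₃ (by omega)
  leibniz f g h hp hq hn _ _ := δ_comp f g h _ _ _ hn hp hq

/-- The full dg-subcategory `C_dg⁺(I)` of complexes that are (strictly) bounded below. -/
abbrev CdgPlus (k : Type w) [Field k] (I : Type u) [Category.{v} I] [Preadditive I] [Linear k I] :
    DGCat.{w, v, max u v} k :=
  (Cdg k I).fullSub (CochainComplex.plus I)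

/-- The inclusion dg-functor `C_dg⁺(I) → C_dg(I)`. -/
abbrev CdgPlus.incl (k : Type w) [Field k] (I : Type u) [Category.{v} I] [Preadditive I]
    [Linear k I] : DGFunctor (CdgPlus k I) (Cdg k I) :=
  DGFunctor.ofFullSub (Cdg k I) (CochainComplex.plus I)

namespace DGCat

open CochainComplex.HomComplex

variable {k : Type u} [Field k]

/-! ### dg-modules -/

/-- The dg-category `dgm(B) = Fun_dg(Bᵒᵖ, C_dg(k))` of right dg-modules. -/
abbrev dgMod (B : DGCat.{u, u, u} k) : DGCat.{u, u, u + 1} k :=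
  B.op.dgFun (Cdg k (ModuleCat.{u} k))

/-- The complex of `k`-modules `M b`. -/
abbrev eval {B : DGCat.{u, u, u} k} (M : B.dgMod.Obj) (b : B.Obj) :
    CochainComplex (ModuleCat.{u} k) ℤ :=
  DGFunctor.obj M b

/-- The chain map `M b → N b` underlying a closed morphism of degree `0` of dg-modules. -/
def evalHom {B : DGCat.{u, u, u} k} {M N : B.dgMod.Z0} (φ : M ⟶ N) (b : B.Obj) :
    eval M.obj b ⟶ eval N.obj b :=
  Cocycle.homOf (Cocycle.mk (φ.1.1 b) 1 (zero_add 1) (congrFun (congrArg Subtype.val φ.2) b))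

/-- A quasi-isomorphism of dg-modules. -/
def IsQis {B : DGCat.{u, u, u} k} {M N : B.dgMod.Z0} (φ : M ⟶ N) : Prop :=
  ∀ b : B.Obj, QuasiIso (evalHom φ b)

section yoneda

variable (B : DGCat.{u, u, u} k)

/-- The right action `x ↦ (-1) ^ (p |x|) x ∘ f` of `f : c' → c` of degree `p` on `B(-, b)`. -/
def precomp (b : B.Obj) {c c' : B.Obj} {p : ℤ} (f : B.Hom c' c p) :
    Cochain (B.homComplex c b) (B.homComplex c' b) p :=
  Cochain.mk fun i _ hij => ModuleCat.ofHom
    ((p * i).negOnePow • B.comp ((add_comm p i).trans hij) f)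

/-- The map `x ↦ g ∘ x` given by `g : b → b'` of degree `p`. -/
def postcomp (c : B.Obj) {b b' : B.Obj} {p : ℤ} (g : B.Hom b b' p) :
    Cochain (B.homComplex c b) (B.homComplex c b') p :=
  Cochain.mk fun _ _ hij => ModuleCat.ofHom ((B.comp hij).flip g)

variable {B}

/-- Two cochains of complexes of modules are equal if they agree on elements. -/
lemma cochain_ext {K L : CochainComplex (ModuleCat.{u} k) ℤ} {n : ℤ} {y z : Cochain K L n}
    (h : ∀ (i j : ℤ) (hij : i + n = j) (x : K.X i), (y.v i j hij).hom x = (z.v i j hij).hom x) :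
    y = z := by
  apply Cochain.ext
  intro i j hij
  ext x
  exact h i j hij x

lemma units_smul_v_apply {K L : CochainComplex (ModuleCat.{u} k) ℤ} {n : ℤ} (z : Cochain K L n)
    (a : ℤˣ) (i j : ℤ) (hij : i + n = j) (x : K.X i) :
    ((a • z).v i j hij).hom x = a • (z.v i j hij).hom x := by
  rw [Cochain.units_smul_v]
  rfl

lemma comp_v_apply {K L M : CochainComplex (ModuleCat.{u} k) ℤ} {p q n : ℤ} (y : Cochain K L p)
    (z : Cochain L M q) (h : p + q = n) (i j l : ℤ) (hij : i + p = j) (hjl : j + q = l)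
    (hil : i + n = l) (x : K.X i) :
    ((y.comp z h).v i l hil).hom x = (z.v j l hjl).hom ((y.v i j hij).hom x) := by
  rw [Cochain.comp_v y z h i j l hij hjl]
  rfl

lemma δ_v_apply {K L : CochainComplex (ModuleCat.{u} k) ℤ} {n m : ℤ} (hnm : n + 1 = m)
    (z : Cochain K L n) (i j i' j' : ℤ) (hij : i + m = j) (hi : i + 1 = i') (hj : i + n = j')
    (x : K.X i) :
    ((δ n m z).v i j hij).hom x = (L.d j' j).hom ((z.v i j' hj).hom x) +
      m.negOnePow • (z.v i' j (by omega)).hom ((K.d i i').hom x) := by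
  rw [δ_v n m hnm z i j hij j' i' (by omega) hi]
  rfl

lemma precomp_add (b : B.Obj) {c c' : B.Obj} {p : ℤ} (f g : B.Hom c' c p) :
    precomp B b (f + g) = precomp B b f + precomp B b g := by
  have key : ∀ (i j : ℤ) (h : p + i = j) (x : B.Hom c b i),
      (p * i).negOnePow • B.comp h (f + g) x =
        (p * i).negOnePow • B.comp h f x + (p * i).negOnePow • B.comp h g x := by
    intro i j h x
    rw [map_add, LinearMap.add_apply, smul_add]
  exact cochain_ext fun i j hij x => key i j _ x

lemma precomp_smul (b : B.Obj) {c c' : B.Obj} {p : ℤ} (a : k) (f : B.Hom c' c p) :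
    precomp B b (a • f) = a • precomp B b f := by
  have key : ∀ (i j : ℤ) (h : p + i = j) (x : B.Hom c b i),
      (p * i).negOnePow • B.comp h (a • f) x = a • (p * i).negOnePow • B.comp h f x := by
    intro i j h x
    rw [map_smul, LinearMap.smul_apply, smul_comm]
  exact cochain_ext fun i j hij x => key i j _ x

lemma postcomp_add (c : B.Obj) {b b' : B.Obj} {p : ℤ} (f g : B.Hom b b' p) :
    postcomp B c (f + g) = postcomp B c f + postcomp B c g := by
  have key : ∀ (i j : ℤ) (h : i + p = j) (x : B.Hom c b i),
      B.comp h x (f + g) = B.comp h x f + B.comp h x g := fun i j h x => map_add _ f g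
  exact cochain_ext fun i j hij x => key i j hij x

lemma postcomp_smul (c : B.Obj) {b b' : B.Obj} {p : ℤ} (a : k) (f : B.Hom b b' p) :
    postcomp B c (a • f) = a • postcomp B c f := by
  have key : ∀ (i j : ℤ) (h : i + p = j) (x : B.Hom c b i),
      B.comp h x (a • f) = a • B.comp h x f := fun i j h x => map_smul _ a f
  exact cochain_ext fun i j hij x => key i j hij x

lemma precomp_id (b c : B.Obj) : precomp B b (B.id c) = Cochain.ofHom (𝟙 _) := by
  have key : ∀ (i : ℤ) (h : 0 + i = i) (x : B.Hom c b i),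
      (0 * i).negOnePow • B.comp h (B.id c) x = x := by
    intro i h x
    rw [B.id_comp, zero_mul, Int.negOnePow_zero, one_smul]
  refine cochain_ext fun i j hij x => ?_
  obtain rfl : i = j := by omega
  rw [Cochain.ofHom_v]
  exact key i _ x

lemma postcomp_id (b c : B.Obj) : postcomp B c (B.id b) = Cochain.ofHom (𝟙 _) := by
  refine cochain_ext fun i j hij x => ?_
  obtain rfl : i = j := by omega
  rw [Cochain.ofHom_v]
  exact B.comp_id (X := c) (Y := b) x

lemma precomp_comp (b : B.Obj) {c c' c'' : B.Obj} {p q n : ℤ} (h : p + q = n)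
    (f : B.Hom c' c p) (g : B.Hom c'' c' q) :
    precomp B b ((p * q).negOnePow • B.comp ((add_comm q p).trans h) g f) =
      (precomp B b f).comp (precomp B b g) h := by
  have key : ∀ (i j : ℤ) (h' : q + p = n) (h₁ : n + i = j) (h₂ : p + i = i + p)
      (h₃ : q + (i + p) = j) (x : B.Hom c b i),
      (n * i).negOnePow • B.comp h₁ ((p * q).negOnePow • B.comp h' g f) x =
        (q * (i + p)).negOnePow • B.comp h₃ g ((p * i).negOnePow • B.comp h₂ f x) := by
    intro i j h' h₁ h₂ h₃ x
    rw [B.units_smul_comp, B.comp_units_smul, smul_smul, smul_smul, B.assoc g f x h' h₁ h₂ h₃,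
      ← Int.negOnePow_add, ← Int.negOnePow_add, ← h]
    congr 2
    ring
  refine cochain_ext fun i j hij x => ?_
  rw [comp_v_apply _ _ h i (i + p) j rfl (by omega)]
  exact key i j _ _ _ _ x

lemma postcomp_comp (c : B.Obj) {b b' b'' : B.Obj} {p q n : ℤ} (h : p + q = n)
    (f : B.Hom b b' p) (g : B.Hom b' b'' q) :
    postcomp B c (B.comp h f g) = (postcomp B c f).comp (postcomp B c g) h := by
  refine cochain_ext fun i j hij x => ?_
  rw [comp_v_apply _ _ h i (i + p) j rfl (by omega)]
  exact (B.assoc (X := c) x f g rfl (by omega) h hij).symm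

lemma precomp_d (b : B.Obj) {c c' : B.Obj} {n m : ℤ} (h : n + 1 = m) (f : B.Hom c' c n) :
    precomp B b (B.d n m f) = δ n m (precomp B b f) := by
  have key : ∀ (i j : ℤ) (h₁ : m + i = j) (h₂ : n + i = i + n) (h₃ : n + (i + 1) = j)
      (x : B.Hom c b i),
      (m * i).negOnePow • B.comp h₁ (B.d n m f) x =
        B.d (i + n) j ((n * i).negOnePow • B.comp h₂ f x) +
          m.negOnePow • (n * (i + 1)).negOnePow • B.comp h₃ f (B.d i (i + 1) x) := by
    intro i j h₁ h₂ h₃ x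
    subst h
    rw [B.d_units_smul, B.leibniz f x h₂ rfl rfl (by omega) h₃ h₁, smul_add, smul_smul, smul_smul,
      ← Int.negOnePow_add, ← Int.negOnePow_add, add_right_comm, mul_add, mul_one, add_mul,
      one_mul, show n + 1 + (n * i + n) = n * i + 1 + 2 * n by ring, Int.negOnePow_add _ (2 * n),
      Int.negOnePow_two_mul, mul_one, Int.negOnePow_succ, Units.neg_smul, add_neg_cancel, zero_add]
  refine cochain_ext fun i j hij x => ?_
  rw [δ_v_apply h _ i j (i + 1) (i + n) hij rfl rfl]
  exact key i j _ _ _ x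

lemma postcomp_d (c : B.Obj) {b b' : B.Obj} {n m : ℤ} (h : n + 1 = m) (f : B.Hom b b' n) :
    postcomp B c (B.d n m f) = δ n m (postcomp B c f) := by
  have key : ∀ (i j : ℤ) (h₁ : i + m = j) (h₂ : i + n = i + n) (h₃ : i + 1 + n = j)
      (x : B.Hom c b i),
      B.comp h₁ x (B.d n m f) = B.d (i + n) j (B.comp h₂ x f) +
        m.negOnePow • B.comp h₃ (B.d i (i + 1) x) f := by
    intro i j h₁ h₂ h₃ x
    subst h
    rw [B.leibniz x f h₂ rfl rfl (by omega) h₁ h₃, Int.negOnePow_succ,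
      Units.neg_smul, add_neg_cancel_right]
  refine cochain_ext fun i j hij x => ?_
  rw [δ_v_apply h _ i j (i + 1) (i + n) hij rfl rfl]
  exact key i j _ _ _ x

lemma postcomp_precomp {b b' c c' : B.Obj} {n p m : ℤ} (h₁ : n + p = m) (h₂ : p + n = m)
    (f : B.Hom c' c p) (g : B.Hom b b' n) :
    (postcomp B c g).comp (precomp B b' f) h₁ =
      (n * p).negOnePow • (precomp B b f).comp (postcomp B c' g) h₂ := by
  have key : ∀ (i j : ℤ) (h₃ : i + n = i + n) (h₄ : p + (i + n) = j) (h₅ : p + i = i + p)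
      (h₆ : i + p + n = j) (x : B.Hom c b i),
      (p * (i + n)).negOnePow • B.comp h₄ f (B.comp h₃ x g) =
        (n * p).negOnePow • B.comp h₆ ((p * i).negOnePow • B.comp h₅ f x) g := by
    intro i j h₃ h₄ h₅ h₆ x
    rw [B.units_smul_comp, smul_smul, ← Int.negOnePow_add, B.assoc f x g h₅ h₆ h₃ h₄]
    congr 2
    ring
  refine cochain_ext fun i j hij x => ?_
  rw [units_smul_v_apply, comp_v_apply _ _ h₁ i (i + n) j rfl (by omega),
    comp_v_apply _ _ h₂ i (i + p) j rfl (by omega)]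
  exact key i j _ _ _ _ x

variable (B)

/-- The right action of morphisms on `B(-, b)`, as a linear map. -/
def precompₗ (b c c' : B.Obj) (p : ℤ) :
    B.Hom c' c p →ₗ[k] Cochain (B.homComplex c b) (B.homComplex c' b) p where
  toFun f := precomp B b f
  map_add' := precomp_add b
  map_smul' := precomp_smul b

/-- The right dg-module `B(-, b)`. -/
def representable (b : B.Obj) : DGFunctor B.op (Cdg k (ModuleCat.{u} k)) where
  obj c := B.homComplex c b
  map {c c' n} := B.precompₗ b c c' n
  map_id := precomp_id b
  map_comp h f g := precomp_comp b h f g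
  map_d _ _ h f := precomp_d b h f

/-- The natural transformation `B(-, b) → B(-, b')` given by a morphism `b → b'`, as a
linear map. -/
def yonedaMap (b b' : B.Obj) (n : ℤ) :
    B.Hom b b' n →ₗ[k] DGFunctor.natTrans (B.representable b) (B.representable b') n where
  toFun g := ⟨fun c => postcomp B c g, fun _ _ _ _ h₁ h₂ f =>
    postcomp_precomp (B := B) h₁ h₂ f g⟩
  map_add' f g := Subtype.ext (funext fun c => postcomp_add (B := B) c f g)
  map_smul' a f := Subtype.ext (funext fun c => postcomp_smul (B := B) c a f)

/-- The dg-Yoneda embedding `B → dgm(B)`. -/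
def dgYoneda : DGFunctor B B.dgMod where
  obj := B.representable
  map {b b' n} := B.yonedaMap b b' n
  map_id b := Subtype.ext (funext fun c => postcomp_id (B := B) b c)
  map_comp h f g := Subtype.ext (funext fun c => postcomp_comp (B := B) c h f g)
  map_d _ _ h f := Subtype.ext (funext fun c => postcomp_d (B := B) c h f)

/-- The value of a cochain of complexes of modules at an element. -/
def cochainApply {K L : CochainComplex (ModuleCat.{u} k) ℤ} {n j p : ℤ} (h : n + p = j)
    (z : K.X n) : Cochain K L p →ₗ[k] L.X j where
  toFun y := (y.v n j h).hom z
  map_add' _ _ := rfl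
  map_smul' _ _ := rfl

variable {B}

/-- The action of a morphism of `B` on a right dg-module. -/
def act (M : B.dgMod.Obj) {c c' : B.Obj} (i : ℤ) :
    B.Hom c' c i →ₗ[k] Cochain (eval M c) (eval M c') i :=
  DGFunctor.map (A := B.op) (C := Cdg k (ModuleCat.{u} k)) M (X := c) (Y := c') (n := i)

lemma act_id (M : B.dgMod.Obj) (c : B.Obj) : act M 0 (B.id c) = Cochain.ofHom (𝟙 _) :=
  DGFunctor.map_id (A := B.op) (C := Cdg k (ModuleCat.{u} k)) M c

lemma act_units_smul (M : B.dgMod.Obj) {c c' : B.Obj} {n : ℤ} (a : ℤˣ) (f : B.Hom c' c n) :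
    act M n (a • f) = a • act M n f := by
  simp only [Units.smul_def, map_zsmul]

lemma act_d (M : B.dgMod.Obj) {c c' : B.Obj} {n m : ℤ} (h : n + 1 = m) (f : B.Hom c' c n) :
    act M m (B.d n m f) = δ n m (act M n f) :=
  DGFunctor.map_d (A := B.op) (C := Cdg k (ModuleCat.{u} k)) M n m h f

lemma act_comp (M : B.dgMod.Obj) {c c' c'' : B.Obj} {p q n : ℤ} (h : q + p = n) (h' : p + q = n)
    (f : B.Hom c' c p) (g : B.Hom c'' c' q) :
    act M n (B.comp h g f) = (p * q).negOnePow • (act M p f).comp (act M q g) h' := by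
  have e : (act M p f).comp (act M q g) h' = act M n ((p * q).negOnePow • B.comp h g f) :=
    (DGFunctor.map_comp (A := B.op) (C := Cdg k (ModuleCat.{u} k)) M h' f g).symm
  rw [e, act_units_smul, smul_smul, ← Int.negOnePow_add, Int.negOnePow_even _ ⟨_, rfl⟩, one_smul]

/-- The map `B(c, b) → M c` given by an element `z` of `M b` of degree `n`. -/
def ofElement (M : B.dgMod.Obj) {b : B.Obj} {n : ℤ} (z : (eval M b).X n) (c : B.Obj) :
    Cochain (B.homComplex c b) (eval M c) n :=
  Cochain.mk fun i _ hij => ModuleCat.ofHom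
    ((n * i).negOnePow • (cochainApply ((add_comm n i).trans hij) z).comp (act M i))

lemma ofElement_precomp (M : B.dgMod.Obj) {b c c' : B.Obj} {n p m : ℤ} (z : (eval M b).X n)
    (h₁ : n + p = m) (h₂ : p + n = m) (f : B.Hom c' c p) :
    (ofElement M z c).comp (act M p f) h₁ =
      (n * p).negOnePow • (precomp B b f).comp (ofElement M z c') h₂ := by
  have key : ∀ (i j : ℤ) (h₃ : n + i = i + n) (h₄ : i + n + p = j) (h₅ : p + i = i + p)
      (h₆ : n + (i + p) = j) (x : B.Hom c b i),
      ((act M p f).v (i + n) j h₄).hom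
        ((n * i).negOnePow • ((act M i x).v n (i + n) h₃).hom z) =
      (n * p).negOnePow • (n * (i + p)).negOnePow •
        ((act M (i + p) ((p * i).negOnePow • B.comp h₅ f x)).v n j h₆).hom z := by
    intro i j h₃ h₄ h₅ h₆ x
    have e : act M (i + p) ((p * i).negOnePow • B.comp h₅ f x) =
        (act M i x).comp (act M p f) rfl := by
      rw [act_units_smul, act_comp M h₅ rfl x f, mul_comm i p, smul_smul, ← Int.negOnePow_add,
        Int.negOnePow_even _ ⟨_, rfl⟩, one_smul]
    rw [e, comp_v_apply _ _ _ n (i + n) j h₃ h₄ h₆, Units.smul_def, map_zsmul, smul_smul,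
      ← Int.negOnePow_add, ← Units.smul_def, ← mul_add, show n * (p + (i + p)) = n * i + 2 * (n * p)
      by ring, Int.negOnePow_add _ (2 * _), Int.negOnePow_two_mul, mul_one]
  refine cochain_ext fun i j hij x => ?_
  rw [units_smul_v_apply, comp_v_apply _ _ h₁ i (i + n) j rfl (by omega),
    comp_v_apply _ _ h₂ i (i + p) j rfl (by omega)]
  exact key i j _ _ _ _ x

lemma ofElement_d (M : B.dgMod.Obj) {b : B.Obj} {n m : ℤ} (h : n + 1 = m) (z : (eval M b).X n)
    (c : B.Obj) :
    ofElement M (((eval M b).d n m).hom z) c = δ n m (ofElement M z c) := by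
  have key : ∀ (i j : ℤ) (h₁ : m + i = j) (h₂ : n + i = i + n) (h₃ : n + (i + 1) = j)
      (x : B.Hom c b i),
      (m * i).negOnePow • ((act M i x).v m j h₁).hom (((eval M b).d n m).hom z) =
        ((eval M c).d (i + n) j).hom ((n * i).negOnePow • ((act M i x).v n (i + n) h₂).hom z) +
          m.negOnePow • (n * (i + 1)).negOnePow •
            ((act M (i + 1) (B.d i (i + 1) x)).v n j h₃).hom z := by
    intro i j h₁ h₂ h₃ x
    subst h
    rw [act_d M rfl, δ_v_apply rfl _ n j (n + 1) (i + n) h₃ rfl h₂, Units.smul_def (n * i).negOnePow,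
      map_zsmul, ← Units.smul_def, smul_add, smul_add, smul_smul, smul_smul, smul_smul,
      ← Int.negOnePow_add, ← Int.negOnePow_add,
      show n + 1 + n * (i + 1) = n * i + 1 + 2 * n by ring, Int.negOnePow_add _ (2 * n),
      Int.negOnePow_two_mul, mul_one, Int.negOnePow_succ, Units.neg_smul, add_neg_cancel_left,
      show n * i + 1 + 2 * n + (i + 1) = (n + 1) * i + 2 * (n + 1) by ring, Int.negOnePow_add _ (2 * _),
      Int.negOnePow_two_mul, mul_one]
  refine cochain_ext fun i j hij x => ?_
  rw [δ_v_apply h _ i j (i + 1) (i + n) hij rfl rfl]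
  exact key i j _ _ _ x

/-- The morphism `B(-, b) → M` of degree `n` given by an element of `M b` of degree `n`. -/
def yonedaInv (M : B.dgMod.Obj) {b : B.Obj} {n : ℤ} (z : (eval M b).X n) :
    B.dgMod.Hom (B.representable b) M n :=
  ⟨fun c => ofElement M z c, fun _ _ _ _ h₁ h₂ f => ofElement_precomp M z h₁ h₂ f⟩

variable (B) in
/-- The identity of `b`, as an element of the complex `B(b, b)`. -/
def idElement (b : B.Obj) : (B.homComplex b b).X 0 := B.id b

lemma d_idElement (b : B.Obj) : ((B.homComplex b b).d 0 1).hom (B.idElement b) = 0 := B.d_id b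

/-- The element of `M b` given by a morphism `B(-, b) → M` of degree `n`. -/
def yonedaEval (M : B.dgMod.Obj) {b : B.Obj} {n : ℤ} (φ : B.dgMod.Hom (B.representable b) M n) :
    (eval M b).X n :=
  (Cochain.v (F := B.homComplex b b) (G := eval M b) (φ.1 b) 0 n (zero_add n)).hom
    (B.idElement b)

lemma yonedaInv_yonedaEval (M : B.dgMod.Obj) {b : B.Obj} {n : ℤ}
    (φ : B.dgMod.Hom (B.representable b) M n) : yonedaInv M (yonedaEval M φ) = φ := by
  let ψ (c : B.Obj) : Cochain (B.homComplex c b) (eval M c) n := φ.1 c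
  have hψ : ∀ (c : B.Obj) (i j : ℤ) (h₁ : n + i = j) (h₂ : i + n = j) (x : B.Hom c b i),
      (ψ b).comp (act M i x) h₁ = (n * i).negOnePow • (precomp B b x).comp (ψ c) h₂ :=
    fun c i j h₁ h₂ x => φ.2 h₁ h₂ x
  have key : ∀ (c : B.Obj) (i j : ℤ) (hij : i + n = j) (h₁ : n + i = j) (x : B.Hom c b i),
      (n * i).negOnePow • ((act M i x).v n j h₁).hom
        (((ψ b).v 0 n (zero_add n)).hom (B.idElement b)) =
      ((ψ c).v i j hij).hom x := by
    intro c i j hij h₁ x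
    have e := congrArg (fun z : Cochain (B.homComplex b b) (eval M c) j =>
      (z.v 0 j (zero_add j)).hom (B.idElement b)) (hψ c i j h₁ hij x)
    rw [comp_v_apply _ _ h₁ 0 n j (zero_add n) h₁, units_smul_v_apply,
      comp_v_apply _ _ hij 0 i j (zero_add i) hij] at e
    have e' : ((precomp B b x).v 0 i (zero_add i)).hom (B.idElement b) = x := by
      have : (i * 0).negOnePow • B.comp (add_zero i) x (B.id b) = x := by
        rw [B.comp_id, mul_zero, Int.negOnePow_zero, one_smul]
      exact this
    rw [e, e', smul_smul, ← Int.negOnePow_add, Int.negOnePow_even _ ⟨_, rfl⟩, one_smul]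
  exact Subtype.ext (funext fun c => cochain_ext fun i j hij x => key c i j hij _ x)

lemma yonedaInv_d (M : B.dgMod.Obj) {b : B.Obj} {n m : ℤ} (h : n + 1 = m)
    (z : (eval M b).X n) :
    yonedaInv M (((eval M b).d n m).hom z) = B.dgMod.d n m (yonedaInv M z) :=
  Subtype.ext (funext fun c => ofElement_d M h z c)

lemma yonedaEval_d (M : B.dgMod.Obj) {b : B.Obj} {n m : ℤ} (h : n + 1 = m)
    (φ : B.dgMod.Hom (B.representable b) M n) :
    yonedaEval M (B.dgMod.d n m φ) = ((eval M b).d n m).hom (yonedaEval M φ) := by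
  let ψ : Cochain (B.homComplex b b) (eval M b) n := φ.1 b
  have e : ((δ n m ψ).v 0 m (zero_add m)).hom (B.idElement b) =
      ((eval M b).d n m).hom ((ψ.v 0 n (zero_add n)).hom (B.idElement b)) := by
    rw [δ_v_apply h ψ 0 m 1 n (zero_add m) (zero_add 1) (zero_add n), d_idElement, map_zero, smul_zero,
      add_zero]
  exact e

lemma yonedaEval_comp (M : B.dgMod.Obj) {b b' : B.Obj} {n : ℤ} (g : B.Hom b b' 0)
    (φ : B.dgMod.Hom (B.representable b') M n) :
    yonedaEval M (B.dgMod.comp (zero_add n) (B.yonedaMap b b' 0 g) φ) =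
      (Cochain.v (F := B.homComplex b b') (G := eval M b) (φ.1 b) 0 n (zero_add n)).hom g := by
  let ψ : Cochain (B.homComplex b b') (eval M b) n := φ.1 b
  have key : ∀ h : 0 + n = n, (((postcomp B b g).comp ψ h).v 0 n (zero_add n)).hom
      (B.idElement b) = (ψ.v 0 n (zero_add n)).hom g := by
    intro h
    have e : ((postcomp B b g).v 0 0 (zero_add 0)).hom (B.idElement b) = g := B.id_comp g
    rw [comp_v_apply _ _ h 0 0 n (zero_add 0) (zero_add n) (zero_add n), e]
  exact key (zero_add n)

/-- A quasi-isomorphism of complexes of modules is surjective on cohomology. -/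
lemma exists_of_quasiIso {K L : CochainComplex (ModuleCat.{u} k) ℤ} (f : K ⟶ L) [QuasiIso f]
    (y : L.X 0) (hy : (L.d 0 1).hom y = 0) :
    ∃ x : K.X 0, (K.d 0 1).hom x = 0 ∧ ∃ z : L.X (-1), (f.f 0).hom x - y = (L.d (-1) 0).hom z := by
  have h := (HomologicalComplex.epi_homologyMap_iff_up_to_refinements f (-1) 0 1
    (by simp) (by simp)).1 inferInstance (A := ModuleCat.of k k)
    (ModuleCat.ofHom (LinearMap.toSpanSingleton k _ y)) (by
      ext
      simpa using hy)
  obtain ⟨A, π, hπ, x, hx, y', hy'⟩ := h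
  obtain ⟨a, ha⟩ := (ModuleCat.epi_iff_surjective π).1 hπ (1 : k)
  refine ⟨x.hom a, congrArg (fun t => t.hom a) hx, -y'.hom a, ?_⟩
  have e := congrArg (fun t => t.hom a) hy'
  have e' : (1 : k) • y = (f.f 0).hom (x.hom a) + (L.d (-1) 0).hom (y'.hom a) := by
    rw [← ha]
    exact e
  rw [one_smul] at e'
  rw [e', map_neg]
  abel

/-- A quasi-isomorphism of complexes of modules is injective on cohomology. -/
lemma exists_boundary_of_quasiIso {K L : CochainComplex (ModuleCat.{u} k) ℤ} (f : K ⟶ L)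
    [QuasiIso f] (x : K.X 0) (hx : (K.d 0 1).hom x = 0) (z : L.X (-1))
    (hz : (f.f 0).hom x = (L.d (-1) 0).hom z) : ∃ w : K.X (-1), x = (K.d (-1) 0).hom w := by
  have h := (HomologicalComplex.mono_homologyMap_iff_up_to_refinements f (-1) 0 1
    (by simp) (by simp)).1 inferInstance (A := ModuleCat.of k k)
    (ModuleCat.ofHom (LinearMap.toSpanSingleton k _ x)) (by
      ext
      simpa using hx) (ModuleCat.ofHom (LinearMap.toSpanSingleton k _ z)) (by
      ext
      simpa using hz)
  obtain ⟨A, π, hπ, y, hy⟩ := h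
  obtain ⟨a, ha⟩ := (ModuleCat.epi_iff_surjective π).1 hπ (1 : k)
  refine ⟨y.hom a, ?_⟩
  have e' : (1 : k) • x = (K.d (-1) 0).hom (y.hom a) := by
    rw [← ha]
    exact congrArg (fun t => t.hom a) hy
  rwa [one_smul] at e'

/-- If `B(-, b') → M` is a quasi-isomorphism, every morphism `B(-, b) → M` in `H⁰(dgm(B))`
lifts uniquely to a morphism `b → b'` in `H⁰(B)`. -/
lemma existsUnique_lift {M : B.dgMod.Z0} {b b' : B.Obj}
    (q : B.dgYoneda.mapZ0.obj ⟨b'⟩ ⟶ M) (hq : IsQis q)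
    (φ : B.dgMod.toH0.obj (B.dgYoneda.mapZ0.obj ⟨b⟩) ⟶ B.dgMod.toH0.obj M) :
    ∃! g : B.toH0.obj ⟨b⟩ ⟶ B.toH0.obj ⟨b'⟩,
      B.dgYoneda.mapH0.map g ≫ B.dgMod.toH0.map q = φ := by
  have := hq b
  let ψ : B.dgMod.Hom (B.representable b') M.obj 0 := q.1
  apply existsUnique_of_exists_of_unique
  · obtain ⟨φ', rfl⟩ := B.dgMod.toH0.map_surjective φ
    let χ : B.dgMod.Hom (B.representable b) M.obj 0 := φ'.1
    obtain ⟨x, hx, z, hz⟩ := exists_of_quasiIso (evalHom q b) (yonedaEval M.obj χ) (by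
      rw [← yonedaEval_d M.obj (zero_add 1) χ]
      exact (congrArg (yonedaEval M.obj) φ'.2).trans rfl)
    let g : (⟨b⟩ : B.Z0) ⟶ ⟨b'⟩ := ⟨x, hx⟩
    refine ⟨B.toH0.map g, CategoryTheory.Quotient.sound B.dgMod.homotopic
      (f₁ := B.dgYoneda.mapZ0.map g ≫ q) ⟨yonedaInv M.obj z, ?_⟩⟩
    refine Eq.trans ?_ (yonedaInv_d M.obj (neg_add_cancel 1) z)
    rw [← hz]
    refine (yonedaInv_yonedaEval M.obj _).symm.trans (congrArg (yonedaInv M.obj) ?_)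
    exact congrArg (· - yonedaEval M.obj χ) (yonedaEval_comp M.obj (n := 0) x ψ)
  · intro g g' h h'
    obtain ⟨g, rfl⟩ := B.toH0.map_surjective g
    obtain ⟨g', rfl⟩ := B.toH0.map_surjective g'
    obtain ⟨η, hη⟩ := (CategoryTheory.Quotient.functor_map_eq_iff B.dgMod.homotopic
      (B.dgYoneda.mapZ0.map g ≫ q) (B.dgYoneda.mapZ0.map g' ≫ q)).1 (h.trans h'.symm)
    let K : CochainComplex (ModuleCat.{u} k) ℤ := B.homComplex b b'
    let f : K ⟶ eval M.obj b := evalHom q b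
    have hf : QuasiIso f := hq b
    have e : (f.f 0).hom (g.1 - g'.1 : B.Hom b b' 0) =
        ((eval M.obj b).d (-1) 0).hom (yonedaEval M.obj η) := by
      refine Eq.trans ?_ ((congrArg (yonedaEval M.obj) hη).trans
        (yonedaEval_d M.obj (neg_add_cancel 1) η))
      refine (map_sub (f.f 0).hom (g.1 : B.Hom b b' 0) (g'.1 : B.Hom b b' 0)).trans ?_
      exact (congrArg₂ (· - ·) (yonedaEval_comp M.obj (n := 0) g.1 ψ)
        (yonedaEval_comp M.obj (n := 0) g'.1 ψ)).symm
    have hgg : B.d 0 1 (g.1 - g'.1) = 0 := by rw [map_sub, g.2, g'.2, sub_zero]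
    obtain ⟨w, hw⟩ := exists_boundary_of_quasiIso f (g.1 - g'.1 : B.Hom b b' 0) hgg _ e
    exact CategoryTheory.Quotient.sound _ ⟨w, hw⟩

end yoneda

/-! ### Pretriangulated dg-categories -/

variable {κ : Type w} [Field κ]

/-- `Y` is the shift `X[n]`: there is a closed isomorphism `X → Y` of degree `-n`. -/
def IsShift (C : DGCat.{w, v, u₁} κ) (n : ℤ) (X Y : C.Obj) : Prop :=
  ∃ (f : C.Hom X Y (-n)) (g : C.Hom Y X n), C.d (-n) (-n + 1) f = 0 ∧ C.d n (n + 1) g = 0 ∧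
    C.comp (neg_add_cancel n) f g = C.id X ∧ C.comp (add_neg_cancel n) g f = C.id Y

/-- `Z` is the cone of the closed morphism `f : X → Y` of degree `0`: as a graded object it is
the direct sum of `X[1]` and `Y`, with injections `inl` (of degree `-1`), `inr` and projections
`fst` (of degree `1`), `snd`, and its differential is determined by `d inr = 0` and
`d inl = inr ∘ f`. -/
def IsCone (C : DGCat.{w, v, u₁} κ) {X Y : C.Obj} (f : C.Hom X Y 0) (Z : C.Obj) : Prop :=
  ∃ (inl : C.Hom X Z (-1)) (inr : C.Hom Y Z 0) (fst : C.Hom Z X 1) (snd : C.Hom Z Y 0),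
    C.comp (neg_add_cancel 1) inl fst = C.id X ∧ C.comp (add_zero 0) inr snd = C.id Y ∧
    C.comp (add_zero (-1)) inl snd = 0 ∧ C.comp (zero_add 1) inr fst = 0 ∧
    C.comp (add_neg_cancel 1) fst inl + C.comp (add_zero 0) snd inr = C.id Z ∧
    C.d 0 1 inr = 0 ∧ C.d (-1) 0 inl = C.comp (add_zero 0) f inr

/-- The objects of the smallest full dg-subcategory of `C` that contains the objects satisfying
`S` and is closed under shifts and cones (of closed morphisms of degree `0`). -/
inductive PretrHull (C : DGCat.{w, v, u₁} κ) (S : C.Obj → Prop) : C.Obj → Prop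
  | of (X : C.Obj) : S X → PretrHull C S X
  | shift (n : ℤ) (X Y : C.Obj) : PretrHull C S X → C.IsShift n X Y → PretrHull C S Y
  | cone (X Y Z : C.Obj) (f : C.Hom X Y 0) : PretrHull C S X → PretrHull C S Y →
      C.d 0 1 f = 0 → C.IsCone f Z → PretrHull C S Z

/-- `B` is pretriangulated: the dg-Yoneda embedding induces a quasi-equivalence from `B` to the
smallest full dg-subcategory of `dgm(B)` that contains the image of `B` and is closed under
shifts and cones. -/
def IsPretriangulated (B : DGCat.{u, u, u} k) : Prop :=
  (B.dgYoneda.toFullSub (PretrHull B.dgMod fun M => ∃ b, M = B.dgYoneda.obj b)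
    fun b => PretrHull.of _ ⟨b, rfl⟩).IsQuasiEquivalence

end DGCat

/-! ### Quasi-functors and derived categories of bimodules -/

namespace DGFunctor

variable {k : Type w} [Field k] {A' : DGCat.{w, v₁, u₁} k} {A : DGCat.{w, v₂, u₂} k}

/-- The restriction `φ ∘ G` of a natural transformation, as a linear map. -/
def restrictNatTrans (G : DGFunctor A' A) {C : DGCat.{w, v₃, u₃} k} (F F' : DGFunctor A C)
    (n : ℤ) : F.natTrans F' n →ₗ[k] (G.comp F).natTrans (G.comp F') n where
  toFun φ := ⟨fun X => φ.1 (G.obj X), fun _ _ _ _ h₁ h₂ f => φ.2 h₁ h₂ (G.map f)⟩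
  map_add' _ _ := rfl
  map_smul' _ _ := rfl

/-- The restriction dg-functor `Fun_dg(A, C) → Fun_dg(A', C)`, `F ↦ F ∘ G`. -/
def precomp (G : DGFunctor A' A) (C : DGCat.{w, v₃, u₃} k) :
    DGFunctor (A.dgFun C) (A'.dgFun C) where
  obj F := G.comp F
  map {F F' n} := G.restrictNatTrans F F' n
  map_id _ := rfl
  map_comp _ _ _ := rfl
  map_d _ _ _ _ := rfl

end DGFunctor

section

variable {k : Type u} [Field k]

/-- The dg-category of `A`-`B`-dg-bimodules, that is, of dg-functors `A → dgm(B)`. -/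
abbrev DGBimod (A B : DGCat.{u, u, u} k) : DGCat.{u, u, u + 1} k := A.dgFun B.dgMod

namespace DGBimod

variable {A' A B : DGCat.{u, u, u} k}

/-- The morphism of dg-modules `F a → G a` underlying a morphism of bimodules. -/
def evalHom {F G : (DGBimod A B).Z0} (φ : F ⟶ G) (a : A.Obj) :
    (⟨DGFunctor.obj F.obj a⟩ : B.dgMod.Z0) ⟶ ⟨DGFunctor.obj G.obj a⟩ :=
  ⟨φ.1.1 a, congrFun (congrArg Subtype.val φ.2) a⟩

/-- A quasi-isomorphism of dg-bimodules. -/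
def IsQis {F G : (DGBimod A B).Z0} (φ : F ⟶ G) : Prop := ∀ a : A.Obj, DGCat.IsQis (evalHom φ a)

variable (A B) in
/-- The class of quasi-isomorphisms in the homotopy category of dg-bimodules. -/
def qis : MorphismProperty (DGBimod A B).H0 := fun F G f =>
  ∃ φ : F.as ⟶ G.as, IsQis φ ∧ (DGBimod A B).toH0.map φ = f

variable (A B) in
/-- The derived category `D(B ⊗ Aᵒᵖ)` of `A`-`B`-dg-bimodules. -/
abbrev Derived : Type (u + 1) := (qis A B).Localization

/-- A dg-bimodule, as an object of the derived category. -/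
abbrev toDerived (F : (DGBimod A B).Obj) : Derived A B :=
  (qis A B).Q.obj ((DGBimod A B).toH0.obj ⟨F⟩)

lemma qis_mapH0_precomp (G : DGFunctor A' A) :
    (qis A B).IsInvertedBy ((G.precomp B.dgMod).mapH0 ⋙ (qis A' B).Q) := by
  rintro F F' _ ⟨φ, hφ, rfl⟩
  refine (qis A' B).Q_inverts _ ⟨(G.precomp B.dgMod).mapZ0.map φ, fun a => ?_, rfl⟩
  have h := hφ (G.obj a)
  exact h

/-- The restriction functor `D(B ⊗ Aᵒᵖ) ⥤ D(B ⊗ A'ᵒᵖ)` along a dg-functor `A' → A`. -/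
noncomputable def restriction (G : DGFunctor A' A) : Derived A B ⥤ Derived A' B :=
  Localization.Construction.lift ((G.precomp B.dgMod).mapH0 ⋙ (qis A' B).Q)
    (qis_mapH0_precomp G)

lemma restriction_obj (G : DGFunctor A' A) (F : DGFunctor A B.dgMod) :
    (restriction G).obj (toDerived (A := A) (B := B) F) =
      toDerived (A := A') (B := B) (G.comp F) := rfl

end DGBimod

/-- A quasi-functor `A → B`: a dg-functor `F : A → dgm(B)` such that for every object `a` there
are an object `Φ a` of `B` and a quasi-isomorphism `B(-, Φ a) → F a`. -/
structure QuasiFunctor (A B : DGCat.{u, u, u} k) where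
  bimod : DGFunctor A B.dgMod
  quasiRep : ∀ a : A.Obj, ∃ (b : B.Obj)
    (q : B.dgYoneda.mapZ0.obj ⟨b⟩ ⟶ bimod.mapZ0.obj ⟨a⟩), DGCat.IsQis q

namespace QuasiFunctor

variable {A' A B : DGCat.{u, u, u} k}

/-- The object `Φ a` of `B` that quasi-represents `F a`. -/
noncomputable def Φ (F : QuasiFunctor A B) (a : A.Obj) : B.Obj := (F.quasiRep a).choose

/-- The quasi-isomorphism `B(-, Φ a) → F a`. -/
noncomputable def q (F : QuasiFunctor A B) (a : A.Obj) :
    B.dgYoneda.mapZ0.obj ⟨F.Φ a⟩ ⟶ F.bimod.mapZ0.obj ⟨a⟩ :=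
  (F.quasiRep a).choose_spec.choose

lemma isQis_q (F : QuasiFunctor A B) (a : A.Obj) : DGCat.IsQis (F.q a) :=
  (F.quasiRep a).choose_spec.choose_spec

/-- The quasi-isomorphism `B(-, Φ a) → F a`, as a morphism in `H⁰(dgm(B))`. -/
noncomputable def qH0 (F : QuasiFunctor A B) (X : A.H0) :
    B.dgYoneda.mapH0.obj (B.toH0.obj ⟨F.Φ X.as.obj⟩) ⟶ F.bimod.mapH0.obj X :=
  B.dgMod.toH0.map (F.q X.as.obj)

lemma existsUnique_map (F : QuasiFunctor A B) {X Y : A.H0} (f : X ⟶ Y) :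
    ∃! g : B.toH0.obj ⟨F.Φ X.as.obj⟩ ⟶ B.toH0.obj ⟨F.Φ Y.as.obj⟩,
      B.dgYoneda.mapH0.map g ≫ F.qH0 Y = F.qH0 X ≫ F.bimod.mapH0.map f :=
  DGCat.existsUnique_lift (F.q Y.as.obj) (F.isQis_q Y.as.obj) _

/-- The functor `H⁰(F) : H⁰(A) ⥤ H⁰(B)` induced by a quasi-functor: it sends `a` to `Φ a`, and a
morphism `f : a → a'` to the unique morphism `Φ a → Φ a'` that is compatible with `F f` through
the quasi-isomorphisms `B(-, Φ a) → F a` and `B(-, Φ a') → F a'`. -/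
noncomputable def H0 (F : QuasiFunctor A B) : A.H0 ⥤ B.H0 where
  obj X := B.toH0.obj ⟨F.Φ X.as.obj⟩
  map f := (F.existsUnique_map f).choose
  map_id X := (F.existsUnique_map (𝟙 X)).unique (F.existsUnique_map (𝟙 X)).choose_spec.1 (by
    rw [CategoryTheory.Functor.map_id, CategoryTheory.Functor.map_id, Category.id_comp, Category.comp_id])
  map_comp {X Y Z} f g := (F.existsUnique_map (f ≫ g)).unique
    (F.existsUnique_map (f ≫ g)).choose_spec.1 (by
      have h₁ := (F.existsUnique_map f).choose_spec.1
      have h₂ := (F.existsUnique_map g).choose_spec.1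
      rw [Functor.map_comp, Category.assoc, h₂, ← Category.assoc, h₁, Category.assoc,
        Functor.map_comp])

/-- The composition `F ∘ G : A' → B` of a quasi-functor `F : A → B` with a dg-functor
`G : A' → A`. -/
def restrict (F : QuasiFunctor A B) (G : DGFunctor A' A) : QuasiFunctor A' B where
  bimod := G.comp F.bimod
  quasiRep a := F.quasiRep (G.obj a)

/-- The isomorphisms of quasi-functors: isomorphisms in the derived category of dg-bimodules. -/
abbrev Iso (F F' : QuasiFunctor A B) : Type (u + 1) :=
  DGBimod.toDerived (A := A) (B := B) F.bimod ≅ DGBimod.toDerived (A := A) (B := B) F'.bimod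

/-- The restriction `φ ∘ G : F ∘ G ≅ F' ∘ G` of an isomorphism of quasi-functors. -/
noncomputable def Iso.restrict {F F' : QuasiFunctor A B} (φ : Iso F F') (G : DGFunctor A' A) :
    Iso (F.restrict G) (F'.restrict G) :=
  (DGBimod.restriction G).mapIso φ

/-- `H⁰(F)` preserves countable direct sums. -/
def PreservesCountableSums (F : QuasiFunctor A B) : Prop :=
  ∀ (J : Type) [Countable J], PreservesColimitsOfShape (Discrete J) F.H0

end QuasiFunctor

end

/-!
Let `i' : C⁺ → C` be the inclusion of the bounded below complexes in `C = C_dg(I)`. Restriction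
along `i'` is shown to be bijective on all morphisms between quasi-functors that preserve
countable sums, in the derived categories of bimodules (`QuasiFunctor.bijective_restriction_map`);
hence isomorphisms lift.

Morphisms `F → G` in the derived category are computed by an h-injective resolution of `G`. Over a
field there is an explicit one, valid for any dg-category `A` and any target with enough limits:
the cobar resolution `M → W M → W (W M) → ⋯` of a dg-functor `M` on `A`, where `W M X = ∏ Y,
Hom_k(A(X, Y), M Y)` is the cofree dg-functor (`cofree`, `cobarObj`). It is objectwise a homotopy
equivalence (`exists_cobarObj_contraction`), and natural transformations from `F` to `W M` are
families of morphisms `F Y → M Y` (`bijective_natTrans_coind`). Applied over `B` and then over `A`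
it gives the resolution `bimodRes G`, built from products of cotensors of h-injective modules (all
complexes of vector spaces being h-injective); so a quasi-isomorphism `F → F'` is a
quasi-isomorphism on morphisms to `bimodRes G` (`isQuasiIso_precompHom_cobarObj`), and morphisms
to `bimodRes G` in the derived category are homotopy classes (`MorphismProperty.bijective_Q_map`).

Let `P` be a property of objects of `A`, such as being bounded below, and suppose that each `Y` is
exhausted by degreewise split subobjects `Y n` satisfying `P`, such that each morphism from an
object satisfying `P` to `Y` factors through some `Y n` (`Exhaustion`). Then `A(-, Y)`, restricted
to `P`, is the sequential colimit of the representable functors of the `Y n`, and natural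
transformations from `M` to `W N` over `P` are families in the limits `lim n, C(M (Y n), N Y)`
(`bijective_subCoindₗ`). These are limits of towers of surjections, hence preserve
quasi-isomorphisms. This has two consequences. The restriction of `bimodRes G` to `P` is still
h-injective (`isQuasiIso_precompHom_sub_cobarObj`). And restriction to `P` of morphisms from `F`
to `bimodRes G` is a quasi-isomorphism as soon as `F Y` is the homotopy colimit of the `F (Y n)`
(`isQuasiIso_restrictHom_cobarObj`).

The last condition holds when `F` preserves countable sums and `Y` is the cokernel of the
difference of the identity and the shift on the sum of the `Y n`, with a degreewise splitting
(`Exhaustion.Presentation`, `isQuasiIso_homLimHom`, `QuasiFunctor.isQuasiIso_precompPi`). A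
complex has such a presentation by its stupid truncations in degrees `≥ -n` (`exhaustionTrunc`,
`nonempty_presentation_trunc`): in each degree the sequence of truncations is `0` up to some point
and constant afterwards.
-/

/-! ### Complexes of vector spaces, elementwise -/

/-- A cochain complex of `k`-vector spaces, in the elementwise form of the complexes of morphisms
of a `DGCat`: only the components `d n (n + 1)` of the differential matter. -/
structure Cplx (k : Type w) [Field k] where
  X : ℤ → Type v
  [addCommGroup : ∀ n, AddCommGroup (X n)]
  [module : ∀ n, Module k (X n)]
  d : ∀ n m : ℤ, X n →ₗ[k] X m
  d_d : ∀ (n m l : ℤ) (x : X n), n + 1 = m → m + 1 = l → d m l (d n m x) = 0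

attribute [instance] Cplx.addCommGroup Cplx.module

namespace Cplx

variable {k : Type w} [Field k]

/-- A chain map. -/
structure Hom (K : Cplx.{w, v₁} k) (L : Cplx.{w, v₂} k) where
  f : ∀ n, K.X n →ₗ[k] L.X n
  comm : ∀ (n m : ℤ) (_ : n + 1 = m) (x : K.X n), f m (K.d n m x) = L.d n m (f n x)

/-- Every cocycle is a coboundary. -/
def Acyclic (K : Cplx.{w, v} k) : Prop :=
  ∀ (l n m : ℤ) (_ : l + 1 = n) (_ : n + 1 = m) (x : K.X n), K.d n m x = 0 → ∃ y, K.d l n y = x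

/-- A quasi-isomorphism, in the form "the mapping cone is acyclic" (see `Hom.isQuasiIso_iff`):
up to signs, `(b, x)` is a cocycle of the cone and the coboundary of `(c, y)`. -/
def Hom.IsQuasiIso {K : Cplx.{w, v₁} k} {L : Cplx.{w, v₂} k} (u : K.Hom L) : Prop :=
  ∀ (l n m m' : ℤ) (_ : l + 1 = n) (_ : n + 1 = m) (_ : m + 1 = m') (b : K.X m) (x : L.X n),
    K.d m m' b = 0 → L.d n m x = u.f m b →
      ∃ (c : K.X n) (y : L.X l), K.d n m c = b ∧ u.f n c + L.d l n y = x

/-- A quasi-isomorphism is surjective on cohomology. -/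
lemma Hom.IsQuasiIso.exists_lift {K : Cplx.{w, v₁} k} {L : Cplx.{w, v₂} k} {u : K.Hom L}
    (h : u.IsQuasiIso) {l n m : ℤ} (hl : l + 1 = n) (hn : n + 1 = m) (x : L.X n)
    (hx : L.d n m x = 0) : ∃ (c : K.X n) (y : L.X l), K.d n m c = 0 ∧ u.f n c + L.d l n y = x :=
  h l n m _ hl hn rfl 0 x (by simp) (by simpa using hx)

/-- A quasi-isomorphism is injective on cohomology. -/
lemma Hom.IsQuasiIso.exists_boundary {K : Cplx.{w, v₁} k} {L : Cplx.{w, v₂} k} {u : K.Hom L}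
    (h : u.IsQuasiIso) {n m m' : ℤ} (hn : n + 1 = m) (hm : m + 1 = m') (b : K.X m)
    (hb : K.d m m' b = 0) (x : L.X n) (hx : L.d n m x = u.f m b) : ∃ c, K.d n m c = b := by
  obtain ⟨c, _, hc, _⟩ := h (n - 1) n m m' (by omega) hn hm b x hb hx
  exact ⟨c, hc⟩

/-- The product of a family of complexes. -/
def pi {ι : Type u} (K : ι → Cplx.{w, v} k) : Cplx.{w, max u v} k where
  X n := ∀ i, (K i).X n
  d n m := LinearMap.pi fun i => (K i).d n m ∘ₗ LinearMap.proj i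
  d_d n m l x h₁ h₂ := funext fun i => (K i).d_d n m l (x i) h₁ h₂

/-- The product of a family of chain maps. -/
def Hom.pi {ι : Type u} {K : ι → Cplx.{w, v₁} k} {L : ι → Cplx.{w, v₂} k}
    (f : ∀ i, (K i).Hom (L i)) : (Cplx.pi K).Hom (Cplx.pi L) where
  f n := LinearMap.pi fun i => (f i).f n ∘ₗ LinearMap.proj i
  comm n m h x := funext fun i => (f i).comm n m h (x i)

lemma Hom.IsQuasiIso.pi {ι : Type u} {K : ι → Cplx.{w, v₁} k} {L : ι → Cplx.{w, v₂} k}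
    {f : ∀ i, (K i).Hom (L i)} (h : ∀ i, (f i).IsQuasiIso) : (Hom.pi f).IsQuasiIso := by
  intro l n m m' hl hn hm b x hb hx
  choose c y hc hy using fun i => h i l n m m' hl hn hm (b i) (x i) (congrFun hb i) (congrFun hx i)
  exact ⟨c, y, funext hc, funext hy⟩

/-- Quasi-isomorphisms are invariant under (degreewise bijective) isomorphisms of source and
target. -/
lemma Hom.IsQuasiIso.of_bijective {K K' : Cplx.{w, v} k} {L L' : Cplx.{w, v} k} {u : K.Hom L}
    {u' : K'.Hom L'} (a : K.Hom K') (b : L.Hom L') (ha : ∀ n, Function.Bijective (a.f n))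
    (hb : ∀ n, Function.Bijective (b.f n)) (h : ∀ n x, b.f n (u.f n x) = u'.f n (a.f n x))
    (hu : u'.IsQuasiIso) : u.IsQuasiIso := by
  intro l n m m' hl hn hm z x hz hx
  obtain ⟨c, y, hc, hy⟩ := hu l n m m' hl hn hm (a.f m z) (b.f n x)
    (by rw [← a.comm _ _ hm, hz, map_zero]) (by rw [← b.comm _ _ hn, hx, h])
  obtain ⟨c, rfl⟩ := (ha n).2 c
  obtain ⟨y, rfl⟩ := (hb l).2 y
  refine ⟨c, y, (ha m).1 (by rw [a.comm _ _ hn, hc]), (hb n).1 ?_⟩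
  rw [map_add, h, b.comm _ _ hl, hy]

/-- Two-out-of-three for a morphism of short exact sequences of complexes; exactness is only
needed where the diagram chase uses it. -/
lemma Hom.IsQuasiIso.of_shortExact {K' K K'' : Cplx.{w, v₁} k} {L' L L'' : Cplx.{w, v₂} k}
    {u' : K'.Hom L'} {u : K.Hom L} {u'' : K''.Hom L''} (f : K'.Hom K) (g : K.Hom K'')
    (f' : L'.Hom L) (g' : L.Hom L'') (hf : ∀ n, Function.Injective (f.f n))
    (hf' : ∀ n, Function.Injective (f'.f n)) (hg : ∀ n, Function.Surjective (g.f n))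
    (hg' : ∀ n, Function.Surjective (g'.f n)) (hfg : ∀ n x, g.f n (f.f n x) = 0)
    (hfg' : ∀ n x, g'.f n (f'.f n x) = 0) (he : ∀ n x, g.f n x = 0 → ∃ y, f.f n y = x)
    (he' : ∀ n x, g'.f n x = 0 → ∃ y, f'.f n y = x)
    (huf : ∀ n x, f'.f n (u'.f n x) = u.f n (f.f n x))
    (hug : ∀ n x, g'.f n (u.f n x) = u''.f n (g.f n x)) (hu : u.IsQuasiIso)
    (hu'' : u''.IsQuasiIso) : u'.IsQuasiIso := by
  intro l n m m' hl hn hm b x hb hx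
  obtain ⟨c, y, hc, hy⟩ := hu l n m m' hl hn hm (f.f m b) (f'.f n x)
    (by rw [← f.comm _ _ hm, hb, map_zero]) (by rw [← f'.comm _ _ hn, hx, huf])
  obtain ⟨c₂, y₂, hc₂, hy₂⟩ := hu'' (l - 1) l n m (by omega) hl hn (g.f n c) (-g'.f l y)
    (by rw [← g.comm _ _ hn, hc, hfg])
    (by rw [map_neg, ← g'.comm _ _ hl, ← hug, eq_sub_of_add_eq' hy, map_sub, hfg', zero_sub,
      neg_neg])
  obtain ⟨c₃, rfl⟩ := hg _ c₂
  obtain ⟨y₃, rfl⟩ := hg' _ y₂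
  obtain ⟨c₀, hc₀⟩ := he n (c - K.d l n c₃) (by rw [map_sub, g.comm _ _ hl, hc₂, sub_self])
  obtain ⟨y₀, hy₀⟩ := he' l (y + u.f l c₃ + L.d (l - 1) l y₃) (by
    rw [map_add, map_add, hug, g'.comm _ _ (by omega), add_assoc, hy₂, add_neg_cancel])
  refine ⟨c₀, y₀, hf m ?_, hf' n ?_⟩
  · rw [f.comm _ _ hn, hc₀, map_sub, K.d_d _ _ _ _ hl hn, sub_zero, hc]
  · rw [map_add, huf, hc₀, f'.comm _ _ hl, hy₀, map_add, map_add, L.d_d _ _ _ _ (by omega) hl,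
      map_sub, ← u.comm _ _ hl, ← hy]
    abel

/-- Over a field, an acyclic complex is contractible. -/
lemma Acyclic.exists_contraction {K : Cplx.{w, v} k} (hK : K.Acyclic) :
    ∃ s : ∀ n m : ℤ, K.X n →ₗ[k] K.X m, ∀ (l n m : ℤ) (_ : l + 1 = n) (_ : n + 1 = m) (x : K.X n),
      K.d l n (s n l x) + s m n (K.d n m x) = x := by
  -- a linear section `σ` of the differential onto its image
  have h : ∀ l n : ℤ, ∃ σ : K.X n →ₗ[k] K.X l, ∀ y, K.d l n (σ (K.d l n y)) = K.d l n y := by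
    intro l n
    obtain ⟨g, hg⟩ := (K.d l n).rangeRestrict.exists_rightInverse_of_surjective
      (K.d l n).range_rangeRestrict
    obtain ⟨σ, hσ⟩ := g.exists_extend
    refine ⟨σ, fun y => ?_⟩
    have h₁ : σ (K.d l n y) = g ((K.d l n).rangeRestrict y) :=
      LinearMap.congr_fun hσ ((K.d l n).rangeRestrict y)
    rw [h₁]
    exact congrArg Subtype.val (LinearMap.congr_fun hg ((K.d l n).rangeRestrict y))
  choose σ hσ using h
  refine ⟨fun n m => σ m n - σ m n ∘ₗ σ n (n + 1) ∘ₗ K.d n (n + 1), fun l n m hl hn x => ?_⟩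
  have hx : K.d n m (x - σ n m (K.d n m x)) = 0 := by rw [map_sub, hσ, sub_self]
  obtain ⟨y, hy⟩ := hK l n m hl hn _ hx
  subst hn
  simp only [LinearMap.sub_apply, LinearMap.comp_apply, map_sub]
  rw [K.d_d n _ _ x rfl rfl, map_zero, map_zero, sub_zero, ← map_sub, ← map_sub, ← hy, hσ, hy]
  simp

/-- A decomposition of the complex `K` as the total complex of a sequence of complexes `G n` (with
degrees and signs of the differentials already adjusted): the elements of `K` are sequences, and
the differential of `x` has components `d (x n) + D (x (n - 1))`. -/
structure TotDecomp (K : Cplx.{w, v} k) (G : ℕ → Cplx.{w, v} k) where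
  p : ∀ n m, K.X m →ₗ[k] (G n).X m
  D : ∀ n m m', m + 1 = m' → (G n).X m →ₗ[k] (G (n + 1)).X m'
  p_zero : ∀ (m m' : ℤ) (_ : m + 1 = m') (x : K.X m), p 0 m' (K.d m m' x) = (G 0).d m m' (p 0 m x)
  p_succ : ∀ (n : ℕ) (m m' : ℤ) (h : m + 1 = m') (x : K.X m),
    p (n + 1) m' (K.d m m' x) = (G (n + 1)).d m m' (p (n + 1) m x) + D n m m' h (p n m x)
  D_d : ∀ (n : ℕ) (m m' m'' : ℤ) (h : m + 1 = m') (h' : m' + 1 = m'') (x : (G n).X m),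
    (G (n + 1)).d m' m'' (D n m m' h x) + D n m' m'' h' ((G n).d m m' x) = 0
  D_D : ∀ (n : ℕ) (m m' m'' : ℤ) (h : m + 1 = m') (h' : m' + 1 = m'') (x : (G n).X m),
    D (n + 1) m' m'' h' (D n m m' h x) = 0
  ext : ∀ (m : ℤ) (x y : K.X m), (∀ n, p n m x = p n m y) → x = y
  lift : ∀ (m : ℤ) (θ : ∀ n, (G n).X m), ∃ x, ∀ n, p n m x = θ n

/-- A map of total complexes that is a quasi-isomorphism on each term is a quasi-isomorphism: the
components of the required elements are found by recursion. -/
lemma TotDecomp.isQuasiIso {K : Cplx.{w, v₁} k} {G : ℕ → Cplx.{w, v₁} k} {L : Cplx.{w, v₂} k}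
    {H : ℕ → Cplx.{w, v₂} k} (s : TotDecomp K G) (t : TotDecomp L H) (u : K.Hom L)
    (v : ∀ n, (G n).Hom (H n)) (hp : ∀ n m x, t.p n m (u.f m x) = (v n).f m (s.p n m x))
    (hD : ∀ n m m' h x, t.D n m m' h ((v n).f m x) = (v (n + 1)).f m' (s.D n m m' h x))
    (hv : ∀ n, (v n).IsQuasiIso) : u.IsQuasiIso := by
  intro l a m m' hl ha hm b x hb hx
  have hb0 : (G 0).d m m' (s.p 0 m b) = 0 := by rw [← s.p_zero _ _ hm, hb, map_zero]
  have hbs : ∀ n, (G (n + 1)).d m m' (s.p (n + 1) m b) + s.D n m m' hm (s.p n m b) = 0 := by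
    intro n
    rw [← s.p_succ _ _ _ hm, hb, map_zero]
  have hx0 : (H 0).d a m (t.p 0 a x) = (v 0).f m (s.p 0 m b) := by
    rw [← t.p_zero _ _ ha, hx, hp]
  have hxs : ∀ n, (H (n + 1)).d a m (t.p (n + 1) a x) + t.D n a m ha (t.p n a x) =
      (v (n + 1)).f m (s.p (n + 1) m b) := by
    intro n
    rw [← t.p_succ _ _ _ ha, hx, hp]
  -- the equations that the components in degree `n` must satisfy to allow the next step
  let Inv (n : ℕ) (z : (G n).X a × (H n).X l) : Prop :=
    (G (n + 1)).d m m' (s.p (n + 1) m b - s.D n a m ha z.1) = 0 ∧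
    (H (n + 1)).d a m (t.p (n + 1) a x - t.D n l a hl z.2) =
      (v (n + 1)).f m (s.p (n + 1) m b - s.D n a m ha z.1)
  have inv : ∀ n (b₁ : (G n).X m) (x₁ : (H n).X a) (z : (G n).X a × (H n).X l),
      s.D n m m' hm b₁ = s.D n m m' hm (s.p n m b) →
      t.D n a m ha x₁ = t.D n a m ha (t.p n a x) →
      (G n).d a m z.1 = b₁ → (v n).f a z.1 + (H n).d l a z.2 = x₁ → Inv n z := by
    intro n b₁ x₁ z h₁ h₂ h₃ h₄
    have e₁ := s.D_d n a m m' ha hm z.1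
    have e₂ := t.D_d n l a m hl ha z.2
    constructor
    · rw [map_sub, eq_neg_of_add_eq_zero_left (hbs n), eq_neg_of_add_eq_zero_left e₁, h₃, h₁,
        sub_self]
    · rw [map_sub, map_sub, eq_neg_of_add_eq_zero_left e₂, eq_sub_of_add_eq (hxs n), ← h₂, ← h₄,
        map_add, hD]
      abel
  have step : ∀ n (z : { z // Inv n z }), ∃ z' : { z // Inv (n + 1) z },
      (G (n + 1)).d a m z'.1.1 = s.p (n + 1) m b - s.D n a m ha z.1.1 ∧
      (v (n + 1)).f a z'.1.1 + (H (n + 1)).d l a z'.1.2 =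
        t.p (n + 1) a x - t.D n l a hl z.1.2 := by
    rintro n ⟨z, hz⟩
    obtain ⟨c, y, hc, hy⟩ := hv (n + 1) l a m m' hl ha hm _ _ hz.1 hz.2
    refine ⟨⟨(c, y), inv (n + 1) _ _ (c, y) ?_ ?_ hc hy⟩, hc, hy⟩
    · rw [map_sub, s.D_D, sub_zero]
    · rw [map_sub, t.D_D, sub_zero]
  obtain ⟨c, y, hc, hy⟩ := hv 0 l a m m' hl ha hm _ _ hb0 hx0
  choose F hF using step
  let z : ∀ n, { z // Inv n z } := fun n =>
    Nat.rec ⟨(c, y), inv 0 _ _ (c, y) rfl rfl hc hy⟩ F n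
  obtain ⟨C, hC⟩ := s.lift a fun n => (z n).1.1
  obtain ⟨Y, hY⟩ := t.lift l fun n => (z n).1.2
  refine ⟨C, Y, s.ext _ _ _ fun n => ?_, t.ext _ _ _ fun n => ?_⟩
  · cases n with
    | zero => rw [s.p_zero _ _ ha, hC]; exact hc
    | succ n =>
      rw [s.p_succ _ _ _ ha, hC, hC, show z (n + 1) = F n (z n) from rfl, (hF n (z n)).1]
      abel
  · cases n with
    | zero => rw [map_add, hp, t.p_zero _ _ hl, hC, hY]; exact hy
    | succ n =>
      rw [map_add, hp, t.p_succ _ _ _ hl, hC, hY, hY, show z (n + 1) = F n (z n) from rfl,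
        ← add_assoc, (hF n (z n)).2]
      abel

end Cplx

lemma Int.negOnePow_congr {a b : ℤ} (c : ℤ) (h : a = b + 2 * c) : a.negOnePow = b.negOnePow := by
  rw [h, Int.negOnePow_add, Int.negOnePow_two_mul, mul_one]

lemma Int.eq_negOnePow_smul_symm {M : Type*} [AddCommGroup M] {x y : M} {n : ℤ}
    (h : x = n.negOnePow • y) : y = n.negOnePow • x := by
  rw [h, smul_smul, ← Int.negOnePow_add, Int.negOnePow_even _ ⟨_, rfl⟩, one_smul]

namespace DGCat

variable {k : Type w} [Field k]

/-! ### Complexes of morphisms -/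

section homCplx

variable (C : DGCat.{w, v, u} k)

/-- The complex of morphisms `X → Y`. -/
abbrev homCplx (X Y : C.Obj) : Cplx.{w, v} k where
  X n := C.Hom X Y n
  d n m := C.d n m
  d_d n m l x h₁ h₂ := C.d_d n m l x h₁ h₂

lemma d_comp_of_closed {X Y Z : C.Obj} {n m : ℤ} (h : n + 1 = m) {a : C.Hom X Y 0}
    (ha : C.d 0 1 a = 0) (x : C.Hom Y Z n) :
    C.d n m (C.comp (zero_add n) a x) = C.comp (zero_add m) a (C.d n m x) := by
  rw [C.leibniz a x (zero_add n) (zero_add 1) h h (zero_add m) (by omega), ha]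
  simp

lemma d_comp_closed {X Y Z : C.Obj} {n m : ℤ} (h : n + 1 = m) (x : C.Hom X Y n)
    {a : C.Hom Y Z 0} (ha : C.d 0 1 a = 0) :
    C.d n m (C.comp (add_zero n) x a) = C.comp (add_zero m) (C.d n m x) a := by
  rw [C.leibniz x a (add_zero n) h (zero_add 1) h (by omega) (add_zero m), ha]
  simp

/-- Precomposition with a closed morphism of degree `0`. -/
abbrev precompHom {X X' : C.Obj} (a : C.Hom X X' 0) (ha : C.d 0 1 a = 0) (Z : C.Obj) :
    (C.homCplx X' Z).Hom (C.homCplx X Z) where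
  f n := C.comp (zero_add n) a
  comm _ _ h x := (C.d_comp_of_closed h ha x).symm

/-- A closed morphism of degree `0`, as a morphism of `H⁰(C)`. -/
def mkH0 {X Y : C.Obj} (f : C.Hom X Y 0) (hf : C.d 0 1 f = 0) :
    C.toH0.obj ⟨X⟩ ⟶ C.toH0.obj ⟨Y⟩ :=
  C.toH0.map (X := ⟨X⟩) (Y := ⟨Y⟩) ⟨f, hf⟩

variable {C}

lemma mkH0_surjective {X Y : C.Obj} (f : C.toH0.obj ⟨X⟩ ⟶ C.toH0.obj ⟨Y⟩) :
    ∃ (g : C.Hom X Y 0) (hg : C.d 0 1 g = 0), C.mkH0 g hg = f := by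
  obtain ⟨g, rfl⟩ := C.toH0.map_surjective f
  exact ⟨g.1, g.2, rfl⟩

lemma mkH0_eq_iff {X Y : C.Obj} {f g : C.Hom X Y 0} (hf : C.d 0 1 f = 0) (hg : C.d 0 1 g = 0) :
    C.mkH0 f hf = C.mkH0 g hg ↔ ∃ h : C.Hom X Y (-1), f - g = C.d (-1) 0 h :=
  CategoryTheory.Quotient.functor_map_eq_iff C.homotopic (X := ⟨X⟩) (Y := ⟨Y⟩) ⟨f, hf⟩ ⟨g, hg⟩

lemma closed_comp {X Y Z : C.Obj} {f : C.Hom X Y 0} {g : C.Hom Y Z 0} (hf : C.d 0 1 f = 0)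
    (hg : C.d 0 1 g = 0) : C.d 0 1 (C.comp (add_zero 0) f g) = 0 := by
  rw [C.d_comp_of_closed (zero_add 1) hf, hg, map_zero]

lemma mkH0_comp {X Y Z : C.Obj} {f : C.Hom X Y 0} {g : C.Hom Y Z 0} (hf : C.d 0 1 f = 0)
    (hg : C.d 0 1 g = 0) :
    C.mkH0 f hf ≫ C.mkH0 g hg = C.mkH0 (C.comp (add_zero 0) f g) (closed_comp hf hg) :=
  (C.toH0.map_comp (X := ⟨X⟩) (Y := ⟨Y⟩) (Z := ⟨Z⟩) ⟨f, hf⟩ ⟨g, hg⟩).symm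

variable (C)

/-- Precomposition with `a` is bijective on morphisms of `H⁰(C)` if it is a quasi-isomorphism on
complexes of morphisms. -/
lemma bijective_comp_of_isQuasiIso {X X' : C.Obj} (a : C.Hom X X' 0) (ha : C.d 0 1 a = 0)
    (Z : C.Obj) (h : (C.precompHom a ha Z).IsQuasiIso) :
    Function.Bijective fun f : C.toH0.obj ⟨X'⟩ ⟶ C.toH0.obj ⟨Z⟩ => C.mkH0 a ha ≫ f := by
  constructor
  · intro f g hfg
    obtain ⟨f, hf, rfl⟩ := mkH0_surjective f
    obtain ⟨g, hg, rfl⟩ := mkH0_surjective g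
    dsimp only at hfg
    rw [mkH0_comp, mkH0_comp, mkH0_eq_iff] at hfg
    obtain ⟨η, hη⟩ := hfg
    obtain ⟨c, hc⟩ := h.exists_boundary (n := -1) (m := 0) (by norm_num) (zero_add 1) (f - g)
      (by simp only [map_sub, hf, hg, sub_zero]) η (by rw [← hη, map_sub])
    exact (mkH0_eq_iff hf hg).2 ⟨c, hc.symm⟩
  · intro f
    obtain ⟨f, hf, rfl⟩ := mkH0_surjective f
    obtain ⟨c, y, hc, hy⟩ := h.exists_lift (l := -1) (n := 0) (by norm_num) (zero_add 1) f hf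
    refine ⟨C.mkH0 c hc, ?_⟩
    dsimp only
    rw [mkH0_comp, mkH0_eq_iff]
    exact ⟨-y, by rw [map_neg, ← hy]; abel⟩

/-- If the identity of `Z` is a coboundary, then so is every closed morphism out of `Z`. -/
lemma acyclic_of_contraction {Z : C.Obj} (h : C.Hom Z Z (-1)) (hh : C.d (-1) 0 h = C.id Z)
    (J : C.Obj) : (C.homCplx Z J).Acyclic := by
  intro l n m hl hn x hx
  refine ⟨n.negOnePow • C.comp (by omega : -1 + n = l) h x, ?_⟩
  rw [C.d_units_smul, C.leibniz h x (by omega) (by norm_num) hn hl (by omega) (zero_add n), hx, hh,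
    C.id_comp, map_zero, zero_add, smul_smul, ← Int.negOnePow_add, Int.negOnePow_even _ ⟨_, rfl⟩,
    one_smul]

end homCplx

/-! ### Products of cotensors and coinduced dg-functors -/

/-- The object `V = ∏ Y, Hom_k(A(X, Y), N Y)` of `C`: the universal object with `k`-linear maps
`A(X, Y) → C(V, N Y)`. Morphisms `Z → V` of degree `m` amount to families of linear maps
`A(X, Y) → C(Z, N Y)` of degree `m`. -/
structure WProd (A : DGCat.{w, v₁, u₁} k) (C : DGCat.{w, v₂, u₂} k) (X : A.Obj)
    (N : A.Obj → C.Obj) where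
  V : C.Obj
  π : ∀ {Y : A.Obj} {p : ℤ}, A.Hom X Y p →ₗ[k] C.Hom V (N Y) p
  d_π : ∀ {Y : A.Obj} {p q : ℤ} (_ : p + 1 = q) (g : A.Hom X Y p), C.d p q (π g) = π (A.d p q g)
  ext : ∀ {Z : C.Obj} {m : ℤ} {φ φ' : C.Hom Z V m}, (∀ (Y : A.Obj) (p q : ℤ) (h : m + p = q)
    (g : A.Hom X Y p), C.comp h φ (π g) = C.comp h φ' (π g)) → φ = φ'
  lift : ∀ {Z : C.Obj} {m : ℤ}
    (θ : ∀ (Y : A.Obj) (p q : ℤ), m + p = q → (A.Hom X Y p →ₗ[k] C.Hom Z (N Y) q)),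
    ∃ φ : C.Hom Z V m, ∀ (Y : A.Obj) (p q : ℤ) (h : m + p = q) (g : A.Hom X Y p),
      C.comp h φ (π g) = θ Y p q h g

/-- `C` has all the objects `∏ Y, Hom_k(A(X, Y), N Y)`. -/
def HasWProd (A : DGCat.{w, v₁, u₁} k) (C : DGCat.{w, v₂, u₂} k) : Prop :=
  ∀ (X : A.Obj) (N : A.Obj → C.Obj), Nonempty (WProd A C X N)

section coind

variable {A : DGCat.{w, v₁, u₁} k} {C : DGCat.{w, v₂, u₂} k}

variable (hW : HasWProd A C)

/-- A choice of the object `∏ Y, Hom_k(A(X, Y), N Y)`, the value at `X` of the coinduced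
dg-functor. -/
noncomputable def coindProd (N : A.Obj → C.Obj) (X : A.Obj) : WProd A C X N := (hW X N).some

lemma exists_coindMap (N : A.Obj → C.Obj) {X X' : A.Obj} {n : ℤ} (f : A.Hom X X' n) :
    ∃ v : C.Hom (coindProd hW N X).V (coindProd hW N X').V n,
      ∀ (Y : A.Obj) (p q : ℤ) (h : n + p = q) (g : A.Hom X' Y p),
        C.comp h v ((coindProd hW N X').π g) = (coindProd hW N X).π (A.comp h f g) :=
  (coindProd hW N X').lift fun _ _ _ h => (coindProd hW N X).π ∘ₗ A.comp h f

/-- The action of morphisms on a coinduced dg-functor. -/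
noncomputable def coindMap (N : A.Obj → C.Obj) {X X' : A.Obj} {n : ℤ} (f : A.Hom X X' n) :
    C.Hom (coindProd hW N X).V (coindProd hW N X').V n :=
  (exists_coindMap hW N f).choose

lemma coindMap_π (N : A.Obj → C.Obj) {X X' Y : A.Obj} {n p q : ℤ} (h : n + p = q)
    (f : A.Hom X X' n) (g : A.Hom X' Y p) :
    C.comp h (coindMap hW N f) ((coindProd hW N X').π g) =
      (coindProd hW N X).π (A.comp h f g) :=
  (exists_coindMap hW N f).choose_spec Y p q h g

/-- The dg-functor `X ↦ ∏ Y, Hom_k(A(X, Y), N Y)` coinduced from the family of objects `N`. -/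
noncomputable def coind (N : A.Obj → C.Obj) : DGFunctor A C where
  obj X := (coindProd hW N X).V
  map {X X' n} :=
    { toFun := coindMap hW N
      map_add' f f' := (coindProd hW N X').ext fun Y p q h g => by
        simp only [map_add, LinearMap.add_apply, coindMap_π]
      map_smul' a f := (coindProd hW N X').ext fun Y p q h g => by
        simp only [map_smul, LinearMap.smul_apply, coindMap_π, RingHom.id_apply] }
  map_id X := (coindProd hW N X).ext fun Y p q h g => by
    obtain rfl : p = q := by omega
    simp only [LinearMap.coe_mk, AddHom.coe_mk, coindMap_π]
    rw [A.id_comp, C.id_comp]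
  map_comp {X Y Z p q n} h f g := (coindProd hW N Z).ext fun T r s hs l => by
    simp only [LinearMap.coe_mk, AddHom.coe_mk, coindMap_π]
    rw [A.assoc f g l h hs rfl (by omega), C.assoc _ _ _ h hs rfl (by omega), coindMap_π,
      coindMap_π]
  map_d {X Y} n m h f := (coindProd hW N Y).ext fun T p q hq g => by
    obtain ⟨q, rfl⟩ : ∃ q', q = q' + 1 := ⟨q - 1, by omega⟩
    simp only [LinearMap.coe_mk, AddHom.coe_mk, coindMap_π]
    have e := C.leibniz (coindMap hW N f) ((coindProd hW N Y).π g) (by omega : n + p = q) h rfl rfl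
      (by omega) hq
    rw [(coindProd hW N Y).d_π rfl, coindMap_π, coindMap_π, (coindProd hW N X).d_π rfl,
      A.leibniz f g (by omega : n + p = q) h rfl rfl (by omega) hq, map_add, Units.smul_def,
      map_zsmul, ← Units.smul_def, add_right_inj] at e
    exact smul_left_cancel _ e

/-- The universal maps of `coind hW N`. -/
noncomputable def coindπ (N : A.Obj → C.Obj) (X : A.Obj) {Y : A.Obj} {p : ℤ} :
    A.Hom X Y p →ₗ[k] C.Hom ((coind hW N).obj X) (N Y) p :=
  (coindProd hW N X).π

variable {hW}

lemma coind_ext {N : A.Obj → C.Obj} {X : A.Obj} {Z : C.Obj} {m : ℤ}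
    {φ φ' : C.Hom Z ((coind hW N).obj X) m} (h : ∀ (Y : A.Obj) (p q : ℤ) (h : m + p = q)
      (g : A.Hom X Y p), C.comp h φ (coindπ hW N X g) = C.comp h φ' (coindπ hW N X g)) : φ = φ' :=
  (coindProd hW N X).ext h

lemma coind_lift {N : A.Obj → C.Obj} {X : A.Obj} {Z : C.Obj} {m : ℤ}
    (θ : ∀ (Y : A.Obj) (p q : ℤ), m + p = q → (A.Hom X Y p →ₗ[k] C.Hom Z (N Y) q)) :
    ∃ φ : C.Hom Z ((coind hW N).obj X) m, ∀ (Y : A.Obj) (p q : ℤ) (h : m + p = q)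
      (g : A.Hom X Y p), C.comp h φ (coindπ hW N X g) = θ Y p q h g :=
  (coindProd hW N X).lift θ

lemma d_coindπ {N : A.Obj → C.Obj} {X Y : A.Obj} {p q : ℤ} (h : p + 1 = q) (g : A.Hom X Y p) :
    C.d p q (coindπ hW N X g) = coindπ hW N X (A.d p q g) :=
  (coindProd hW N X).d_π h g

lemma coind_map_π {N : A.Obj → C.Obj} {X X' Y : A.Obj} {n p q : ℤ} (h : n + p = q)
    (f : A.Hom X X' n) (g : A.Hom X' Y p) :
    C.comp h ((coind hW N).map f) (coindπ hW N X' g) = coindπ hW N X (A.comp h f g) :=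
  coindMap_π hW N h f g

/-- A natural transformation to a coinduced dg-functor is determined by its composition with the
evaluations `coindπ (𝟙 Y)`. -/
lemma natTrans_coind_π {M : DGFunctor A C} {N : A.Obj → C.Obj} {m : ℤ}
    (φ : M.natTrans (coind hW N) m) {X Y : A.Obj} {p q : ℤ} (h : m + p = q) (h' : p + m = q)
    (g : A.Hom X Y p) : C.comp h (φ.1 X) (coindπ hW N X g) =
      (m * p).negOnePow • C.comp h' (M.map g)
        (C.comp (add_zero m) (φ.1 Y) (coindπ hW N Y (A.id Y))) := by
  have e := congrArg (fun z => C.comp (add_zero q) z (coindπ hW N Y (A.id Y)))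
    (DGFunctor.natTrans_comm φ h h' g)
  rw [C.units_smul_comp, C.assoc _ _ _ h (add_zero q) (add_zero p) h, coind_map_π, A.comp_id,
    C.assoc _ _ _ h' (add_zero q) (add_zero m) h'] at e
  exact e

/-- Natural transformations to the coinduced dg-functor amount to families of morphisms. -/
lemma bijective_natTrans_coind (M : DGFunctor A C) (N : A.Obj → C.Obj) (m : ℤ) :
    Function.Bijective fun (φ : M.natTrans (coind hW N) m) (Y : A.Obj) =>
      C.comp (add_zero m) (φ.1 Y) (coindπ hW N Y (A.id Y)) := by
  constructor
  · intro φ φ' h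
    refine Subtype.ext (funext fun X => coind_ext fun Y p q hq g => ?_)
    rw [natTrans_coind_π φ hq (by omega), natTrans_coind_π φ' hq (by omega)]
    exact congrArg (fun z => (m * p).negOnePow • C.comp (by omega) (M.map g) z) (congrFun h Y)
  · intro x
    choose φ hφ using fun X => coind_lift (hW := hW) (N := N) (X := X) (Z := M.obj X) (m := m)
      fun Y p q hq => (m * p).negOnePow • (C.comp (by omega : p + m = q)).flip (x Y) ∘ₗ M.map
    have hφ' : ∀ X Y p q hq (hq' : p + m = q) g, C.comp hq (φ X) (coindπ hW N X g) =
      (m * p).negOnePow • C.comp hq' (M.map g) (x Y) :=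
      fun X Y p q hq _ g => hφ X Y p q hq g
    refine ⟨⟨φ, fun X X' p q h₁ h₂ f => coind_ext fun Y r s hs g => ?_⟩, funext fun Y => ?_⟩
    · rw [C.assoc _ _ _ h₁ hs rfl (by omega), coind_map_π, hφ' X Y _ s _ (by omega), M.map_comp,
        C.units_smul_comp, C.assoc _ _ _ h₂ hs rfl (by omega),
        hφ' X' Y _ _ rfl (by omega), C.comp_units_smul, smul_smul, ← Int.negOnePow_add, mul_add,
        C.assoc (qr := m + r) _ _ _ rfl (by omega) (by omega) (by omega)]
    · dsimp only
      rw [hφ' Y Y 0 m _ (zero_add m), M.map_id, C.id_comp, mul_zero, Int.negOnePow_zero, one_smul]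

variable (hW)

lemma exists_coindNat {N N' : A.Obj → C.Obj} {m : ℤ} (φ : ∀ Y, C.Hom (N Y) (N' Y) m) :
    ∃ ψ : (coind hW N).natTrans (coind hW N') m, ∀ (X Y : A.Obj) (p q : ℤ) (h : m + p = q)
      (h' : p + m = q) (g : A.Hom X Y p), C.comp h (ψ.1 X) (coindπ hW N' X g) =
        (m * p).negOnePow • C.comp h' (coindπ hW N X g) (φ Y) := by
  obtain ⟨ψ, hψ⟩ := (bijective_natTrans_coind (coind hW N) N' m (hW := hW)).2 fun Y =>
    C.comp (zero_add m) (coindπ hW N Y (A.id Y)) (φ Y)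
  refine ⟨ψ, fun X Y p q h h' g => ?_⟩
  have e := congrFun hψ Y
  dsimp only at e
  rw [natTrans_coind_π ψ h h', e, ← C.assoc _ _ _ (add_zero p) h' (zero_add m) h',
    coind_map_π, A.comp_id]

/-- The natural transformation of coinduced dg-functors induced by a family of morphisms. -/
noncomputable def coindNat {N N' : A.Obj → C.Obj} {m : ℤ} (φ : ∀ Y, C.Hom (N Y) (N' Y) m) :
    (coind hW N).natTrans (coind hW N') m :=
  (exists_coindNat hW φ).choose

lemma coindNat_π {N N' : A.Obj → C.Obj} {m : ℤ} (φ : ∀ Y, C.Hom (N Y) (N' Y) m) {X Y : A.Obj}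
    {p q : ℤ} (h : m + p = q) (h' : p + m = q) (g : A.Hom X Y p) :
    C.comp h ((coindNat hW φ).1 X) (coindπ hW N' X g) =
      (m * p).negOnePow • C.comp h' (coindπ hW N X g) (φ Y) :=
  (exists_coindNat hW φ).choose_spec X Y p q h h' g

/-- `coindNat`, as a linear map on natural transformations. -/
noncomputable def coindNatₗ (M M' : DGFunctor A C) (m : ℤ) :
    M.natTrans M' m →ₗ[k] (coind hW M.obj).natTrans (coind hW M'.obj) m where
  toFun φ := coindNat hW φ.1
  map_add' φ φ' := Subtype.ext <| funext fun X => coind_ext fun Y p q h g => by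
    change _ = C.comp h ((coindNat hW φ.1).1 X + (coindNat hW φ'.1).1 X) _
    simp only [map_add, LinearMap.add_apply, coindNat_π hW _ h (by omega : p + m = q)]
    rw [← smul_add]
    exact congrArg _ (map_add _ _ _)
  map_smul' a φ := Subtype.ext <| funext fun X => coind_ext fun Y p q h g => by
    change _ = C.comp h (a • (coindNat hW φ.1).1 X) _
    simp only [map_smul, LinearMap.smul_apply, coindNat_π hW _ h (by omega : p + m = q)]
    rw [smul_comm]
    exact congrArg _ (map_smul _ _ _)

/-- The cofree dg-functor `M ↦ coind M` on dg-functors `A → C`: restriction to the objects of `A`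
followed by coinduction, its right adjoint. -/
noncomputable def cofree : DGFunctor (A.dgFun C) (A.dgFun C) where
  obj M := coind hW (DGFunctor.obj M)
  map {M M' m} := coindNatₗ hW M M' m
  map_id M := Subtype.ext <| funext fun X => coind_ext fun Y p q h g => by
    obtain rfl : p = q := by omega
    refine (coindNat_π hW _ h (add_zero p) g).trans ?_
    rw [zero_mul, Int.negOnePow_zero, one_smul]
    exact (C.comp_id _).trans (C.id_comp _).symm
  map_comp {M M' M'' p q n} h φ ψ := Subtype.ext <| funext fun X => coind_ext fun Y r s hs g => by
    refine (coindNat_π hW _ hs (by omega : r + n = s) g).trans (Eq.symm ?_)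
    refine (C.assoc _ _ _ h hs rfl (by omega)).trans ?_
    change C.comp _ ((coindNat hW φ.1).1 X) (C.comp rfl ((coindNat hW ψ.1).1 X) _) = _
    rw [coindNat_π hW ψ.1 rfl (add_comm r q), C.comp_units_smul,
      ← C.assoc _ _ _ (rfl : p + r = p + r) (by omega) (add_comm r q) (by omega),
      coindNat_π hW φ.1 rfl (add_comm r p), C.units_smul_comp, smul_smul, ← Int.negOnePow_add,
      C.assoc _ _ _ (add_comm r p) (by omega) h (by omega), ← add_mul, add_comm q p, h]
    rfl
  map_d {M M'} n m h φ := Subtype.ext <| funext fun X => coind_ext fun Y p q hq g => by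
    obtain ⟨q, rfl⟩ : ∃ q', q = q' + 1 := ⟨q - 1, by omega⟩
    refine (coindNat_π hW _ hq (by omega : p + m = q + 1) g).trans (Eq.symm ?_)
    change C.comp hq (C.d n m ((coindNat hW φ.1).1 X)) _ =
      (m * p).negOnePow • C.comp _ (coindπ hW M.obj X g) (C.d n m (φ.1 Y))
    have e := C.leibniz ((coindNat hW φ.1).1 X) (coindπ hW M'.obj X g) (by omega : n + p = q) h rfl
      rfl (by omega) hq
    have e' := C.leibniz (coindπ hW M.obj X g) (φ.1 Y) (by omega : p + n = q) rfl h rfl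
      (by omega) (by omega)
    rw [d_coindπ rfl, coindNat_π hW φ.1 (by omega : n + p = q) (by omega : p + n = q),
      coindNat_π hW φ.1 (by omega : n + (p + 1) = q + 1) (by omega : p + 1 + n = q + 1),
      C.d_units_smul, e', d_coindπ rfl, smul_add, smul_smul, ← Int.negOnePow_add,
      show n * p + n = n * (p + 1) by ring] at e
    refine smul_left_cancel p.negOnePow
      ((add_left_cancel ((add_comm _ _).trans e)).symm.trans ?_)
    rw [smul_smul, ← Int.negOnePow_add]
    congr 1
    exact Int.negOnePow_congr (-p) (by rw [← h]; ring)

end coind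

end DGCat

namespace DGCat

variable {k : Type w} [Field k]

/-! ### Limits of dg-functors, computed objectwise -/

section proj

variable {E : DGCat.{w, v₁, u₁} k} {C : DGCat.{w, v₂, u₂} k} {T : Type u} (N : T → DGFunctor E C)
  (s : T → ℤ) (V : E.Obj → C.Obj) (π : ∀ (c : E.Obj) (a : T), C.Hom (V c) ((N a).obj c) (s a))

/-- A morphism `v : V c → V c'` of degree `q` which is compatible with the projections to `N a`. -/
def IsProjLift {c c' : E.Obj} {q : ℤ} (f : E.Hom c c' q) (v : C.Hom (V c) (V c') q) : Prop :=
  ∀ (a : T) (n : ℤ) (h : q + s a = n) (h' : s a + q = n),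
    C.comp h v (π c' a) = (s a * q).negOnePow • C.comp h' (π c a) ((N a).map f)

/-- Conditions under which objects `V c` with projections to the values of the dg-functors `N a`
(of degree `s a`) are the values of a dg-functor: the projections are jointly monic, morphisms of
`E` lift, and the differentials of the projections are natural. -/
structure IsProjSystem : Prop where
  mono : ∀ {c : E.Obj} {Z : C.Obj} {m : ℤ} {φ φ' : C.Hom Z (V c) m},
    (∀ (a : T) (q : ℤ) (h : m + s a = q), C.comp h φ (π c a) = C.comp h φ' (π c a)) → φ = φ'
  map : ∀ {c c' : E.Obj} {q : ℤ} (f : E.Hom c c' q), ∃ v, IsProjLift N s V π f v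
  d : ∀ {c c' : E.Obj} {q : ℤ} (f : E.Hom c c' q) (v : C.Hom (V c) (V c') q),
    IsProjLift N s V π f v → ∀ (a : T) (t n : ℤ) (_ : s a + 1 = t) (h : q + t = n) (h' : t + q = n),
      C.comp h v (C.d (s a) t (π c' a)) =
        (t * q).negOnePow • C.comp h' (C.d (s a) t (π c a)) ((N a).map f)

variable {N s V π} (H : IsProjSystem N s V π)

namespace IsProjSystem

include H in
lemma lift_unique {c c' : E.Obj} {q : ℤ} {f : E.Hom c c' q} {v v' : C.Hom (V c) (V c') q}
    (h : IsProjLift N s V π f v) (h' : IsProjLift N s V π f v') : v = v' :=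
  H.mono fun a n hn => (h a n hn (by omega)).trans (h' a n hn (by omega)).symm

/-- The dg-functor with values `V c`. -/
noncomputable def functor : DGFunctor E C where
  obj := V
  map {c c' q} :=
    { toFun f := (H.map f).choose
      map_add' f f' := by
        refine H.lift_unique (H.map _).choose_spec fun a n h h' => ?_
        rw [map_add, LinearMap.add_apply, map_add, map_add, smul_add,
          (H.map f).choose_spec a n h h', (H.map f').choose_spec a n h h']
      map_smul' r f := by
        refine H.lift_unique (H.map _).choose_spec fun a n h h' => ?_
        rw [RingHom.id_apply, map_smul, LinearMap.smul_apply, map_smul, map_smul, smul_comm,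
          (H.map f).choose_spec a n h h'] }
  map_id c := by
    refine H.lift_unique (H.map _).choose_spec fun a n h h' => ?_
    obtain rfl : s a = n := by omega
    rw [(N a).map_id, C.comp_id, C.id_comp, mul_zero, Int.negOnePow_zero, one_smul]
  map_comp {c c' c'' p q n} h f g := by
    refine H.lift_unique (H.map _).choose_spec fun a r hr hr' => ?_
    change C.comp hr (C.comp h (H.map f).choose (H.map g).choose) _ = _
    rw [C.assoc _ _ _ h hr rfl (by omega), (H.map g).choose_spec a _ rfl (add_comm _ _),
      C.comp_units_smul, ← C.assoc _ _ _ rfl (by omega) (add_comm _ _) (by omega),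
      (H.map f).choose_spec a _ rfl (add_comm _ _), C.units_smul_comp, smul_smul,
      ← Int.negOnePow_add, ← mul_add, C.assoc _ _ _ (add_comm _ _) (by omega) h hr', (N a).map_comp,
      add_comm q p, h]
  map_d {c c'} n m h f := by
    refine H.lift_unique (H.map _).choose_spec fun a r hr hr' => ?_
    obtain ⟨r, rfl⟩ : ∃ r', r = r' + 1 := ⟨r - 1, by omega⟩
    have hf := (H.map f).choose_spec
    have e := C.leibniz (H.map f).choose (π c' a) (by omega : n + s a = r) h rfl rfl (by omega) hr
    have e' := C.leibniz (π c a) ((N a).map f) (by omega : s a + n = r) rfl h rfl hr' (by omega)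
    rw [hf a r (by omega) (by omega), C.d_units_smul, e', H.d f _ hf a _ _ rfl _ (by omega),
      smul_add, smul_smul, ← Int.negOnePow_add, show s a * n + n = (s a + 1) * n by ring] at e
    change C.comp hr (C.d n m (H.map f).choose) _ = _
    refine smul_left_cancel (s a).negOnePow
      ((add_left_cancel ((add_comm _ _).trans e)).symm.trans ?_)
    rw [smul_smul, ← Int.negOnePow_add, (N a).map_d n m h]
    congr 1
    exact Int.negOnePow_congr (-s a) (by rw [← h]; ring)

lemma isProjLift_map {c c' : E.Obj} {q : ℤ} (f : E.Hom c c' q) :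
    IsProjLift N s V π f (H.functor.map f) :=
  (H.map f).choose_spec

/-- The projections, as natural transformations. -/
noncomputable def proj (a : T) : H.functor.natTrans (N a) (s a) :=
  ⟨fun c => π c a, fun _ _ _ m h₁ h₂ f =>
    Int.eq_negOnePow_smul_symm (H.isProjLift_map f a m h₂ h₁)⟩

end IsProjSystem

end proj

section WProd

variable {A : DGCat.{w, v, u} k} {E : DGCat.{w, v₁, u₁} k} {C : DGCat.{w, v₂, u₂} k}

/-- Products of cotensors of dg-functors are computed objectwise. -/
lemma HasWProd.dgFun (hW : HasWProd A C) : HasWProd A (E.dgFun C) := by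
  intro X N
  let N' : A.Obj → DGFunctor E C := N
  let P (c : E.Obj) : WProd A C X fun Y => (N' Y).obj c := (hW X fun Y => (N' Y).obj c).some
  have H : IsProjSystem (T := Σ (Y : A.Obj) (p : ℤ), A.Hom X Y p) (fun a => N' a.1)
      (fun a => a.2.1) (fun c => (P c).V) fun c a => (P c).π a.2.2 := by
    refine ⟨fun h => (P _).ext fun Y p q hq g => h ⟨Y, p, g⟩ q hq, fun {c c' q} f => ?_,
      fun {c c' q} f v hv a t n ht h h' => ?_⟩
    · obtain ⟨v, hv⟩ := (P c').lift (Z := (P c).V) (m := q) fun Y p r hr => (p * q).negOnePow •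
        (C.comp (by omega : p + q = r)).flip ((N' Y).map f) ∘ₗ (P c).π
      exact ⟨v, fun a n h h' => hv _ _ _ h _⟩
    · rw [(P c').d_π ht, (P c).d_π ht]
      exact hv ⟨a.1, t, A.d _ _ a.2.2⟩ n h h'
  let π' (c : E.Obj) (Y : A.Obj) (p : ℤ) :
    A.Hom X Y p →ₗ[k] C.Hom (H.functor.obj c) ((N' Y).obj c) p := (P c).π
  let π (Y : A.Obj) (p : ℤ) : A.Hom X Y p →ₗ[k] H.functor.natTrans (N' Y) p :=
    { toFun g := H.proj ⟨Y, p, g⟩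
      map_add' g g' := Subtype.ext (funext fun c => map_add (P c).π g g')
      map_smul' a g := Subtype.ext (funext fun c => map_smul (P c).π a g) }
  refine ⟨⟨H.functor, fun {Y p} => π Y p,
    fun h g => Subtype.ext (funext fun c => (P c).d_π h g),
    fun {Z m φ φ'} h => Subtype.ext (funext fun c => (P c).ext fun Y p q hq g =>
      congrFun (congrArg Subtype.val (h Y p q hq g)) c), fun {Z m} θ => ?_⟩⟩
  let Z' : DGFunctor E C := Z
  let θ' (Y : A.Obj) (p q : ℤ) (h : m + p = q) : A.Hom X Y p →ₗ[k] Z'.natTrans (N' Y) q := θ Y p q h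
  choose φ₀ hφ₀ using fun c => (P c).lift (Z := Z'.obj c) (m := m) fun Y p q h =>
    LinearMap.proj c ∘ₗ (Z'.natTrans (N' Y) q).subtype ∘ₗ θ' Y p q h
  let φ (c : E.Obj) : C.Hom (Z'.obj c) (H.functor.obj c) m := φ₀ c
  have hφ : ∀ c Y p q h g, C.comp h (φ c) (π' c Y p g) = (θ' Y p q h g).1 c := hφ₀
  have hnat : φ ∈ Z'.natTrans H.functor m := fun c c' r n h₁ h₂ f =>
    (P c').ext fun Y p q hq g => by
    change C.comp hq _ (π' c' Y p g) = C.comp hq _ (π' c' Y p g)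
    have e : C.comp (add_comm r p) (H.functor.map f) (π' c' Y p g) =
        (p * r).negOnePow • C.comp rfl (π' c Y p g) ((N' Y).map f) :=
      H.isProjLift_map f ⟨Y, p, g⟩ _ _ _
    have e' := DGFunctor.natTrans_comm (θ' Y p (m + p) rfl g) (by omega : m + p + r = q)
      (by omega) f
    rw [C.assoc _ _ _ h₁ hq (add_comm _ _) (by omega), C.units_smul_comp,
      C.assoc _ _ _ h₂ hq rfl (by omega), hφ, e, C.comp_units_smul,
      ← C.assoc _ _ _ rfl (by omega) rfl (by omega), hφ, e', smul_smul, ← Int.negOnePow_add]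
    congr 1
    exact Int.negOnePow_congr (p * r) (by ring)
  exact ⟨⟨φ, hnat⟩, fun Y p q h g => Subtype.ext (funext fun c => hφ c Y p q h g)⟩

end WProd

/-! ### Totalizations -/

section Tot

/-- `T` is the total object (with products) of the complex `N 0 → N 1 → ⋯` of objects of `C`: the
universal object with projections `p n : T → N n` of degree `-n` such that `d (p 0) = 0` and
`d (p (n + 1)) = D n ∘ p n`. -/
structure IsTot {C : DGCat.{w, v, u} k} (N : ℕ → C.Obj) (D : ∀ n, C.Hom (N n) (N (n + 1)) 0)
    (T : C.Obj) (p : ∀ n : ℕ, C.Hom T (N n) (-n)) : Prop where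
  d_zero : ∀ m : ℤ, C.d (-(0 : ℕ)) m (p 0) = 0
  d_succ : ∀ (n : ℕ) (m : ℤ) (h : -(n : ℤ) + 0 = m),
    C.d (-(n + 1 : ℕ)) m (p (n + 1)) = C.comp h (p n) (D n)
  ext : ∀ {Z : C.Obj} {m : ℤ} {φ φ' : C.Hom Z T m},
    (∀ (n : ℕ) (q : ℤ) (h : m + -n = q), C.comp h φ (p n) = C.comp h φ' (p n)) → φ = φ'
  lift : ∀ {Z : C.Obj} {m : ℤ} (θ : ∀ (n : ℕ) (q : ℤ), m + -n = q → C.Hom Z (N n) q),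
    ∃ φ : C.Hom Z T m, ∀ (n : ℕ) (q : ℤ) (h : m + -n = q), C.comp h φ (p n) = θ n q h

/-- Every complex of objects of `C` has a total object. -/
def HasTot (C : DGCat.{w, v, u} k) : Prop :=
  ∀ (N : ℕ → C.Obj) (D : ∀ n, C.Hom (N n) (N (n + 1)) 0), (∀ n, C.d 0 1 (D n) = 0) →
    (∀ n, C.comp (add_zero 0) (D n) (D (n + 1)) = 0) → ∃ T p, IsTot N D T p

variable {E : DGCat.{w, v₁, u₁} k} {C : DGCat.{w, v₂, u₂} k} {N : ℕ → DGFunctor E C}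
  {D : ∀ n, (N n).natTrans (N (n + 1)) 0}

/-- A natural family of total objects is a total object in the dg-category of dg-functors. -/
lemma IsTot.of_objectwise {T : DGFunctor E C} {p : ∀ n : ℕ, T.natTrans (N n) (-n)}
    (h : ∀ c, IsTot (fun n => (N n).obj c) (fun n => (D n).1 c) (T.obj c) fun n => (p n).1 c) :
    IsTot (C := E.dgFun C) N D T p := by
  refine ⟨fun m => Subtype.ext (funext fun c => (h c).d_zero m),
    fun n m hm => Subtype.ext (funext fun c => (h c).d_succ n m hm),
    fun {Z m φ φ'} he => Subtype.ext (funext fun c => (h c).ext fun n q hq =>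
      congrFun (congrArg Subtype.val (he n q hq)) c), fun {Z m} θ => ?_⟩
  let Z' : DGFunctor E C := Z
  let θ' (n : ℕ) (q : ℤ) (h : m + -n = q) : Z'.natTrans (N n) q := θ n q h
  choose φ hφ using fun c => (h c).lift (Z := Z'.obj c) (m := m) fun n q h => (θ' n q h).1 c
  have hnat : φ ∈ Z'.natTrans T m := fun c c' r t h₁ h₂ f => (h c').ext fun n q hq => by
    have e := DGFunctor.natTrans_comm (p n) rfl (add_comm _ _) f
    have e' := DGFunctor.natTrans_comm (θ' n (m + -n) rfl) (by omega : m + -n + r = q)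
      (by omega) f
    have e'' : C.comp (add_comm r (-n)) (T.map f) ((p n).1 c') =
        (-n * r).negOnePow • C.comp rfl ((p n).1 c) ((N n).map f) :=
      Int.eq_negOnePow_smul_symm e
    rw [C.assoc _ _ _ h₁ hq (add_comm _ _) (by omega), C.units_smul_comp,
      C.assoc _ _ _ h₂ hq rfl (by omega), hφ, e'', C.comp_units_smul,
      ← C.assoc _ _ _ rfl (by omega) rfl (by omega), hφ, e', smul_smul, ← Int.negOnePow_add]
    congr 1
    exact Int.negOnePow_congr (-n * r) (by ring)
  exact ⟨⟨φ, hnat⟩, fun n q h => Subtype.ext (funext fun c => hφ c n q h)⟩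

/-- Total objects of dg-functors are computed objectwise. -/
lemma HasTot.exists_dgFun (hC : HasTot C) (hD : ∀ n c, C.d 0 1 ((D n).1 c) = 0)
    (hDD : ∀ n c, C.comp (add_zero 0) ((D n).1 c) ((D (n + 1)).1 c) = 0) :
    ∃ (T : DGFunctor E C) (p : ∀ n : ℕ, T.natTrans (N n) (-n)), ∀ c,
      IsTot (fun n => (N n).obj c) (fun n => (D n).1 c) (T.obj c) fun n => (p n).1 c := by
  choose V π P using fun c => hC (fun n => (N n).obj c) (fun n => (D n).1 c) (fun n => hD n c)
    fun n => hDD n c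
  have H : IsProjSystem N (fun n : ℕ => -(n : ℤ)) V π := by
    refine ⟨fun h => (P _).ext fun n q hq => h n q hq, fun {c c' q} f => ?_,
      fun {c c' q} f v hv a t n ht h h' => ?_⟩
    · obtain ⟨v, hv⟩ := (P c').lift (Z := V c) (m := q) fun n r hr => (-n * q).negOnePow •
        C.comp (by omega : -n + q = r) (π c n) ((N n).map f)
      exact ⟨v, fun a n h h' => hv _ _ _⟩
    · cases a with
      | zero => rw [(P c').d_zero, (P c).d_zero, map_zero, map_zero, LinearMap.zero_apply, smul_zero]
      | succ a =>
        obtain rfl : -(a : ℤ) = t := by simpa using ht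
        have e := DGFunctor.natTrans_comm (D a) (zero_add q) (add_zero q) f
        rw [zero_mul, Int.negOnePow_zero, one_smul] at e
        rw [(P c').d_succ a _ (add_zero _), (P c).d_succ a _ (add_zero _),
          ← C.assoc _ _ _ h (add_zero n) (add_zero _) h, hv a n h h', C.units_smul_comp,
          C.assoc _ _ _ h' (add_zero n) (add_zero q) h', ← e,
          C.assoc _ _ _ (add_zero _) h' (zero_add q) h']
  exact ⟨H.functor, H.proj, P⟩

/-- Total objects exist in dg-categories of dg-functors if they exist in the target. -/
lemma HasTot.dgFun (hC : HasTot C) : HasTot (E.dgFun C) := by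
  intro N D hD hDD
  obtain ⟨T, p, h⟩ := hC.exists_dgFun (N := N) (D := D)
    (fun n c => congrFun (congrArg Subtype.val (hD n)) c)
    fun n c => congrFun (congrArg Subtype.val (hDD n)) c
  exact ⟨T, p, IsTot.of_objectwise h⟩

end Tot

end DGCat

/-! ### Shifts, and morphisms to a total object -/

namespace Cplx

variable {k : Type w} [Field k]

/-- The shifted complex, with the usual sign on the differential. -/
abbrev shift (K : Cplx.{w, v} k) (a : ℤ) : Cplx.{w, v} k where
  X m := K.X (m + a)
  d m m' := a.negOnePow • K.d (m + a) (m' + a)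
  d_d n m l x h₁ h₂ := by
    simp only [LinearMap.smul_apply, Units.smul_def, map_zsmul,
      K.d_d _ _ _ x (by omega : n + a + 1 = m + a) (by omega : m + a + 1 = l + a), smul_zero]

/-- The shift of a chain map. -/
abbrev Hom.shift {K : Cplx.{w, v₁} k} {L : Cplx.{w, v₂} k} (u : K.Hom L) (a : ℤ) :
    (K.shift a).Hom (L.shift a) where
  f m := u.f (m + a)
  comm n m h x := by
    simp only [LinearMap.smul_apply, Units.smul_def, map_zsmul]
    rw [u.comm _ _ (by omega)]

lemma Hom.IsQuasiIso.shift {K : Cplx.{w, v₁} k} {L : Cplx.{w, v₂} k} {u : K.Hom L}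
    (h : u.IsQuasiIso) (a : ℤ) : (u.shift a).IsQuasiIso := by
  intro l n m m' hl hn hm b x hb hx
  have hb' : a.negOnePow • K.d (m + a) (m' + a) b = 0 := hb
  have hx' : a.negOnePow • L.d (n + a) (m + a) x = u.f (m + a) b := hx
  obtain ⟨c, y, hc, hy⟩ := h (l + a) (n + a) (m + a) (m' + a) (by omega) (by omega) (by omega)
    b (a.negOnePow • x) ((smul_eq_zero_iff_eq _).1 hb') (by
      rw [← hx', Units.smul_def, map_zsmul, ← Units.smul_def])
  refine ⟨a.negOnePow • c, y, ?_, ?_⟩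
  · have e : a.negOnePow • K.d (n + a) (m + a) (a.negOnePow • c) = b := by
      rw [Units.smul_def, Units.smul_def, map_zsmul, ← Units.smul_def, ← Units.smul_def, smul_smul,
        ← Int.negOnePow_add, Int.negOnePow_even _ ⟨_, rfl⟩, one_smul, hc]
    exact e
  · have e : u.f (n + a) (a.negOnePow • c) + a.negOnePow • L.d (l + a) (n + a) y = x := by
      rw [Units.smul_def, map_zsmul, ← Units.smul_def, ← smul_add, hy, smul_smul,
        ← Int.negOnePow_add, Int.negOnePow_even _ ⟨_, rfl⟩, one_smul]
    exact e

end Cplx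

namespace DGFunctor

variable {k : Type w} [Field k] {A : DGCat.{w, v₁, u₁} k} {B : DGCat.{w, v₂, u₂} k}
  {C : DGCat.{w, v₃, u₃} k}

/-- The identity dg-functor. -/
def id (A : DGCat.{w, v, u} k) : DGFunctor A A where
  obj X := X
  map := LinearMap.id
  map_id _ := rfl
  map_comp _ _ _ := rfl
  map_d _ _ _ _ := rfl

/-- The composition `G ∘ φ` of a natural transformation with a dg-functor. -/
def whiskerRight {F F' : DGFunctor A B} {n : ℤ} (φ : F.natTrans F' n) (G : DGFunctor B C) :
    (F.comp G).natTrans (F'.comp G) n :=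
  ⟨fun X => G.map (φ.1 X), fun X Y p m h₁ h₂ f => by
    have e := congrArg G.map (natTrans_comm φ h₁ h₂ f)
    rw [Units.smul_def, map_zsmul, G.map_comp, G.map_comp, ← Units.smul_def] at e
    exact e⟩

end DGFunctor

namespace DGCat

variable {k : Type w} [Field k]

section Tot

variable {C : DGCat.{w, v, u} k} {N : ℕ → C.Obj} {D : ∀ n, C.Hom (N n) (N (n + 1)) 0} {T : C.Obj}
  {p : ∀ n : ℕ, C.Hom T (N n) (-n)}

/-- The complex of morphisms to a total object is a total complex. -/
def IsTot.totDecomp (hT : IsTot N D T p) (hD : ∀ n, C.d 0 1 (D n) = 0)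
    (hDD : ∀ n, C.comp (add_zero 0) (D n) (D (n + 1)) = 0) (Z : C.Obj) :
    Cplx.TotDecomp (C.homCplx Z T) fun n => (C.homCplx Z (N n)).shift (-n) where
  p n m := (C.comp rfl).flip (p n)
  D n m m' h := (n : ℤ).negOnePow •
    (C.comp (by push_cast; omega : m + -(n : ℤ) + 0 = m' + -((n + 1 : ℕ) : ℤ))).flip (D n)
  p_zero m m' h x := by
    have e := C.leibniz x (p 0) rfl h rfl (by omega : m + -((0 : ℕ) : ℤ) + 1 = m' + -((0 : ℕ) : ℤ))
      (by omega) rfl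
    rw [hT.d_zero, map_zero, zero_add] at e
    exact Int.eq_negOnePow_smul_symm e
  p_succ n m m' h x := by
    have e := C.leibniz x (p (n + 1)) rfl h rfl
      (by omega : m + -((n + 1 : ℕ) : ℤ) + 1 = m' + -((n + 1 : ℕ) : ℤ)) (by omega) rfl
    rw [hT.d_succ n _ (by push_cast; omega),
      ← C.assoc (pq := m + -n) _ _ _ rfl (by push_cast; omega) _ _, ← sub_eq_iff_eq_add'] at e
    refine (Int.eq_negOnePow_smul_symm e).trans ?_
    rw [smul_sub, sub_eq_add_neg]
    simp only [LinearMap.smul_apply, LinearMap.flip_apply]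
    rw [← Units.neg_smul, ← Int.negOnePow_succ]
    rw [show (-((n + 1 : ℕ) : ℤ) + 1).negOnePow = (n : ℤ).negOnePow from
      Int.negOnePow_congr (-n) (by push_cast; ring)]
  D_d n m m' m'' h h' x := by
    simp only [LinearMap.smul_apply, LinearMap.flip_apply, d_units_smul, units_smul_comp]
    rw [C.leibniz x (D n) _ (by omega : m + -(n : ℤ) + 1 = m' + -(n : ℤ)) (zero_add 1)
      (by push_cast; omega) (by push_cast; omega) (by push_cast; omega), hD, map_zero, zero_add,
      Int.negOnePow_zero, one_smul, smul_smul, smul_smul, ← Int.negOnePow_add,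
      ← Int.negOnePow_add, show (-((n + 1 : ℕ) : ℤ) + n).negOnePow = -1 from
        (Int.negOnePow_congr (-1) (by push_cast; ring)).trans Int.negOnePow_one,
      Int.negOnePow_even _ (by simp), one_smul, Units.neg_smul, one_smul, neg_add_cancel]
  D_D n m m' m'' h h' x := by
    simp only [LinearMap.smul_apply, LinearMap.flip_apply, units_smul_comp]
    rw [C.assoc _ _ _ _ _ (add_zero 0) (by push_cast; omega), hDD]
    simp
  ext m x y h := hT.ext fun n q hq => by
    subst hq
    exact h n
  lift m θ := by
    obtain ⟨φ, hφ⟩ := hT.lift (Z := Z) (m := m) fun n q hq => hq ▸ θ n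
    exact ⟨φ, fun n => hφ n _ rfl⟩

/-- Total objects are unique up to isomorphism; only one of the two composites is needed. -/
lemma IsTot.exists_iso (hT : IsTot N D T p) {T' : C.Obj} {p' : ∀ n : ℕ, C.Hom T' (N n) (-n)}
    (hT' : IsTot N D T' p') : ∃ (ψ : C.Hom T T' 0) (ψ' : C.Hom T' T 0),
      (∀ n, C.comp (zero_add _) ψ (p' n) = p n) ∧ (∀ n, C.comp (zero_add _) ψ' (p n) = p' n) ∧
      C.comp (add_zero 0) ψ ψ' = C.id T := by
  obtain ⟨ψ, hψ⟩ := hT'.lift (Z := T) (m := 0) fun n q hq => (by omega : -(n : ℤ) = q) ▸ p n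
  obtain ⟨ψ', hψ'⟩ := hT.lift (Z := T') (m := 0) fun n q hq => (by omega : -(n : ℤ) = q) ▸ p' n
  refine ⟨ψ, ψ', fun n => hψ n _ _, fun n => hψ' n _ _, hT.ext fun n q hq => ?_⟩
  obtain rfl : -(n : ℤ) = q := by omega
  rw [C.assoc _ _ _ _ hq (zero_add _) (zero_add _), hψ', hψ, C.id_comp]

end Tot

section

variable {E : DGCat.{w, v₁, u₁} k} {C : DGCat.{w, v₂, u₂} k} {N : ℕ → DGFunctor E C}
  {D : ∀ n, (N n).natTrans (N (n + 1)) 0} {T : DGFunctor E C} {p : ∀ n : ℕ, T.natTrans (N n) (-n)}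

/-- Every total object of dg-functors is a total object at each argument, since it is isomorphic to
the one that is constructed objectwise. -/
lemma IsTot.objectwise (hC : HasTot C) (hD : ∀ n c, C.d 0 1 ((D n).1 c) = 0)
    (hDD : ∀ n c, C.comp (add_zero 0) ((D n).1 c) ((D (n + 1)).1 c) = 0)
    (hT : IsTot (C := E.dgFun C) N D T p) (c : E.Obj) :
    IsTot (fun n => (N n).obj c) (fun n => (D n).1 c) (T.obj c) fun n => (p n).1 c := by
  obtain ⟨T', p', h'⟩ := hC.exists_dgFun hD hDD
  obtain ⟨ψ, ψ', hψ, hψ', hψψ⟩ := hT.exists_iso (IsTot.of_objectwise h')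
  have e : ∀ n, C.comp (zero_add _) (ψ.1 c) ((p' n).1 c) = (p n).1 c := fun n =>
    congrFun (congrArg Subtype.val (hψ n)) c
  have e' : ∀ n, C.comp (zero_add _) (ψ'.1 c) ((p n).1 c) = (p' n).1 c := fun n =>
    congrFun (congrArg Subtype.val (hψ' n)) c
  have e'' : C.comp (add_zero 0) (ψ.1 c) (ψ'.1 c) = C.id _ :=
    congrFun (congrArg Subtype.val hψψ) c
  refine ⟨fun m => congrFun (congrArg Subtype.val (hT.d_zero m)) c,
    fun n m h => congrFun (congrArg Subtype.val (hT.d_succ n m h)) c,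
    fun {Z m φ φ'} h => ?_, fun {Z m} θ => ?_⟩
  · have : C.comp (add_zero m) φ (ψ.1 c) = C.comp (add_zero m) φ' (ψ.1 c) :=
      (h' c).ext fun n q hq => by
        rw [C.assoc _ _ _ _ hq (zero_add _) hq, C.assoc _ _ _ _ hq (zero_add _) hq, e]
        exact h n q hq
    rw [← C.comp_id φ, ← C.comp_id φ', ← e'', ← C.assoc _ _ _ (add_zero m) (add_zero m) _ _,
      ← C.assoc _ _ _ (add_zero m) (add_zero m) _ _, this]
  · obtain ⟨φ, hφ⟩ := (h' c).lift θ
    exact ⟨C.comp (add_zero m) φ (ψ'.1 c), fun n q hq => by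
      rw [C.assoc _ _ _ _ hq (zero_add _) hq, e', hφ]⟩

end

end DGCat

namespace DGCat

variable {k : Type w} [Field k]

/-! ### The cobar resolution -/

section cobar

variable {A : DGCat.{w, v₁, u₁} k} {C : DGCat.{w, v₂, u₂} k} (hW : HasWProd A C)

/-- The unit `M → coind M`: its composition with the projection at `g` is `M g`. -/
lemma exists_unit (M : DGFunctor A C) : ∃ η : M.natTrans (coind hW M.obj) 0,
    ∀ (X Y : A.Obj) (p q : ℤ) (h : 0 + p = q) (h' : p = q) (g : A.Hom X Y p),
      C.comp h (η.1 X) (coindπ hW M.obj X g) = h' ▸ M.map g := by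
  obtain ⟨η, hη⟩ := (bijective_natTrans_coind M M.obj 0 (hW := hW)).2 fun Y => C.id _
  refine ⟨η, fun X Y p q h h' g => ?_⟩
  subst h'
  have e := congrFun hη Y
  dsimp only at e
  rw [natTrans_coind_π η h (add_zero p), e, C.comp_id, zero_mul, Int.negOnePow_zero, one_smul]

/-- The component at `M` of the unit `M → coind M`. -/
noncomputable def cofreeUnitApp (M : DGFunctor A C) : M.natTrans (coind hW M.obj) 0 :=
  (exists_unit hW M).choose

lemma cofreeUnitApp_π (M : DGFunctor A C) {X Y : A.Obj} {p : ℤ} (g : A.Hom X Y p) :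
    C.comp (zero_add p) ((cofreeUnitApp hW M).1 X) (coindπ hW M.obj X g) = M.map g :=
  (exists_unit hW M).choose_spec X Y p p (zero_add p) rfl g

/-- The unit `id → cofree`. -/
noncomputable def cofreeUnit : (DGFunctor.id (A.dgFun C)).natTrans (cofree hW) 0 :=
  ⟨fun M => cofreeUnitApp hW M, fun M M' p m h₁ h₂ φ => by
    obtain rfl : p = m := by omega
    rw [zero_mul, Int.negOnePow_zero, one_smul]
    let M₁ : DGFunctor A C := M
    let M₂ : DGFunctor A C := M'
    let φ' : M₁.natTrans M₂ p := φ
    refine Subtype.ext (funext fun X => coind_ext fun Y r s hs g => ?_)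
    have e : C.comp hs (C.comp h₁ ((cofreeUnitApp hW M₁).1 X) ((coindNat hW φ'.1).1 X))
        (coindπ hW M₂.obj X g) =
        C.comp hs (C.comp h₂ (φ'.1 X) ((cofreeUnitApp hW M₂).1 X)) (coindπ hW M₂.obj X g) := by
      rw [C.assoc _ _ _ h₁ hs hs (zero_add s), C.assoc _ _ _ h₂ hs (zero_add r) hs,
        coindNat_π hW φ'.1 hs (by omega), C.comp_units_smul,
        ← C.assoc _ _ _ (zero_add r) (by omega : r + p = s) _ _, cofreeUnitApp_π, cofreeUnitApp_π]
      exact (DGFunctor.natTrans_comm φ' hs (by omega) g).symm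
    exact e⟩

lemma d_cofreeUnit (M : (A.dgFun C).Obj) : (A.dgFun C).d 0 1 ((cofreeUnit hW).1 M) = 0 := by
  let M' : DGFunctor A C := M
  refine Subtype.ext (funext fun X => coind_ext fun Y p q h g => ?_)
  obtain rfl : q = p + 1 := by omega
  have e := C.leibniz ((cofreeUnitApp hW M').1 X) (coindπ hW M'.obj X g) (zero_add p) (zero_add 1)
    rfl rfl (zero_add _) h
  rw [d_coindπ rfl, cofreeUnitApp_π, cofreeUnitApp_π, ← M'.map_d _ _ rfl, left_eq_add,
    smul_eq_zero_iff_eq] at e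
  have e' : C.comp h (0 : C.Hom (M'.obj X) ((coind hW M'.obj).obj X) 1) (coindπ hW M'.obj X g) =
      0 := by
    simp
  exact e.trans e'.symm

end cobar

section pointed

variable {𝒟 : DGCat.{w, v, u} k} (W : DGFunctor 𝒟 𝒟) (η : (DGFunctor.id 𝒟).natTrans W 0)

/-- The iterates of a dg-functor. -/
def iter : ℕ → DGFunctor 𝒟 𝒟
  | 0 => DGFunctor.id _
  | n + 1 => (iter n).comp W

/-- The unit `W ^ (n + 1) → W ^ (n + 2)`. -/
def iterUnit (n : ℕ) : (iter W (n + 1)).natTrans (iter W (n + 2)) 0 :=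
  (iter W (n + 1)).restrictNatTrans (DGFunctor.id _) W 0 η

/-- The differential `η - W(D)` of the cobar complex `M → W M → W (W M) → ⋯` of the pointed
dg-functor `W`; it is the alternating sum of the cofaces. -/
def cobarD : ∀ n, (iter W n).natTrans (iter W (n + 1)) 0
  | 0 => η
  | n + 1 =>
    let D : (iter W (n + 1)).natTrans (iter W (n + 2)) 0 :=
      DGFunctor.whiskerRight (cobarD n) W
    iterUnit W η n - D

/-- The component of the unit at `W ^ n M`. -/
def iterUnitApp (n : ℕ) (M : 𝒟.Obj) : 𝒟.Hom ((iter W n).obj M) ((iter W (n + 1)).obj M) 0 :=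
  η.1 ((iter W n).obj M)

/-- The image under `W` of the differential of the cobar complex. -/
def mapCobarD (n : ℕ) (M : 𝒟.Obj) :
    𝒟.Hom ((iter W (n + 1)).obj M) ((iter W (n + 2)).obj M) 0 :=
  W.map ((cobarD W η n).1 M)

lemma cobarD_succ (n : ℕ) (M : 𝒟.Obj) :
    (cobarD W η (n + 1)).1 M = iterUnitApp W η (n + 1) M - mapCobarD W η n M := rfl

variable {W η}

lemma d_cobarD (hη : ∀ M, 𝒟.d 0 1 (η.1 M) = 0) (n : ℕ) (M : 𝒟.Obj) :
    𝒟.d 0 1 ((cobarD W η n).1 M) = 0 := by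
  induction n with
  | zero => exact hη M
  | succ n ih =>
    have e : 𝒟.d 0 1 (mapCobarD W η n M) = 0 :=
      (W.map_d _ _ (zero_add 1) _).symm.trans ((congrArg W.map ih).trans (map_zero _))
    rw [cobarD_succ, map_sub, e, sub_zero]
    exact hη _

lemma comp_unit {M M' : 𝒟.Obj} (f : 𝒟.Hom M M' 0) :
    𝒟.comp (Y := M') (Z := W.obj M') (add_zero 0) f (η.1 M') =
      𝒟.comp (X := M) (Y := W.obj M) (add_zero 0) (η.1 M) (W.map f) := by
  have e := DGFunctor.natTrans_comm η (add_zero 0) (add_zero 0) f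
  rw [zero_mul, Int.negOnePow_zero, one_smul] at e
  exact e.symm

lemma cobarD_comp (n : ℕ) (M : 𝒟.Obj) :
    𝒟.comp (add_zero 0) ((cobarD W η n).1 M) ((cobarD W η (n + 1)).1 M) = 0 := by
  have e : 𝒟.comp (add_zero 0) ((cobarD W η n).1 M) (iterUnitApp W η (n + 1) M) =
      𝒟.comp (add_zero 0) (iterUnitApp W η n M) (mapCobarD W η n M) :=
    comp_unit (η := η) ((cobarD W η n).1 M)
  rw [cobarD_succ, map_sub, e]
  cases n with
  | zero => exact sub_self _
  | succ n =>
    have ih := cobarD_comp n M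
    have e' : 𝒟.comp (add_zero 0) (mapCobarD W η n M) (mapCobarD W η (n + 1) M) = 0 :=
      (W.map_comp _ _ _).symm.trans ((congrArg W.map ih).trans (map_zero _))
    rw [cobarD_succ, map_sub, LinearMap.sub_apply, e', sub_zero, sub_self]

variable (W η)

/-- The total object of the cobar complex `W M → W (W M) → ⋯`, as a dg-functor of `M`. -/
lemma exists_cobar (h𝒟 : HasTot 𝒟) (hη : ∀ M, 𝒟.d 0 1 (η.1 M) = 0) :
    ∃ (T : DGFunctor 𝒟 𝒟) (p : ∀ n : ℕ, T.natTrans (iter W (n + 1)) (-n)), ∀ M,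
      IsTot (fun n => (iter W (n + 1)).obj M) (fun n => (cobarD W η (n + 1)).1 M) (T.obj M)
        fun n => (p n).1 M :=
  h𝒟.exists_dgFun (fun n M => d_cobarD hη (n + 1) M) fun n M => cobarD_comp (n + 1) M

/-- The coaugmentation of the cobar complex, as a natural transformation to its total object. -/
lemma exists_cobar_unit {T : DGFunctor 𝒟 𝒟} {p : ∀ n : ℕ, T.natTrans (iter W (n + 1)) (-n)}
    (hT : ∀ M, IsTot (fun n => (iter W (n + 1)).obj M) (fun n => (cobarD W η (n + 1)).1 M)
      (T.obj M) fun n => (p n).1 M) (hη : ∀ M, 𝒟.d 0 1 (η.1 M) = 0) :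
    ∃ ι : (DGFunctor.id 𝒟).natTrans T 0, (∀ M, 𝒟.d 0 1 (ι.1 M) = 0) ∧
      (∀ M, 𝒟.comp (by simp) (ι.1 M) ((p 0).1 M) = η.1 M) ∧
      ∀ M (n : ℕ), 𝒟.comp (zero_add _) (ι.1 M) ((p (n + 1)).1 M) = 0 := by
  have H : IsTot (C := 𝒟.dgFun 𝒟) (fun n => iter W (n + 1)) (fun n => cobarD W η (n + 1)) T p :=
    IsTot.of_objectwise hT
  let θ (n : ℕ) (q : ℤ) (h : (0 : ℤ) + -n = q) : (DGFunctor.id 𝒟).natTrans (iter W (n + 1)) q :=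
    match n, h with
    | 0, h => (by simpa using h : (0 : ℤ) = q) ▸ (η : (DGFunctor.id 𝒟).natTrans (iter W 1) 0)
    | _ + 1, _ => 0
  obtain ⟨ι, hι⟩ := H.lift θ
  let ι' : (DGFunctor.id 𝒟).natTrans T 0 := ι
  have h₀ : ∀ M, 𝒟.comp (by simp) (ι'.1 M) ((p 0).1 M) = η.1 M := fun M =>
    congrFun (congrArg Subtype.val (hι 0 0 (by simp))) M
  have h₁ : ∀ M (n : ℕ) (q : ℤ) (h : 0 + -((n + 1 : ℕ) : ℤ) = q),
      𝒟.comp h (ι'.1 M) ((p (n + 1)).1 M) = 0 := fun M n q h =>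
    congrFun (congrArg Subtype.val (hι (n + 1) q h)) M
  refine ⟨ι', fun M => (hT M).ext fun n q hq => ?_, h₀, fun M n => h₁ M n _ _⟩
  rw [map_zero, LinearMap.zero_apply]
  cases n with
  | zero =>
    obtain rfl : 1 = q := by simpa using hq
    have e := 𝒟.leibniz (n := 0) (n' := 1) (q' := -((0 : ℕ) : ℤ) + 1) (ι'.1 M) ((p 0).1 M)
      (by simp) (zero_add 1) rfl (zero_add 1) (by simp) hq
    rw [(hT M).d_zero, map_zero] at e
    exact (smul_eq_zero_iff_eq _).1 (((zero_add _).symm.trans e.symm).trans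
      ((congrArg (𝒟.d 0 1) (h₀ M)).trans (hη M)))
  | succ n =>
    obtain rfl : -(n : ℤ) = q := by push_cast at hq; omega
    have e := 𝒟.leibniz (n := -((n + 1 : ℕ) : ℤ)) (n' := -n) (q' := -n) (ι'.1 M)
      ((p (n + 1)).1 M) (zero_add _) (zero_add 1) (by push_cast; omega) (by push_cast; omega)
      (zero_add _) hq
    have e' : 𝒟.comp (zero_add (-(n : ℤ))) (ι'.1 M) (𝒟.comp (add_zero _) ((p n).1 M)
        ((cobarD W η (n + 1)).1 M)) = 0 := by
      rw [← 𝒟.assoc (pq := -n) _ _ _ (zero_add _) (add_zero _) (add_zero _) _]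
      cases n with
      | zero =>
        have e₀ : 𝒟.comp (zero_add _) (ι'.1 M) ((p 0).1 M) = η.1 M := h₀ M
        rw [e₀]
        exact cobarD_comp 0 M
      | succ n => rw [h₁, map_zero, LinearMap.zero_apply]
    rw [h₁, (hT M).d_succ n _ (by omega), map_zero] at e
    exact (smul_eq_zero_iff_eq _).1 ((e.trans ((congrArg (· + _) e').trans (zero_add _))).symm)

end pointed

section resolution

variable {A : DGCat.{w, v₁, u₁} k} {C : DGCat.{w, v₂, u₂} k} (hW : HasWProd A C) (hC : HasTot C)

/-- The cobar resolution, as a dg-functor: `M` goes to the total object of the complex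
`W M → W (W M) → ⋯` of the cofree dg-functor `W`. -/
noncomputable def cobar : DGFunctor (A.dgFun C) (A.dgFun C) :=
  (exists_cobar (cofree hW) (cofreeUnit hW) hC.dgFun (d_cofreeUnit hW)).choose

/-- The projections of the cobar resolution. -/
noncomputable def cobarP (n : ℕ) : (cobar hW hC).natTrans (iter (cofree hW) (n + 1)) (-n) :=
  (exists_cobar (cofree hW) (cofreeUnit hW) hC.dgFun (d_cofreeUnit hW)).choose_spec.choose n

lemma isTot_cobar (M : (A.dgFun C).Obj) :
    IsTot (fun n => (iter (cofree hW) (n + 1)).obj M)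
      (fun n => (cobarD (cofree hW) (cofreeUnit hW) (n + 1)).1 M) ((cobar hW hC).obj M)
      fun n => (cobarP hW hC n).1 M :=
  (exists_cobar (cofree hW) (cofreeUnit hW) hC.dgFun (d_cofreeUnit hW)).choose_spec.choose_spec M

/-- The iterate `W ^ n M` as a dg-functor `A → C`. -/
noncomputable def cofreeIter (n : ℕ) (M : DGFunctor A C) : DGFunctor A C :=
  (iter (cofree hW) n).obj M

/-- The differential of the cobar complex of `M`. -/
noncomputable def cofreeD (n : ℕ) (M : DGFunctor A C) :
    (cofreeIter hW n M).natTrans (cofreeIter hW (n + 1) M) 0 :=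
  (cobarD (cofree hW) (cofreeUnit hW) n).1 M

/-- The cobar resolution of `M`. -/
noncomputable def cobarObj (M : DGFunctor A C) : DGFunctor A C := (cobar hW hC).obj M

/-- The projections of the cobar resolution of `M`. -/
noncomputable def cobarObjP (n : ℕ) (M : DGFunctor A C) :
    (cobarObj hW hC M).natTrans (cofreeIter hW (n + 1) M) (-n) :=
  (cobarP hW hC n).1 M

lemma cofreeD_succ_app (n : ℕ) (M : DGFunctor A C) (X : A.Obj) :
    (cofreeD hW (n + 1) M).1 X =
      (show C.Hom ((cofreeIter hW (n + 1) M).obj X) ((cofreeIter hW (n + 2) M).obj X) 0 from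
        (cofreeUnitApp hW (cofreeIter hW (n + 1) M)).1 X) -
      (show C.Hom ((cofreeIter hW (n + 1) M).obj X) ((cofreeIter hW (n + 2) M).obj X) 0 from
        (coindNat hW (cofreeD hW n M).1).1 X) := rfl

lemma d_cofreeD (n : ℕ) (M : DGFunctor A C) (X : A.Obj) :
    C.d 0 1 ((cofreeD hW n M).1 X) = 0 :=
  congrFun (congrArg Subtype.val (d_cobarD (d_cofreeUnit hW) n M)) X

lemma cofreeD_comp (n : ℕ) (M : DGFunctor A C) (X : A.Obj) :
    C.comp (add_zero 0) ((cofreeD hW n M).1 X) ((cofreeD hW (n + 1) M).1 X) = 0 :=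
  congrFun (congrArg Subtype.val
    (cobarD_comp (W := cofree hW) (η := cofreeUnit hW) n M)) X

lemma isTot_cobarObj (M : DGFunctor A C) (X : A.Obj) :
    IsTot (fun n => (cofreeIter hW (n + 1) M).obj X) (fun n => (cofreeD hW (n + 1) M).1 X)
      ((cobarObj hW hC M).obj X) fun n => (cobarObjP hW hC n M).1 X :=
  IsTot.objectwise (N := fun n => cofreeIter hW (n + 1) M) (D := fun n => cofreeD hW (n + 1) M) hC
    (fun n => d_cofreeD hW (n + 1) M) (fun n => cofreeD_comp hW (n + 1) M) (isTot_cobar hW hC M) X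

/-- The coaugmentation of the cobar resolution. -/
noncomputable def cobarι : (DGFunctor.id (A.dgFun C)).natTrans (cobar hW hC) 0 :=
  (exists_cobar_unit _ _ (isTot_cobar hW hC) (d_cofreeUnit hW)).choose

lemma d_cobarι (M : (A.dgFun C).Obj) : (A.dgFun C).d 0 1 ((cobarι hW hC).1 M) = 0 :=
  (exists_cobar_unit _ _ (isTot_cobar hW hC) (d_cofreeUnit hW)).choose_spec.1 M

/-- The coaugmentation of the cobar resolution of `M`. -/
noncomputable def cobarObjι (M : DGFunctor A C) : M.natTrans (cobarObj hW hC M) 0 :=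
  (cobarι hW hC).1 M

lemma d_cobarObjι (M : DGFunctor A C) (X : A.Obj) : C.d 0 1 ((cobarObjι hW hC M).1 X) = 0 :=
  congrFun (congrArg Subtype.val (d_cobarι hW hC M)) X

lemma cobarObjι_zero (M : DGFunctor A C) (X : A.Obj) :
    C.comp (by simp) ((cobarObjι hW hC M).1 X) ((cobarObjP hW hC 0 M).1 X) =
      (cofreeUnitApp hW M).1 X :=
  congrFun (congrArg Subtype.val
    ((exists_cobar_unit _ _ (isTot_cobar hW hC) (d_cofreeUnit hW)).choose_spec.2.1 M)) X

lemma cobarObjι_succ (M : DGFunctor A C) (X : A.Obj) (n : ℕ) :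
    C.comp (zero_add _) ((cobarObjι hW hC M).1 X) ((cobarObjP hW hC (n + 1) M).1 X) = 0 :=
  congrFun (congrArg Subtype.val
    ((exists_cobar_unit _ _ (isTot_cobar hW hC) (d_cofreeUnit hW)).choose_spec.2.2 M n)) X

end resolution

end DGCat

/-! ### The cobar resolution is objectwise contractible -/

namespace DGCat

variable {k : Type w} [Field k] {A : DGCat.{w, v₁, u₁} k} {C : DGCat.{w, v₂, u₂} k}
  (hW : HasWProd A C) (hC : HasTot C)

section contraction

/-- The extra codegeneracy `W ^ (n + 1) M → W ^ n M`, which is not natural in the argument. -/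
noncomputable def cofreeE (n : ℕ) (M : DGFunctor A C) (X : A.Obj) :
    C.Hom ((cofreeIter hW (n + 1) M).obj X) ((cofreeIter hW n M).obj X) 0 :=
  coindπ hW (cofreeIter hW n M).obj X (A.id X)

lemma d_cofreeE (n : ℕ) (M : DGFunctor A C) (X : A.Obj) : C.d 0 1 (cofreeE hW n M X) = 0 := by
  have e := d_coindπ (hW := hW) (N := (cofreeIter hW n M).obj) (zero_add 1) (A.id X)
  rw [A.d_id, map_zero] at e
  exact e

lemma cofreeUnitApp_cofreeE (M : DGFunctor A C) (X : A.Obj) :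
    C.comp (add_zero 0) ((cofreeUnitApp hW M).1 X) (coindπ hW M.obj X (A.id X)) = C.id _ :=
  (cofreeUnitApp_π hW M (A.id X)).trans (M.map_id X)

lemma cofreeD_cofreeE (n : ℕ) (M : DGFunctor A C) (X : A.Obj) :
    C.comp (add_zero 0) ((cofreeD hW (n + 1) M).1 X) (cofreeE hW (n + 1) M X) =
      C.id _ - C.comp (add_zero 0) (cofreeE hW n M X) ((cofreeD hW n M).1 X) := by
  have e₁ := cofreeUnitApp_cofreeE hW (cofreeIter hW (n + 1) M) X
  have e₂ := coindNat_π hW (cofreeD hW n M).1 (add_zero 0) (add_zero 0) (A.id X)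
  rw [zero_mul, Int.negOnePow_zero, one_smul] at e₂
  rw [cofreeD_succ_app, map_sub, LinearMap.sub_apply]
  exact congrArg₂ (· - ·) e₁ e₂

/-- The coaugmentation of the cobar resolution is objectwise a homotopy equivalence: the extra
codegeneracies contract the augmented cobar complex. -/
lemma exists_cobarObj_contraction (M : DGFunctor A C) (X : A.Obj) :
    ∃ (ρ : C.Hom ((cobarObj hW hC M).obj X) (M.obj X) 0)
      (h : C.Hom ((cobarObj hW hC M).obj X) ((cobarObj hW hC M).obj X) (-1)),
      C.d 0 1 ρ = 0 ∧ C.comp (add_zero 0) ((cobarObjι hW hC M).1 X) ρ = C.id _ ∧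
      C.d (-1) 0 h = C.id _ - C.comp (add_zero 0) ρ ((cobarObjι hW hC M).1 X) := by
  have hT := isTot_cobarObj hW hC M X
  let p (n : ℕ) := (cobarObjP hW hC n M).1 X
  have hp₀ : C.d (-(0 : ℕ)) 1 (p 0) = 0 := hT.d_zero 1
  have hp : ∀ n, C.d (-(n + 1 : ℕ)) (-n) (p (n + 1)) =
    C.comp (add_zero _) (p n) ((cofreeD hW (n + 1) M).1 X) := fun n => hT.d_succ n _ _
  let M₀ : DGFunctor A C := cofreeIter hW 0 M
  let ι : C.Hom (M₀.obj X) ((cobarObj hW hC M).obj X) 0 := (cobarObjι hW hC M).1 X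
  let η : C.Hom (M₀.obj X) ((cofreeIter hW 1 M).obj X) 0 := (cofreeD hW 0 M).1 X
  let e₀ : C.Hom ((cofreeIter hW 1 M).obj X) (M₀.obj X) 0 := cofreeE hW 0 M X
  have hι₀ : C.comp (by simp) ι (p 0) = η := cobarObjι_zero hW hC M X
  have hι : ∀ n, C.comp (zero_add _) ι (p (n + 1)) = 0 := cobarObjι_succ hW hC M X
  have hηe : C.comp (add_zero 0) η e₀ = C.id _ := cofreeUnitApp_cofreeE hW M X
  let ρ : C.Hom ((cobarObj hW hC M).obj X) (M₀.obj X) 0 := C.comp (by simp) (p 0) e₀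
  let θ (n : ℕ) (q : ℤ) (hq : -1 + -(n : ℤ) = q) :
      C.Hom ((cobarObj hW hC M).obj X) ((cofreeIter hW (n + 1) M).obj X) q :=
    (n : ℤ).negOnePow • C.comp (by push_cast; omega) (p (n + 1)) (cofreeE hW (n + 1) M X)
  -- the homotopy is given by the extra codegeneracies, up to sign
  obtain ⟨h, hh⟩ := hT.lift θ
  have hh' : ∀ n, C.comp (by push_cast; omega) h (p n) = (n : ℤ).negOnePow •
    C.comp (add_zero (-((n + 1 : ℕ) : ℤ))) (p (n + 1)) (cofreeE hW (n + 1) M X) :=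
    fun n => hh n _ _
  have hdρ : C.d 0 1 ρ = 0 := by
    rw [C.leibniz (n := 0) (n' := 1) (p 0) e₀ (by simp) (by simp) (zero_add 1) (by simp)
      (by simp) (add_zero 1), hp₀, d_cofreeE]
    simp
  have hιρ : C.comp (add_zero 0) ι ρ = C.id _ := by
    rw [← C.assoc (pq := 0) (n := 0) ι (p 0) e₀ (by simp) (add_zero 0) (by simp) (by simp), hι₀,
      hηe]
  have hdh : C.d (-1) 0 h = C.id _ - C.comp (add_zero 0) ρ ι := hT.ext fun n q hq => by
    obtain rfl : -(n : ℤ) = q := by omega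
    change C.comp hq _ (p n) = C.comp hq _ (p n)
    rw [map_sub, LinearMap.sub_apply, C.id_comp]
    have e := C.leibniz (n := -((n + 1 : ℕ) : ℤ)) (n' := -n) h (p n) (by push_cast; omega)
      (neg_add_cancel 1) rfl (by push_cast; omega) (by omega) hq
    rw [hh', C.d_units_smul, C.d_comp_closed (by push_cast; omega) _ (d_cofreeE hW _ _ _), hp,
      C.assoc _ _ _ (add_zero _) (add_zero _) (add_zero 0) (add_zero _), cofreeD_cofreeE,
      map_sub, C.comp_id] at e
    have e' : C.comp (by omega : -1 + (-(n : ℤ) + 1) = -n) h (C.d (-n) (-n + 1) (p n)) +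
        (-(n : ℤ)).negOnePow • C.comp (add_zero (-(n : ℤ))) (p n)
          (C.comp (add_zero 0) (cofreeE hW n M X) ((cofreeD hW n M).1 X)) =
        (-(n : ℤ)).negOnePow • C.comp hq (C.comp (add_zero 0) ρ ι) (p n) := by
      rw [C.assoc ρ ι (p n) _ hq (zero_add _) (zero_add _)]
      cases n with
      | zero =>
        have e₁ : C.comp (zero_add (-((0 : ℕ) : ℤ))) ι (p 0) = η := hι₀
        have e₂ : C.d (-((0 : ℕ) : ℤ)) (-((0 : ℕ) : ℤ) + 1) (p 0) = 0 := hT.d_zero _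
        rw [e₁, e₂, map_zero]
        exact (zero_add _).trans <| congrArg _
          (C.assoc (p 0) e₀ η (by simp) (zero_add _) (add_zero 0) _).symm
      | succ n =>
        have e₂ : C.d (-((n + 1 : ℕ) : ℤ)) (-((n + 1 : ℕ) : ℤ) + 1) (p (n + 1)) =
          C.comp (by push_cast; omega) (p n) ((cofreeD hW (n + 1) M).1 X) := hT.d_succ n _ _
        rw [hι, map_zero, smul_zero, e₂,
          ← C.assoc (pq := -((n + 1 : ℕ) : ℤ)) _ _ _ (by push_cast; omega)
            (add_zero _) (by push_cast; omega) _, hh', C.units_smul_comp,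
          C.assoc _ _ _ (add_zero _) (add_zero _) (add_zero 0) (add_zero _),
          show (-((n + 1 : ℕ) : ℤ)).negOnePow = -(n : ℤ).negOnePow by
            rw [← Int.negOnePow_succ]
            exact Int.negOnePow_congr (-n - 1) (by push_cast; ring), Units.neg_smul]
        exact add_neg_cancel _
    rw [Int.negOnePow_neg] at e e'
    refine smul_left_cancel (n : ℤ).negOnePow ?_
    rw [smul_sub, ← e']
    rw [smul_sub] at e
    rw [← sub_sub, sub_right_comm, e]
    abel
  exact ⟨ρ, h, hdρ, hιρ, hdh⟩

end contraction

section coind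

/-- The isomorphism `bijective_natTrans_coind`, as a linear map. -/
noncomputable def natTransCoindₗ (Z : DGFunctor A C) (N : A.Obj → C.Obj) (m : ℤ) :
    Z.natTrans (coind hW N) m →ₗ[k] (∀ Y, C.Hom (Z.obj Y) (N Y) m) where
  toFun φ := fun Y => C.comp (add_zero m) (φ.1 Y) (coindπ hW N Y (A.id Y))
  map_add' _ _ := funext fun _ => LinearMap.map_add₂ (C.comp (add_zero m)) _ _ _
  map_smul' _ _ := funext fun _ => LinearMap.map_smul₂ (C.comp (add_zero m)) _ _ _

/-- The isomorphism `bijective_natTrans_coind`, as a chain map. -/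
noncomputable def natTransCoindHom (Z : DGFunctor A C) (N : A.Obj → C.Obj) :
    ((A.dgFun C).homCplx Z (coind hW N)).Hom (Cplx.pi fun Y => C.homCplx (Z.obj Y) (N Y)) where
  f m := natTransCoindₗ hW Z N m
  comm n m h φ := funext fun Y => by
    have e : C.d 0 1 (coindπ hW N Y (A.id Y)) = 0 := by
      rw [d_coindπ (zero_add 1), A.d_id, map_zero]
    exact (C.d_comp_closed h (φ.1 Y) e).symm

end coind

end DGCat

/-! ### Morphisms to products of cotensors and to cobar resolutions -/

namespace Cplx

variable {k : Type w} [Field k]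

/-- The mapping cone of a chain map, shifted by one. -/
abbrev cone {K : Cplx.{w, v₁} k} {L : Cplx.{w, v₂} k} (u : K.Hom L) : Cplx.{w, max v₁ v₂} k where
  X n := K.X (n + 1) × L.X n
  d n m := (-(K.d (n + 1) (m + 1)) ∘ₗ LinearMap.fst k _ _).prod
    (L.d n m ∘ₗ LinearMap.snd k _ _ -
      (if h : n + 1 = m then h ▸ u.f (n + 1) else 0) ∘ₗ LinearMap.fst k _ _)
  d_d := by
    rintro n _ _ ⟨b, x⟩ rfl rfl
    have e₁ := K.d_d _ _ _ b rfl (rfl : n + 1 + 1 + 1 = _)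
    have e₂ := L.d_d _ _ _ x rfl (rfl : n + 1 + 1 = _)
    have e₃ := u.comm _ _ rfl b
    simp [e₁, e₂, e₃]

lemma cone_d {K : Cplx.{w, v₁} k} {L : Cplx.{w, v₂} k} (u : K.Hom L) (n : ℤ) (b : K.X (n + 1))
    (x : L.X n) :
    (cone u).d n (n + 1) (b, x) = (-K.d (n + 1) (n + 1 + 1) b, L.d n (n + 1) x - u.f (n + 1) b) := by
  simp

lemma Hom.isQuasiIso_iff {K : Cplx.{w, v₁} k} {L : Cplx.{w, v₂} k} {u : K.Hom L} :
    u.IsQuasiIso ↔ (cone u).Acyclic := by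
  constructor
  · rintro h l _ _ rfl rfl ⟨b, x⟩ hx
    rw [cone_d] at hx
    obtain ⟨h₁, h₂⟩ := Prod.mk.injEq _ _ _ _ ▸ hx
    obtain ⟨c, y, hc, hy⟩ := h l _ _ _ rfl rfl rfl b x (neg_eq_zero.1 h₁) (sub_eq_zero.1 h₂)
    refine ⟨(-c, y), (cone_d u l _ _).trans (Prod.ext ?_ ?_)⟩
    · dsimp only
      rw [map_neg, neg_neg, hc]
    · dsimp only
      rw [map_neg, sub_neg_eq_add]
      exact (add_comm _ _).trans hy
  · rintro h l _ _ _ rfl rfl rfl b x hb hx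
    obtain ⟨⟨c, y⟩, hy⟩ := h l _ _ rfl rfl (b, x) (by rw [cone_d, hb, hx, sub_self, neg_zero]; rfl)
    rw [cone_d] at hy
    obtain ⟨h₁, h₂⟩ := Prod.mk.injEq _ _ _ _ ▸ hy
    exact ⟨-c, y, by rw [map_neg, h₁], by rw [map_neg, ← h₂]; abel⟩

/-- A decomposition of `K` as the product of the complexes `Hom_k(E t, K' t)`: an element of `K`
is a family of linear maps, with values `π t _ g x` at `g`. -/
structure LinDecomp {T : Type u} (E : T → Cplx.{w, v₁} k) (K : Cplx.{w, v₂} k)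
    (K' : T → Cplx.{w, v₃} k) where
  π : ∀ (t : T) {p m q : ℤ}, m + p = q → ((E t).X p →ₗ[k] K.X m →ₗ[k] (K' t).X q)
  d_π : ∀ (t : T) {p m q : ℤ} (h : m + p = q) (g : (E t).X p) (x : K.X m),
    (K' t).d q (q + 1) (π t h g x) = π t (by omega) ((E t).d p (p + 1) g) x +
      p.negOnePow • π t (by omega : m + 1 + p = q + 1) g (K.d m (m + 1) x)
  ext : ∀ {m : ℤ} {x y : K.X m}, (∀ (t : T) (p q : ℤ) (h : m + p = q) (g : (E t).X p),
    π t h g x = π t h g y) → x = y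
  lift : ∀ {m : ℤ} (θ : ∀ (t : T) (p q : ℤ), m + p = q → ((E t).X p →ₗ[k] (K' t).X q)),
    ∃ x : K.X m, ∀ (t : T) (p q : ℤ) (h : m + p = q) (g : (E t).X p), π t h g x = θ t p q h g

namespace LinDecomp

variable {T : Type u} {E : T → Cplx.{w, v} k}

/-- A product of complexes `Hom_k(E t, K' t)` is acyclic if the complexes `K' t` are: over a field
these are contractible. -/
lemma acyclic {K : Cplx.{w, v₂} k} {K' : T → Cplx.{w, v₃} k} (D : LinDecomp E K K')
    (hK : ∀ t, (K' t).Acyclic) : K.Acyclic := by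
  choose s hs using fun t => (hK t).exists_contraction
  -- apply the contractions to the values of `x`
  rintro l _ _ rfl rfl x hx
  let θ (t : T) (p q : ℤ) (hq : l + p = q) : (E t).X p →ₗ[k] (K' t).X q :=
    p.negOnePow • s t (q + 1) q ∘ₗ (D.π t (by omega : l + 1 + p = q + 1)).flip x
  obtain ⟨y, hy⟩ := D.lift θ
  have hy' : ∀ t p q (hq : l + p = q) g, D.π t hq g y =
    p.negOnePow • s t (q + 1) q (D.π t (by omega) g x) := hy
  refine ⟨y, D.ext fun t p q' hq' g => ?_⟩
  obtain ⟨q, rfl⟩ : ∃ q, q' = q + 1 := ⟨q' - 1, by omega⟩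
  have e := D.d_π t (by omega : l + p = q) g y
  have e₂ := D.d_π t hq' g x
  have e₃ := hs t q (q + 1) (q + 1 + 1) rfl rfl (D.π t hq' g x)
  rw [hx, map_zero, smul_zero, add_zero] at e₂
  rw [hy', hy', Units.smul_def, map_zsmul, ← Units.smul_def, Int.negOnePow_succ, Units.neg_smul,
    eq_neg_add_iff_add_eq, ← smul_add] at e
  rw [e₂] at e₃
  exact (smul_left_cancel _ e).symm.trans ((add_comm _ _).trans e₃)

/-- A product of decomposed complexes is decomposed. -/
def pi {ι : Type u₁} {K : ι → Cplx.{w, v₂} k} {K' : ι → T → Cplx.{w, v₃} k}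
    (D : ∀ i, LinDecomp E (K i) (K' i)) :
    LinDecomp E (Cplx.pi K) fun t => Cplx.pi fun i => K' i t where
  π t _ _ _ h := LinearMap.mk₂ k (fun g x i => (D i).π t h g (x i))
    (fun _ _ _ => funext fun _ => LinearMap.map_add₂ _ _ _ _)
    (fun _ _ _ => funext fun _ => LinearMap.map_smul₂ _ _ _ _)
    (fun _ _ _ => funext fun _ => map_add _ _ _)
    (fun _ _ _ => funext fun _ => map_smul _ _ _)
  d_π t _ _ _ h g x := funext fun i => (D i).d_π t h g (x i)
  ext h := funext fun i => (D i).ext fun t p q hq g => congrFun (h t p q hq g) i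
  lift θ := by
    choose x hx using fun i => (D i).lift fun t p q hq => LinearMap.proj i ∘ₗ θ t p q hq
    exact ⟨x, fun t p q hq g => funext fun i => hx i t p q hq g⟩

/-- The cone of a map of decomposed complexes is decomposed. -/
def cone {K : Cplx.{w, v₁} k} {K' : T → Cplx.{w, v₁} k} {L : Cplx.{w, v₂} k}
    {L' : T → Cplx.{w, v₂} k} (D : LinDecomp E K K') (D' : LinDecomp E L L') (a : K.Hom L)
    (a' : ∀ t, (K' t).Hom (L' t))
    (h : ∀ t {p m q : ℤ} (h : m + p = q) g x, D'.π t h g (a.f m x) = (a' t).f q (D.π t h g x)) :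
    LinDecomp E (Cplx.cone a) fun t => Cplx.cone (a' t) where
  π t p m q h := LinearMap.mk₂ k
    (fun g x => (p.negOnePow • D.π t (by omega : m + 1 + p = q + 1) g x.1, D'.π t h g x.2))
    (fun _ _ _ => Prod.ext (by simp only [map_add, LinearMap.add_apply, smul_add, Prod.fst_add])
      (by simp only [map_add, LinearMap.add_apply, Prod.snd_add]))
    (fun _ _ _ => Prod.ext
      (by simp only [map_smul, LinearMap.smul_apply, Prod.smul_fst]; rw [smul_comm])
      (by simp only [map_smul, LinearMap.smul_apply, Prod.smul_snd]))
    (fun _ _ _ => Prod.ext (by simp only [map_add, smul_add, Prod.fst_add])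
      (by simp only [map_add, Prod.snd_add]))
    (fun _ _ _ => Prod.ext (by simp only [map_smul, Prod.smul_fst]; rw [smul_comm])
      (by simp only [map_smul, Prod.smul_snd]))
  d_π t p m q h' g x := by
    obtain ⟨b, x⟩ := x
    have e₁ := D.d_π t (by omega : m + 1 + p = q + 1) g b
    have e₂ := D'.d_π t h' g x
    have e₃ := h t (by omega : m + 1 + p = q + 1) g b
    refine (cone_d (a' t) q _ _).trans (Eq.trans (Prod.ext ?_ ?_)
      (congrArg (fun z : (Cplx.cone a).X (m + 1) =>
        ((p + 1).negOnePow • D.π t (by omega) ((E t).d p (p + 1) g) b,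
          D'.π t (by omega : m + (p + 1) = q + 1) ((E t).d p (p + 1) g) x) +
        p.negOnePow • (p.negOnePow • D.π t (by omega : m + 1 + 1 + p = q + 1 + 1) g z.1,
          D'.π t (by omega : m + 1 + p = q + 1) g z.2)) (cone_d a m b x)).symm)
    · simp only [Prod.fst_add, Prod.smul_fst, Units.smul_def, map_zsmul, map_neg]
      simp only [← Units.smul_def]
      rw [e₁, Int.negOnePow_succ, smul_smul, ← Int.negOnePow_add, Int.negOnePow_even _ ⟨p, rfl⟩,
        smul_add, smul_smul, ← Int.negOnePow_add, Int.negOnePow_even _ ⟨p, rfl⟩, one_smul,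
        one_smul, Units.neg_smul, neg_add]
    · simp only [Prod.snd_add, Prod.smul_snd, map_sub, Units.smul_def, map_zsmul]
      simp only [← Units.smul_def]
      rw [e₂, ← e₃, smul_sub, add_sub_assoc]
  ext {m z z'} h' := by
    have h₁ : z.1 = z'.1 := D.ext fun t p q hq g => by
      obtain ⟨q, rfl⟩ : ∃ q', q = q' + 1 := ⟨q - 1, by omega⟩
      exact smul_left_cancel p.negOnePow (congrArg Prod.fst (h' t p q (by omega) g))
    have h₂ : z.2 = z'.2 := D'.ext fun t p q hq g => congrArg Prod.snd (h' t p q hq g)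
    exact Prod.ext h₁ h₂
  lift {m} θ := by
    have hθ : ∀ t p q (_ : m + 1 + p = q), ∃ f : (E t).X p →ₗ[k] (K' t).X q,
        ∀ q' (e : q = q' + 1) g, e ▸ f g = p.negOnePow • (θ t p q' (by omega) g).1 := by
      intro t p q hq
      obtain ⟨q, rfl⟩ : ∃ q', q = q' + 1 := ⟨q - 1, by omega⟩
      refine ⟨p.negOnePow • LinearMap.fst k _ _ ∘ₗ θ t p q (by omega), fun q' e g => ?_⟩
      obtain rfl : q = q' := by omega
      rfl
    choose θ₁ hθ₁ using hθ
    obtain ⟨b, hb⟩ := D.lift θ₁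
    obtain ⟨x, hx⟩ := D'.lift fun t p q hq => LinearMap.snd k _ _ ∘ₗ θ t p q hq
    refine ⟨(b, x), fun t p q hq g => Prod.ext ?_ (hx t p q hq g)⟩
    have e : D.π t (by omega : m + 1 + p = q + 1) g b = p.negOnePow • (θ t p q hq g).1 :=
      (hb t p (q + 1) (by omega) g).trans (hθ₁ t p (q + 1) (by omega) q rfl g)
    exact (Int.eq_negOnePow_smul_symm e).symm

/-- A chain map between products of complexes `Hom_k(E t, -)` is a quasi-isomorphism if it is
induced by quasi-isomorphisms, because its cone is again such a product. -/
lemma isQuasiIso {K : Cplx.{w, v₁} k} {K' : T → Cplx.{w, v₁} k} {L : Cplx.{w, v₂} k}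
    {L' : T → Cplx.{w, v₂} k} (D : LinDecomp E K K') (D' : LinDecomp E L L') (a : K.Hom L)
    (a' : ∀ t, (K' t).Hom (L' t))
    (h : ∀ t {p m q : ℤ} (h : m + p = q) g x, D'.π t h g (a.f m x) = (a' t).f q (D.π t h g x))
    (ha : ∀ t, (a' t).IsQuasiIso) : a.IsQuasiIso :=
  Hom.isQuasiIso_iff.2 <| (D.cone D' a a' h).acyclic fun t => Hom.isQuasiIso_iff.1 (ha t)

end LinDecomp

end Cplx

namespace DGCat

variable {k : Type w} [Field k] {A : DGCat.{w, v₁, u₁} k} {C : DGCat.{w, v₂, u₂} k}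

section precomp

variable (C)

/-- Precomposition with a family of closed morphisms of degree `0`. -/
abbrev precompPi {ι : Type u} {Z : ι → C.Obj} {S : C.Obj} (a : ∀ i, C.Hom (Z i) S 0)
    (ha : ∀ i, C.d 0 1 (a i) = 0) (N : C.Obj) :
    (C.homCplx S N).Hom (Cplx.pi fun i => C.homCplx (Z i) N) where
  f n := LinearMap.pi fun i => (C.precompHom (a i) (ha i) N).f n
  comm n m h x := funext fun i => (C.precompHom (a i) (ha i) N).comm n m h x

variable {C}

/-- The complex of morphisms `Z → ∏ Y, Hom_k(A(X, Y), N Y)` is the product of the complexes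
`Hom_k(A(X, Y), C(Z, N Y))`. -/
def WProd.linDecomp {X : A.Obj} {N : A.Obj → C.Obj} (P : WProd A C X N) (Z : C.Obj) :
    Cplx.LinDecomp (fun Y => A.homCplx X Y) (C.homCplx Z P.V) fun Y => C.homCplx Z (N Y) where
  π Y p m q h := (C.comp h).flip ∘ₗ P.π
  d_π Y p m q h g x := by
    have e := C.leibniz x (P.π g) h rfl rfl rfl (by omega) (by omega)
    rw [P.d_π rfl] at e
    exact e
  ext h := P.ext h
  lift θ := P.lift θ

lemma WProd.isQuasiIso_precompHom {X : A.Obj} {N : A.Obj → C.Obj} (P : WProd A C X N)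
    {Z S : C.Obj} {a : C.Hom Z S 0} {ha : C.d 0 1 a = 0}
    (h : ∀ Y, (C.precompHom a ha (N Y)).IsQuasiIso) : (C.precompHom a ha P.V).IsQuasiIso :=
  (P.linDecomp S).isQuasiIso (P.linDecomp Z) _ (fun Y => C.precompHom a ha (N Y))
    (fun _ _ _ _ h _ _ => C.assoc _ _ _ _ h h _) h

lemma WProd.isQuasiIso_precompPi {X : A.Obj} {N : A.Obj → C.Obj} (P : WProd A C X N)
    {ι : Type u} {Z : ι → C.Obj} {S : C.Obj} {a : ∀ i, C.Hom (Z i) S 0}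
    {ha : ∀ i, C.d 0 1 (a i) = 0} (h : ∀ Y, (C.precompPi a ha (N Y)).IsQuasiIso) :
    (C.precompPi a ha P.V).IsQuasiIso :=
  (P.linDecomp S).isQuasiIso (Cplx.LinDecomp.pi fun i => P.linDecomp (Z i)) _
    (fun Y => C.precompPi a ha (N Y))
    (fun _ _ _ _ h _ _ => funext fun _ => C.assoc _ _ _ _ h h _) h

lemma IsTot.isQuasiIso_precompHom {N : ℕ → C.Obj} {D : ∀ n, C.Hom (N n) (N (n + 1)) 0} {T : C.Obj}
    {p : ∀ n : ℕ, C.Hom T (N n) (-n)} (hT : IsTot N D T p) (hD : ∀ n, C.d 0 1 (D n) = 0)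
    (hDD : ∀ n, C.comp (add_zero 0) (D n) (D (n + 1)) = 0) {Z S : C.Obj} {a : C.Hom Z S 0}
    {ha : C.d 0 1 a = 0} (h : ∀ n, (C.precompHom a ha (N n)).IsQuasiIso) :
    (C.precompHom a ha T).IsQuasiIso := by
  refine (hT.totDecomp hD hDD S).isQuasiIso (hT.totDecomp hD hDD Z) _
    (fun n => (C.precompHom a ha (N n)).shift (-n))
    (fun n m x => ?_) (fun n m m' h x => ?_) fun n => (h n).shift _
  · exact C.assoc _ _ _ _ _ _ _
  · refine (congrArg ((n : ℤ).negOnePow • ·)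
      (C.assoc a x (D n) _ _ (by push_cast; omega) (zero_add (m' + -((n + 1 : ℕ) : ℤ))))).trans ?_
    exact (C.comp_units_smul _ _ _ _).symm

end precomp

section cofree

variable (hW : HasWProd A C) (hC : HasTot C)

lemma isQuasiIso_precompHom_cofreeIter {M : DGFunctor A C} {Z S : C.Obj} {a : C.Hom Z S 0}
    {ha : C.d 0 1 a = 0} (h : ∀ Y, (C.precompHom a ha (M.obj Y)).IsQuasiIso) (n : ℕ) (X : A.Obj) :
    (C.precompHom a ha ((cofreeIter hW n M).obj X)).IsQuasiIso := by
  induction n generalizing X with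
  | zero => exact h X
  | succ n ih => exact (coindProd hW _ X).isQuasiIso_precompHom ih

lemma isQuasiIso_precompPi_cofreeIter {M : DGFunctor A C} {ι : Type u} {Z : ι → C.Obj}
    {S : C.Obj} {a : ∀ i, C.Hom (Z i) S 0} {ha : ∀ i, C.d 0 1 (a i) = 0}
    (h : ∀ Y, (C.precompPi a ha (M.obj Y)).IsQuasiIso) (n : ℕ) (X : A.Obj) :
    (C.precompPi a ha ((cofreeIter hW n M).obj X)).IsQuasiIso := by
  induction n generalizing X with
  | zero => exact h X
  | succ n ih => exact (coindProd hW _ X).isQuasiIso_precompPi ih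

lemma isQuasiIso_precompHom_coind {Z S : DGFunctor A C} (φ : Z.natTrans S 0)
    (hφ : ∀ Y, C.d 0 1 (φ.1 Y) = 0) {N : A.Obj → C.Obj}
    (h : ∀ Y, (C.precompHom (φ.1 Y) (hφ Y) (N Y)).IsQuasiIso) :
    ((A.dgFun C).precompHom (X := Z) (X' := S) φ (Subtype.ext (funext hφ))
      (coind hW N)).IsQuasiIso :=
  Cplx.Hom.IsQuasiIso.of_bijective (natTransCoindHom hW S N) (natTransCoindHom hW Z N)
    (fun m => bijective_natTrans_coind S N m (hW := hW))
    (fun m => bijective_natTrans_coind Z N m (hW := hW))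
    (fun _ _ => funext fun _ => C.assoc _ _ _ _ _ _ _)
    (Cplx.Hom.IsQuasiIso.pi h)

/-- Precomposition with `φ` is a quasi-isomorphism on morphisms to the cobar resolution of `M` if
precomposition with the components of `φ` is a quasi-isomorphism on morphisms to the values
of `M`. -/
lemma isQuasiIso_precompHom_cobarObj {Z S : DGFunctor A C} (φ : Z.natTrans S 0)
    (hφ : ∀ Y, C.d 0 1 (φ.1 Y) = 0) {M : DGFunctor A C}
    (h : ∀ Y Y', (C.precompHom (φ.1 Y) (hφ Y) (M.obj Y')).IsQuasiIso) :
    ((A.dgFun C).precompHom (X := Z) (X' := S) φ (Subtype.ext (funext hφ))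
      (cobarObj hW hC M)).IsQuasiIso := by
  exact (IsTot.isQuasiIso_precompHom (isTot_cobar hW hC M)
    (fun n => d_cobarD (d_cofreeUnit hW) (n + 1) M)
    (fun n => cobarD_comp (W := cofree hW) (η := cofreeUnit hW) (n + 1) M)) fun n =>
      isQuasiIso_precompHom_coind hW φ hφ fun Y => isQuasiIso_precompHom_cofreeIter hW (h Y) n Y

end cofree

end DGCat

namespace DGCat

open CochainComplex.HomComplex

variable {k : Type u} [Field k]

/-! ### Products of cotensors and total objects for complexes of vector spaces -/

section WProd

variable (A : DGCat.{u, u, u} k) (X : A.Obj) (N : A.Obj → CochainComplex (ModuleCat.{u} k) ℤ)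

/-- The degree `m` part of `∏ Y, Hom_k(A(X, Y), N Y)`. The pairs `(p, q)` with `m + p = q` stand for
the degree `p` in `A(X, Y)` and the degree `q` in `N Y`. -/
abbrev cotensorX (m : ℤ) : Type u :=
  ∀ (Y : A.Obj) (a : { a : ℤ × ℤ // m + a.1 = a.2 }), A.Hom X Y a.1.1 →ₗ[k] (N Y).X a.1.2

/-- The differential of `∏ Y, Hom_k(A(X, Y), N Y)`. -/
def cotensorD (m m' : ℤ) (h : m + 1 = m') : cotensorX A X N m →ₗ[k] cotensorX A X N m' :=
  LinearMap.pi fun Y => LinearMap.pi fun a => a.1.1.negOnePow •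
    (LinearMap.llcomp k _ _ _ ((N Y).d (a.1.2 - 1) a.1.2).hom ∘ₗ
        LinearMap.proj (⟨(a.1.1, a.1.2 - 1), by have := a.2; dsimp only at this ⊢; omega⟩ :
          { a : ℤ × ℤ // m + a.1 = a.2 }) ∘ₗ LinearMap.proj Y -
      LinearMap.lcomp k _ (A.d a.1.1 (a.1.1 + 1)) ∘ₗ
        LinearMap.proj (⟨(a.1.1 + 1, a.1.2), by have := a.2; dsimp only at this ⊢; omega⟩ :
          { a : ℤ × ℤ // m + a.1 = a.2 }) ∘ₗ LinearMap.proj Y)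

lemma cotensorD_apply {m m' : ℤ} (h : m + 1 = m') (x : cotensorX A X N m) (Y : A.Obj) {p q q' : ℤ}
    (hq : m + p = q) (hq' : m' + p = q') (hqq : q + 1 = q') (g : A.Hom X Y p) :
    cotensorD A X N m m' h x Y ⟨(p, q'), hq'⟩ g = p.negOnePow •
      (((N Y).d q q').hom (x Y ⟨(p, q), hq⟩ g) -
        x Y ⟨(p + 1, q'), by dsimp only; omega⟩ (A.d p (p + 1) g)) := by
  obtain rfl : q = q' - 1 := by omega
  rfl

/-- The complex `∏ Y, Hom_k(A(X, Y), N Y)`. -/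
def cotensor : CochainComplex (ModuleCat.{u} k) ℤ where
  X m := ModuleCat.of k (cotensorX A X N m)
  d m m' := ModuleCat.ofHom (if h : m + 1 = m' then cotensorD A X N m m' h else 0)
  shape m m' h := by
    rw [dif_neg (by simpa using h)]
    rfl
  d_comp_d' := by
    rintro m _ _ rfl rfl
    refine ModuleCat.hom_ext (LinearMap.ext fun (x : cotensorX A X N m) => ?_)
    refine funext fun Y => funext fun ⟨(p, q), ha⟩ => LinearMap.ext fun g => ?_
    dsimp only at ha g
    have e : cotensorD A X N (m + 1) (m + 1 + 1) rfl (cotensorD A X N m (m + 1) rfl x) Y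
        ⟨(p, q), ha⟩ g = 0 := by
      rw [cotensorD_apply (q := q - 1) (hq := by omega) (hqq := by omega),
        cotensorD_apply (q := q - 1 - 1) (hq := by omega) (hqq := by omega),
        cotensorD_apply (q := q - 1) (hq := by omega) (hqq := by omega),
        A.d_d _ _ _ g rfl rfl, map_zero, sub_zero, Units.smul_def, Units.smul_def, map_zsmul,
        map_sub, ← Units.smul_def, ← Units.smul_def]
      have h0 : ((N Y).d (q - 1) q).hom (((N Y).d (q - 1 - 1) (q - 1)).hom
          (x Y ⟨(p, q - 1 - 1), by dsimp only; omega⟩ g)) = 0 :=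
        LinearMap.congr_fun (congrArg ModuleCat.Hom.hom ((N Y).d_comp_d (q - 1 - 1) (q - 1) q)) _
      rw [h0, zero_sub, Int.negOnePow_succ, Units.neg_smul, smul_neg, sub_neg_eq_add,
        neg_add_cancel, smul_zero]
    simp only [dif_pos]
    exact e

/-- The evaluation of `∏ Y, Hom_k(A(X, Y), N Y)` at a morphism, in each degree. -/
def cotensorEv {Y : A.Obj} {m p q : ℤ} (h : m + p = q) (g : A.Hom X Y p) :
    cotensorX A X N m →ₗ[k] (N Y).X q where
  toFun x := x Y ⟨(p, q), h⟩ g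
  map_add' _ _ := rfl
  map_smul' _ _ := rfl

/-- The evaluation of `∏ Y, Hom_k(A(X, Y), N Y)` at a morphism. -/
def cotensorπ {Y : A.Obj} {p : ℤ} :
    A.Hom X Y p →ₗ[k] Cochain (cotensor A X N) (N Y) p where
  toFun g := Cochain.mk fun _ _ h => ModuleCat.ofHom (cotensorEv A X N h g)
  map_add' g g' := cochain_ext fun _ j hij x => map_add (x Y ⟨(p, j), hij⟩) g g'
  map_smul' r g := cochain_ext fun _ j hij x => map_smul (x Y ⟨(p, j), hij⟩) r g

lemma cotensorπ_v {Y : A.Obj} {m p q : ℤ} (h : m + p = q) (g : A.Hom X Y p)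
    (x : cotensorX A X N m) :
    ((cotensorπ A X N g).v m q h).hom x = x Y ⟨(p, q), h⟩ g := rfl

lemma cotensor_d (m : ℤ) (x : cotensorX A X N m) :
    ((cotensor A X N).d m (m + 1)).hom x = cotensorD A X N m (m + 1) rfl x := by
  simp only [cotensor, dif_pos]
  rfl

lemma δ_cotensorπ {Y : A.Obj} {p q : ℤ} (h : p + 1 = q) (g : A.Hom X Y p) :
    δ p q (cotensorπ A X N g) = cotensorπ A X N (A.d p q g) := by
  subst h
  refine cochain_ext fun i j hij x => ?_
  rw [δ_v_apply rfl _ i j (i + 1) (i + p) hij rfl rfl]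
  let x' : cotensorX A X N i := x
  change ((N Y).d (i + p) j).hom (((cotensorπ A X N g).v i (i + p) rfl).hom x') + (p + 1).negOnePow •
    ((cotensorπ A X N g).v (i + 1) j (by omega)).hom (((cotensor A X N).d i (i + 1)).hom x') =
      ((cotensorπ A X N (A.d p (p + 1) g)).v i j hij).hom x'
  rw [cotensor_d, cotensorπ_v, cotensorπ_v,
    cotensorπ_v, cotensorD_apply (q := i + p) (hq := rfl) (hqq := by omega), smul_smul,
    ← Int.negOnePow_add, show (p + 1 + p).negOnePow = -1 from
      (Int.negOnePow_congr p (by ring)).trans Int.negOnePow_one, Units.neg_smul, one_smul,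
    neg_sub, add_sub_cancel]

variable {A X N}

lemma cotensor_ext {Z : CochainComplex (ModuleCat.{u} k) ℤ} {m : ℤ}
    {φ φ' : Cochain Z (cotensor A X N) m} (h : ∀ (Y : A.Obj) (p q : ℤ) (h : m + p = q)
      (g : A.Hom X Y p), φ.comp (cotensorπ A X N g) h = φ'.comp (cotensorπ A X N g) h) :
    φ = φ' := by
  refine cochain_ext fun i j hij x => funext fun Y => funext fun ⟨(p, q), ha⟩ =>
    LinearMap.ext fun (g : A.Hom X Y p) => ?_
  have ha : j + p = q := ha
  have e := congrArg (fun z : Cochain Z (N Y) (m + p) => (z.v i q (by omega)).hom x)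
    (h Y p (m + p) rfl g)
  rw [comp_v_apply _ _ rfl i j q hij ha, comp_v_apply _ _ rfl i j q hij ha] at e
  exact e

lemma cotensor_lift {Z : CochainComplex (ModuleCat.{u} k) ℤ} {m : ℤ}
    (θ : ∀ (Y : A.Obj) (p q : ℤ), m + p = q → (A.Hom X Y p →ₗ[k] Cochain Z (N Y) q)) :
    ∃ φ : Cochain Z (cotensor A X N) m, ∀ (Y : A.Obj) (p q : ℤ) (h : m + p = q)
      (g : A.Hom X Y p), φ.comp (cotensorπ A X N g) h = θ Y p q h g := by
  let φ : Cochain Z (cotensor A X N) m := Cochain.mk fun i j hij => ModuleCat.ofHom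
    (show Z.X i →ₗ[k] cotensorX A X N j from
    { toFun x := fun Y a =>
        { toFun g := ((θ Y a.1.1 (m + a.1.1) rfl g).v i a.1.2 (by have := a.2; omega)).hom x
          map_add' g g' := by simp
          map_smul' r g := by simp }
      map_add' x x' := funext fun Y => funext fun a => LinearMap.ext fun g =>
        map_add ((θ Y a.1.1 (m + a.1.1) rfl g).v i a.1.2 (by have := a.2; omega)).hom x x'
      map_smul' r x := funext fun Y => funext fun a => LinearMap.ext fun g =>
        map_smul ((θ Y a.1.1 (m + a.1.1) rfl g).v i a.1.2 (by have := a.2; omega)).hom r x })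
  refine ⟨φ, fun Y p q h g => cochain_ext fun i j hij x => ?_⟩
  subst h
  rw [comp_v_apply _ _ rfl i (i + m) j rfl (by omega)]
  rfl

end WProd

lemma hasWProd_Cdg (A : DGCat.{u, u, u} k) : HasWProd A (Cdg k (ModuleCat.{u} k)) :=
  fun X N => ⟨⟨cotensor A X N, cotensorπ A X N, δ_cotensorπ A X N, cotensor_ext (N := N),
    cotensor_lift (N := N)⟩⟩

section Tot

variable (N : ℕ → CochainComplex (ModuleCat.{u} k) ℤ) (D : ∀ n, Cochain (N n) (N (n + 1)) 0)

/-- The degree `m` part of the total complex: pairs `(n, q)` with `m - n = q` stand for the degree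
`q` part of `N n`. -/
abbrev totX (m : ℤ) : Type u := ∀ a : { a : ℕ × ℤ // m + -(a.1 : ℤ) = a.2 }, (N a.1.1).X a.1.2

/-- The horizontal part of the differential of the total complex. -/
def totH (m m' : ℤ) (h : m + 1 = m') (x : totX N m) :
    ∀ (n : ℕ) (q : ℤ), m' + -(n : ℤ) = q → (N n).X q
  | 0, _, _ => 0
  | n + 1, q, hq => ((D n).v q q (add_zero q)).hom (x ⟨(n, q), by push_cast at hq ⊢; omega⟩)

/-- The differential of the total complex. The signs are those for which the projections satisfy
the equations of `IsTot`. -/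
def totD (m m' : ℤ) (h : m + 1 = m') : totX N m →ₗ[k] totX N m' where
  toFun x a := (a.1.1 : ℤ).negOnePow • (((N a.1.1).d (a.1.2 - 1) a.1.2).hom
    (x ⟨(a.1.1, a.1.2 - 1), by have := a.2; dsimp only; omega⟩) - totH N D m m' h x a.1.1 a.1.2 a.2)
  map_add' x y := by
    refine funext fun ⟨(n, q), ha⟩ => ?_
    cases n with
    | zero => simp [totH]
    | succ n =>
      simp only [totH, Pi.add_apply, map_add]
      rw [← smul_add]
      congr 1
      abel
  map_smul' r x := by
    refine funext fun ⟨(n, q), ha⟩ => ?_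
    cases n with
    | zero => simp [totH]
    | succ n =>
      simp only [totH, Pi.smul_apply, map_smul, RingHom.id_apply]
      rw [← smul_sub, smul_comm]

lemma totD_zero {m m' q q' : ℤ} (h : m + 1 = m') (hq : m + -((0 : ℕ) : ℤ) = q)
    (hq' : m' + -((0 : ℕ) : ℤ) = q') (x : totX N m) :
    totD N D m m' h x ⟨(0, q'), hq'⟩ = ((N 0).d q q').hom (x ⟨(0, q), hq⟩) := by
  obtain rfl : q = q' - 1 := by omega
  simp [totD, totH]

lemma totD_succ {m m' q q' : ℤ} (n : ℕ) (h : m + 1 = m') (hq : m + -((n + 1 : ℕ) : ℤ) = q)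
    (hq' : m' + -((n + 1 : ℕ) : ℤ) = q') (hn : m + -(n : ℤ) = q') (x : totX N m) :
    totD N D m m' h x ⟨(n + 1, q'), hq'⟩ = ((n + 1 : ℕ) : ℤ).negOnePow •
      (((N (n + 1)).d q q').hom (x ⟨(n + 1, q), hq⟩) -
        ((D n).v q' q' (add_zero q')).hom (x ⟨(n, q'), hn⟩)) := by
  obtain rfl : q = q' - 1 := by omega
  rfl

variable (hD : ∀ n, δ 0 1 (D n) = 0)
  (hDD : ∀ n, (D n).comp (D (n + 1)) (add_zero 0) = 0)

include hD in
lemma D_comm (n : ℕ) {q q' : ℤ} (h : q + 1 = q') (x : (N n).X q) :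
    ((N (n + 1)).d q q').hom (((D n).v q q (add_zero q)).hom x) =
      ((D n).v q' q' (add_zero q')).hom (((N n).d q q').hom x) := by
  have e := congrArg (fun z : Cochain (N n) (N (n + 1)) 1 => (z.v q q' h).hom x) (hD n)
  rw [δ_v_apply (zero_add 1) _ q q' q' q h h (add_zero q), Int.negOnePow_one, Units.neg_smul,
    one_smul] at e
  exact add_neg_eq_zero.1 e

include hDD in
lemma D_comp (n : ℕ) (q : ℤ) (x : (N n).X q) :
    ((D (n + 1)).v q q (add_zero q)).hom (((D n).v q q (add_zero q)).hom x) = 0 := by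
  have e := congrArg (fun z : Cochain (N n) (N (n + 1 + 1)) 0 => (z.v q q (add_zero q)).hom x)
    (hDD n)
  rw [comp_v_apply _ _ _ q q q (add_zero q) (add_zero q)] at e
  exact e

lemma d_d_apply (K : CochainComplex (ModuleCat.{u} k) ℤ) (a b c : ℤ) (x : K.X a) :
    (K.d b c).hom ((K.d a b).hom x) = 0 :=
  LinearMap.congr_fun (congrArg ModuleCat.Hom.hom (K.d_comp_d a b c)) x

include hD hDD in
lemma totD_totD (m m' m'' : ℤ) (h : m + 1 = m') (h' : m' + 1 = m'') (x : totX N m) :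
    totD N D m' m'' h' (totD N D m m' h x) = 0 := by
  refine funext fun ⟨(n, q), ha⟩ => ?_
  change totD N D m' m'' h' (totD N D m m' h x) ⟨(n, q), ha⟩ = 0
  have ha' : m'' + -(n : ℤ) = q := ha
  match n, ha' with
  | 0, ha' =>
    rw [totD_zero N D (q := q - 1) h' (by omega), totD_zero N D (q := q - 1 - 1) h (by omega),
      d_d_apply]
  | 1, ha' =>
    rw [totD_succ N D (q := q - 1) 0 h' (by omega) _ (by omega),
      totD_succ N D (q := q - 1 - 1) 0 h (by omega) _ (by omega),
      totD_zero N D (q := q - 1) h (by omega)]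
    simp only [Units.smul_def, map_zsmul, map_sub]
    simp only [← Units.smul_def]
    rw [d_d_apply, D_comm N D hD 0 (by omega), zero_sub, smul_neg,
      show ((0 + 1 : ℕ) : ℤ).negOnePow = -1 from Int.negOnePow_one, Units.neg_smul, one_smul,
      Units.neg_smul, one_smul, neg_neg, sub_self, neg_zero]
  | n + 2, ha' =>
    rw [totD_succ N D (q := q - 1) (n + 1) h' (by omega) _ (by omega),
      totD_succ N D (q := q - 1 - 1) (n + 1) h (by omega) _ (by omega),
      totD_succ N D (q := q - 1) n h (by omega) _ (by omega)]
    simp only [Units.smul_def, map_zsmul, map_sub]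
    simp only [← Units.smul_def]
    rw [d_d_apply, D_comm N D hD (n + 1) (by omega), D_comp N D hDD, sub_zero,
      zero_sub, show ((n + 1 + 1 : ℕ) : ℤ).negOnePow = -((n + 1 : ℕ) : ℤ).negOnePow by
        rw [← Int.negOnePow_succ]; push_cast; rfl, Units.neg_smul, Units.neg_smul, smul_neg,
      neg_neg, sub_self,
      smul_zero, neg_zero]

/-- The total complex (with products) of a complex of complexes. -/
def tot : CochainComplex (ModuleCat.{u} k) ℤ where
  X m := ModuleCat.of k (totX N m)
  d m m' := ModuleCat.ofHom (if h : m + 1 = m' then totD N D m m' h else 0)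
  shape m m' h := by
    rw [dif_neg (by simpa using h)]
    rfl
  d_comp_d' := by
    rintro m _ _ rfl rfl
    refine ModuleCat.hom_ext (LinearMap.ext fun (x : totX N m) => ?_)
    simp only [dif_pos]
    exact totD_totD N D hD hDD _ _ _ _ _ x

/-- The projections of the total complex. -/
def totπ (n : ℕ) : Cochain (tot N D hD hDD) (N n) (-n) :=
  Cochain.mk fun _ q h => ModuleCat.ofHom (LinearMap.proj (⟨(n, q), h⟩ :
    { a : ℕ × ℤ // _ + -(a.1 : ℤ) = a.2 }))

lemma tot_d (m : ℤ) (x : totX N m) :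
    ((tot N D hD hDD).d m (m + 1)).hom x = totD N D m (m + 1) rfl x := by
  simp only [tot, dif_pos]
  rfl

lemma totπ_v {n : ℕ} {m q : ℤ} (h : m + -(n : ℤ) = q) (x : totX N m) :
    ((totπ N D hD hDD n).v m q h).hom x = x ⟨(n, q), h⟩ := rfl

lemma δ_totπ_zero : δ (-((0 : ℕ) : ℤ)) (-((0 : ℕ) : ℤ) + 1) (totπ N D hD hDD 0) = 0 := by
  refine cochain_ext fun i j hij x => ?_
  have hj : i + 1 = j := by simpa using hij
  let x' : totX N i := x
  rw [δ_v_apply rfl _ i j (i + 1) i hij rfl (by simp)]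
  change ((N 0).d i j).hom (((totπ N D hD hDD 0).v i i _).hom x') + (-((0 : ℕ) : ℤ) + 1).negOnePow •
    ((totπ N D hD hDD 0).v (i + 1) j _).hom (((tot N D hD hDD).d i (i + 1)).hom x') = 0
  rw [tot_d, totπ_v, totπ_v, totD_zero N D (q := i) rfl (by simp),
    show (-((0 : ℕ) : ℤ) + 1).negOnePow = -1 from Int.negOnePow_one, Units.neg_smul, one_smul,
    add_neg_cancel]

lemma δ_totπ_succ (n : ℕ) : δ (-((n + 1 : ℕ) : ℤ)) (-(n : ℤ)) (totπ N D hD hDD (n + 1)) =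
    (totπ N D hD hDD n).comp (D n) (add_zero _) := by
  refine cochain_ext fun i j hij x => ?_
  let x' : totX N i := x
  rw [δ_v_apply (by push_cast; omega) _ i j (i + 1) (j - 1) hij rfl (by push_cast; omega),
    comp_v_apply _ _ _ i j j hij (add_zero j)]
  change ((N (n + 1)).d (j - 1) j).hom (((totπ N D hD hDD (n + 1)).v i (j - 1) _).hom x') +
    (-(n : ℤ)).negOnePow • ((totπ N D hD hDD (n + 1)).v (i + 1) j _).hom
      (((tot N D hD hDD).d i (i + 1)).hom x') =
    ((D n).v j j _).hom (((totπ N D hD hDD n).v i j hij).hom x')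
  rw [tot_d, totπ_v, totπ_v, totπ_v, totD_succ N D (q := j - 1) n rfl (by push_cast; omega) _
    (by omega), smul_smul, ← Int.negOnePow_add, show (-(n : ℤ) + ((n + 1 : ℕ) : ℤ)).negOnePow = -1 by
      rw [show (-(n : ℤ) + ((n + 1 : ℕ) : ℤ)) = 1 by push_cast; omega, Int.negOnePow_one],
    Units.neg_smul, one_smul, neg_sub, add_sub_cancel]

variable {N D hD hDD}

lemma tot_ext {Z : CochainComplex (ModuleCat.{u} k) ℤ} {m : ℤ}
    {φ φ' : Cochain Z (tot N D hD hDD) m} (h : ∀ (n : ℕ) (q : ℤ) (h : m + -(n : ℤ) = q),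
      φ.comp (totπ N D hD hDD n) h = φ'.comp (totπ N D hD hDD n) h) : φ = φ' := by
  refine cochain_ext fun i j hij x => funext fun ⟨(n, q), ha⟩ => ?_
  have ha : j + -(n : ℤ) = q := ha
  have e := congrArg (fun z : Cochain Z (N n) (m + -(n : ℤ)) => (z.v i q (by omega)).hom x)
    (h n (m + -(n : ℤ)) rfl)
  rw [comp_v_apply _ _ rfl i j q hij ha, comp_v_apply _ _ rfl i j q hij ha] at e
  exact e

lemma tot_lift {Z : CochainComplex (ModuleCat.{u} k) ℤ} {m : ℤ}
    (θ : ∀ (n : ℕ) (q : ℤ), m + -(n : ℤ) = q → Cochain Z (N n) q) :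
    ∃ φ : Cochain Z (tot N D hD hDD) m, ∀ (n : ℕ) (q : ℤ) (h : m + -(n : ℤ) = q),
      φ.comp (totπ N D hD hDD n) h = θ n q h := by
  let φ : Cochain Z (tot N D hD hDD) m := Cochain.mk fun i j hij => ModuleCat.ofHom
    (show Z.X i →ₗ[k] totX N j from LinearMap.pi fun a =>
      ((θ a.1.1 (m + -(a.1.1 : ℤ)) rfl).v i a.1.2 (by have := a.2; omega)).hom)
  refine ⟨φ, fun n q h => cochain_ext fun i j hij x => ?_⟩
  subst h
  rw [comp_v_apply _ _ rfl i (i + m) j rfl (by omega)]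
  rfl

end Tot

lemma hasTot_Cdg : HasTot (Cdg k (ModuleCat.{u} k)) := by
  intro N D hD hDD
  have h₀ := δ_totπ_zero N D hD hDD
  have h₁ := δ_totπ_succ N D hD hDD
  refine ⟨tot N D hD hDD, totπ N D hD hDD, fun m => ?_, fun n m h => ?_, tot_ext, tot_lift⟩
  · by_cases hm : -((0 : ℕ) : ℤ) + 1 = m
    · subst hm
      exact h₀
    · exact δ_shape _ _ hm _
  · obtain rfl : -(n : ℤ) = m := by omega
    exact h₁ n

end DGCat

/-! ### Quasi-isomorphisms of complexes of vector spaces -/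

namespace Cplx

variable {k : Type u} [Field k]

/-- A complex of modules, elementwise. -/
abbrev ofComplex (K : CochainComplex (ModuleCat.{v} k) ℤ) : Cplx.{u, v} k where
  X n := K.X n
  d n m := (K.d n m).hom
  d_d n m l x _ _ := LinearMap.congr_fun (congrArg ModuleCat.Hom.hom (K.d_comp_d n m l)) x

/-- A morphism of complexes of modules, elementwise. -/
abbrev Hom.ofHom {K L : CochainComplex (ModuleCat.{v} k) ℤ} (f : K ⟶ L) :
    (ofComplex K).Hom (ofComplex L) where
  f n := (f.f n).hom
  comm n m _ x := LinearMap.congr_fun (congrArg ModuleCat.Hom.hom (f.comm n m)).symm x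

/-- Quasi-isomorphisms of complexes of modules are quasi-isomorphisms in the elementwise sense. -/
lemma Hom.isQuasiIso_ofHom {K L : CochainComplex (ModuleCat.{u} k) ℤ} (f : K ⟶ L) [QuasiIso f] :
    (Hom.ofHom f).IsQuasiIso := by
  rintro l _ _ _ rfl rfl rfl b x hb hx
  -- injectivity on cohomology, then surjectivity
  have h₁ := (HomologicalComplex.mono_homologyMap_iff_up_to_refinements f (l + 1) (l + 1 + 1)
    (l + 1 + 1 + 1) (by simp) (by simp)).1 inferInstance (A := ModuleCat.of k k)
    (ModuleCat.ofHom (LinearMap.toSpanSingleton k _ b)) (by ext; simpa using hb)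
    (ModuleCat.ofHom (LinearMap.toSpanSingleton k _ x)) (by ext; simpa using hx.symm)
  obtain ⟨P, π, hπ, y, hy⟩ := h₁
  obtain ⟨a, ha⟩ := (ModuleCat.epi_iff_surjective π).1 hπ (1 : k)
  have hc : (1 : k) • b = (K.d (l + 1) (l + 1 + 1)).hom (y.hom a) := by
    rw [← ha]
    exact congrArg (fun t => t.hom a) hy
  rw [one_smul] at hc
  have h₂ := (HomologicalComplex.epi_homologyMap_iff_up_to_refinements f l (l + 1) (l + 1 + 1)
    (by simp) (by simp)).1 inferInstance (A := ModuleCat.of k k)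
    (ModuleCat.ofHom (LinearMap.toSpanSingleton k _ (x - (f.f _).hom (y.hom a)))) (by
      ext
      have e := (Hom.ofHom f).comm _ _ rfl (y.hom a)
      have e' : (L.d (l + 1) (l + 1 + 1)).hom (x - (f.f _).hom (y.hom a)) = 0 := by
        rw [map_sub, sub_eq_zero]
        exact hx.trans ((congrArg (f.f _).hom hc).trans e)
      simpa using e')
  obtain ⟨P', π', hπ', z, hz, w, hw⟩ := h₂
  obtain ⟨a', ha'⟩ := (ModuleCat.epi_iff_surjective π').1 hπ' (1 : k)
  have e : (1 : k) • (x - (f.f _).hom (y.hom a)) =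
      (f.f _).hom (z.hom a') + (L.d l (l + 1)).hom (w.hom a') := by
    rw [← ha']
    exact congrArg (fun t => t.hom a') hw
  have ez : (K.d (l + 1) (l + 1 + 1)).hom (z.hom a') = 0 := congrArg (fun t => t.hom a') hz
  refine ⟨y.hom a + z.hom a', w.hom a', ?_, ?_⟩
  · change (K.d _ _).hom _ = _
    rw [map_add, ez, add_zero, ← hc]
  · change (f.f _).hom _ + (L.d _ _).hom _ = x
    rw [map_add, add_assoc, ← e, one_smul, add_sub_cancel]

open CochainComplex in
lemma acyclic_mappingCone {K L : CochainComplex (ModuleCat.{u} k) ℤ} (f : K ⟶ L) [QuasiIso f] :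
    (ofComplex (mappingCone f)).Acyclic := by
  rintro l _ _ rfl rfl z hz
  let b := ((mappingCone.fst f).1.v (l + 1) (l + 1 + 1) rfl).hom z
  let x := ((mappingCone.snd f).v (l + 1) (l + 1) (add_zero _)).hom z
  have hz' : ((mappingCone f).d (l + 1) (l + 1 + 1)).hom z = 0 := hz
  have h₁ := congrArg (fun t => t.hom z)
    (mappingCone.d_fst_v f (l + 1) (l + 1 + 1) (l + 1 + 1 + 1) rfl rfl)
  have h₂ := congrArg (fun t => t.hom z) (mappingCone.d_snd_v f (l + 1) (l + 1 + 1) rfl)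
  have e₁ : (K.d (l + 1 + 1) (l + 1 + 1 + 1)).hom b = 0 :=
    neg_eq_zero.1 (h₁.symm.trans ((congrArg
      ((mappingCone.fst f).1.v (l + 1 + 1) (l + 1 + 1 + 1) rfl).hom hz').trans (map_zero _)))
  have e₂ : (f.f (l + 1 + 1)).hom b + (L.d (l + 1) (l + 1 + 1)).hom x = 0 :=
    h₂.symm.trans ((congrArg
      ((mappingCone.snd f).v (l + 1 + 1) (l + 1 + 1) (add_zero _)).hom hz').trans (map_zero _))
  obtain ⟨c, y, hc, hy⟩ := Hom.isQuasiIso_ofHom f l _ _ _ rfl rfl rfl (-b) x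
    (by rw [map_neg]; exact neg_eq_zero.2 e₁)
    (by rw [map_neg]; exact eq_neg_of_add_eq_zero_right e₂)
  let w := ((mappingCone.inl f).v (l + 1) l (by omega)).hom c + ((mappingCone.inr f).f l).hom y
  refine ⟨w, ?_⟩
  have h₃ := congrArg (fun t => t.hom c) (mappingCone.inl_v_d f (l + 1) l (l + 1 + 1)
    (by omega) (by omega))
  have h₄ := congrArg (fun t => t.hom y) (mappingCone.inr_f_d f l (l + 1))
  have h₅ := congrArg (fun t => t.hom z) (mappingCone.id_X f (l + 1) (l + 1 + 1) rfl)
  have e₃ : ((mappingCone f).d l (l + 1)).hom (((mappingCone.inl f).v (l + 1) l (by omega)).hom c) =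
    ((mappingCone.inr f).f (l + 1)).hom ((f.f (l + 1)).hom c) -
      ((mappingCone.inl f).v (l + 1 + 1) (l + 1) (by omega)).hom
        ((K.d (l + 1) (l + 1 + 1)).hom c) := h₃
  have e₄ : ((mappingCone f).d l (l + 1)).hom (((mappingCone.inr f).f l).hom y) =
    ((mappingCone.inr f).f (l + 1)).hom ((L.d l (l + 1)).hom y) := h₄
  have e₅ : ((mappingCone.inl f).v (l + 1 + 1) (l + 1) (by omega)).hom b +
    ((mappingCone.inr f).f (l + 1)).hom x = z := h₅
  change ((mappingCone f).d l (l + 1)).hom w = z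
  have hc' : (K.d (l + 1) (l + 1 + 1)).hom c = -b := hc
  have hy' : (f.f (l + 1)).hom c + (L.d l (l + 1)).hom y = x := hy
  rw [map_add, e₃, e₄, hc', map_neg, ← e₅, ← hy', map_add]
  abel

end Cplx

namespace DGCat

open CochainComplex CochainComplex.HomComplex

variable {k : Type u} [Field k]

/-- An acyclic complex of vector spaces is contractible. -/
lemma exists_contraction_of_acyclic {K : CochainComplex (ModuleCat.{u} k) ℤ}
    (hK : (Cplx.ofComplex K).Acyclic) :
    ∃ h : Cochain K K (-1), δ (-1) 0 h = Cochain.ofHom (𝟙 K) := by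
  obtain ⟨s, hs⟩ := hK.exists_contraction
  refine ⟨Cochain.mk fun i j _ => ModuleCat.ofHom (s i j), cochain_ext fun i j hij x => ?_⟩
  obtain rfl : i = j := by omega
  rw [δ_v_apply (by norm_num) _ i i (i + 1) (i - 1) hij rfl (by omega), Int.negOnePow_zero, one_smul,
    Cochain.ofHom_v]
  exact hs (i - 1) i (i + 1) (by omega) rfl x

/-- Every complex `N` of vector spaces is h-injective: a quasi-isomorphism `f` has a contractible
mapping cone, hence it induces a quasi-isomorphism on morphisms to `N`. -/
lemma isQuasiIso_precompHom_ofHom {K L : CochainComplex (ModuleCat.{u} k) ℤ} (f : K ⟶ L)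
    [QuasiIso f] (N : CochainComplex (ModuleCat.{u} k) ℤ) :
    ((Cdg k (ModuleCat.{u} k)).precompHom (X := K) (X' := L) (Cochain.ofHom f)
      (δ_ofHom f) N).IsQuasiIso := by
  obtain ⟨h, hh⟩ := exists_contraction_of_acyclic (Cplx.acyclic_mappingCone f)
  have hN := acyclic_of_contraction (Cdg k (ModuleCat.{u} k)) (Z := mappingCone f) h hh N
  intro l n m m' hl hn hm (b : Cochain L N m) (x : Cochain K N n) hb hx
  have hb' : δ m m' b = 0 := hb
  have hx' : δ n m x = (Cochain.ofHom f).comp b (zero_add m) := hx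
  let z := mappingCone.descCochain f (m.negOnePow • x) b hn
  have hz : δ m m' z = 0 := by
    rw [mappingCone.δ_descCochain f _ b hn m' hm, hb', δ_units_smul, hx',
      show m'.negOnePow = -m.negOnePow by rw [← hm, Int.negOnePow_succ],
      Units.neg_smul, add_neg_cancel, Cochain.comp_zero, Cochain.comp_zero,
      add_zero]
  obtain ⟨y, hy⟩ : ∃ y : Cochain (mappingCone f) N n, δ n m y = z := hN n m m' hn hm z hz
  have e₁ : δ n m ((Cochain.ofHom (mappingCone.inr f)).comp y (zero_add n)) = b := by
    rw [δ_zero_cochain_comp _ _ _ hn, δ_ofHom, hy, Cochain.zero_comp, smul_zero, add_zero,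
      mappingCone.inr_descCochain]
  have e₂ : (Cochain.ofHom f).comp
      ((Cochain.ofHom (mappingCone.inr f)).comp y (zero_add n)) (zero_add n) +
      δ l n (m.negOnePow • (mappingCone.inl f).comp y (by omega : -1 + n = l)) = x := by
    rw [δ_units_smul, δ_comp _ _ (by omega : -1 + n = l) 0 m n hl (by norm_num) hn,
      mappingCone.δ_inl, hy, mappingCone.inl_descCochain, smul_add, smul_smul, smul_smul,
      ← Int.negOnePow_add, ← Int.negOnePow_add, Int.negOnePow_even _ ⟨m, rfl⟩, one_smul,
      show (m + n).negOnePow = -1 from (Int.negOnePow_congr n (by omega)).trans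
        Int.negOnePow_one, Units.neg_smul, one_smul, Cochain.ofHom_comp,
      Cochain.comp_assoc_of_first_is_zero_cochain]
    abel
  exact ⟨_, _, e₁, e₂⟩

lemma isQuasiIso_precompHom_of_quasiIso {K L : CochainComplex (ModuleCat.{u} k) ℤ}
    (a : Cochain K L 0) (ha : δ 0 1 a = 0)
    (h : QuasiIso (Cocycle.homOf (Cocycle.mk a 1 (zero_add 1) ha)))
    (N : CochainComplex (ModuleCat.{u} k) ℤ) :
    ((Cdg k (ModuleCat.{u} k)).precompHom (X := K) (X' := L) a ha N).IsQuasiIso := by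
  have e : Cochain.ofHom (Cocycle.homOf (Cocycle.mk a 1 (zero_add 1) ha)) = a :=
    Cocycle.cochain_ofHom_homOf_eq_coe _
  generalize Cocycle.homOf (Cocycle.mk a 1 (zero_add 1) ha) = f at h e
  subst e
  exact isQuasiIso_precompHom_ofHom f N

end DGCat

namespace DGCat

open CochainComplex CochainComplex.HomComplex

variable {k : Type u} [Field k]

/-! ### Resolutions of dg-modules and of dg-bimodules -/

/-- A homotopy equivalence, given by cochains, is a quasi-isomorphism. -/
lemma quasiIso_of_contraction {K L : CochainComplex (ModuleCat.{u} k) ℤ} (f : Cochain K L 0)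
    (hf : δ 0 1 f = 0) (ρ : Cochain L K 0) (hρ : δ 0 1 ρ = 0) (h : Cochain L L (-1))
    (h₁ : f.comp ρ (add_zero 0) = Cochain.ofHom (𝟙 K))
    (h₂ : δ (-1) 0 h = Cochain.ofHom (𝟙 L) - ρ.comp f (add_zero 0)) :
    QuasiIso (Cocycle.homOf (Cocycle.mk f 1 (zero_add 1) hf)) := by
  have e₁ : Cochain.ofHom (Cocycle.homOf (Cocycle.mk f 1 (zero_add 1) hf)) = f :=
    Cocycle.cochain_ofHom_homOf_eq_coe _
  have e₂ : Cochain.ofHom (Cocycle.homOf (Cocycle.mk ρ 1 (zero_add 1) hρ)) = ρ :=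
    Cocycle.cochain_ofHom_homOf_eq_coe _
  generalize Cocycle.homOf (Cocycle.mk f 1 (zero_add 1) hf) = f' at e₁ ⊢
  generalize Cocycle.homOf (Cocycle.mk ρ 1 (zero_add 1) hρ) = ρ' at e₂
  subst e₁ e₂
  rw [← Cochain.ofHom_comp] at h₁ h₂
  let e : HomotopyEquiv K L :=
    { hom := f'
      inv := ρ'
      homotopyHomInvId := Homotopy.ofEq (Cochain.ofHom_injective h₁)
      homotopyInvHomId := (Cochain.equivHomotopy _ _).symm ⟨-h, by rw [δ_neg, h₂]; abel⟩ }
  exact e.quasiIso_hom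

lemma IsQis.comp {B : DGCat.{u, u, u} k} {M N P : B.dgMod.Z0} {φ : M ⟶ N} {ψ : N ⟶ P}
    (hφ : IsQis φ) (hψ : IsQis ψ) : IsQis (φ ≫ ψ) := by
  intro b
  have := hφ b
  have := hψ b
  have e : evalHom (φ ≫ ψ) b = evalHom φ b ≫ evalHom ψ b := by
    apply Cochain.ofHom_injective
    rw [Cochain.ofHom_comp]
    simp only [evalHom, Cocycle.cochain_ofHom_homOf_eq_coe]
    rfl
  rw [e]
  infer_instance

section modules

variable (B : DGCat.{u, u, u} k)

/-- The functorial resolution of right dg-modules by h-injective ones: the cobar resolution of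
dg-functors from `B.op` to complexes of vector spaces. -/
noncomputable def modRes : DGFunctor B.dgMod B.dgMod := cobar (hasWProd_Cdg B.op) hasTot_Cdg

/-- The quasi-isomorphism `M → modRes M`. -/
noncomputable def modι : (DGFunctor.id B.dgMod).natTrans (modRes B) 0 :=
  cobarι (hasWProd_Cdg B.op) hasTot_Cdg

variable {B}

lemma d_modι (M : B.dgMod.Obj) : B.dgMod.d 0 1 ((modι B).1 M) = 0 := d_cobarι _ _ M

lemma isQis_modι (M : B.dgMod.Obj) :
    IsQis (M := ⟨M⟩) (N := ⟨(modRes B).obj M⟩) ⟨(modι B).1 M, d_modι M⟩ := by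
  intro b
  obtain ⟨ρ, h, hρ, h₁, h₂⟩ := exists_cobarObj_contraction (hasWProd_Cdg B.op) hasTot_Cdg M b
  exact quasiIso_of_contraction _ _ ρ hρ h h₁ h₂

/-- The values of `modRes` are h-injective. -/
lemma isQuasiIso_precompHom_modRes {M M' : B.dgMod.Obj} (φ : B.dgMod.Hom M M' 0)
    (hφ : B.dgMod.d 0 1 φ = 0) (h : IsQis (M := ⟨M⟩) (N := ⟨M'⟩) ⟨φ, hφ⟩) (N : B.dgMod.Obj) :
    (B.dgMod.precompHom φ hφ ((modRes B).obj N)).IsQuasiIso :=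
  isQuasiIso_precompHom_cobarObj (hasWProd_Cdg B.op) hasTot_Cdg φ
    (fun b => congrFun (congrArg Subtype.val hφ) b)
    fun b b' => isQuasiIso_precompHom_of_quasiIso _ _ (h b) (eval N b')

end modules

section bimodules

variable {A B : DGCat.{u, u, u} k}

lemma hasWProd_dgMod (A B : DGCat.{u, u, u} k) : HasWProd A B.dgMod := (hasWProd_Cdg A).dgFun

lemma hasTot_dgMod (B : DGCat.{u, u, u} k) : HasTot B.dgMod := hasTot_Cdg.dgFun

/-- The h-injective resolution of a bimodule `G : A → dgm(B)`: the cobar resolution over `A` of the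
objectwise resolution `a ↦ modRes (G a)`. -/
noncomputable def bimodRes (G : DGFunctor A B.dgMod) : DGFunctor A B.dgMod :=
  cobarObj (hasWProd_dgMod A B) (hasTot_dgMod B) (G.comp (modRes B))

lemma _root_.DGBimod.IsQis.comp {F G H : (DGBimod A B).Z0} {φ : F ⟶ G} {ψ : G ⟶ H}
    (hφ : DGBimod.IsQis φ) (hψ : DGBimod.IsQis ψ) : DGBimod.IsQis (φ ≫ ψ) :=
  fun a => by
    have e : DGBimod.evalHom (φ ≫ ψ) a = DGBimod.evalHom φ a ≫ DGBimod.evalHom ψ a := rfl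
    rw [e]
    exact DGCat.IsQis.comp (hφ a) (hψ a)

/-- The morphism `G → G.comp (modRes B)`. -/
noncomputable def compModι (G : DGFunctor A B.dgMod) :
    (⟨G⟩ : (DGBimod A B).Z0) ⟶ ⟨G.comp (modRes B)⟩ :=
  ⟨G.restrictNatTrans (DGFunctor.id _) (modRes B) 0 (modι B),
    Subtype.ext (funext fun a => d_modι (G.obj a))⟩

lemma isQis_compModι (G : DGFunctor A B.dgMod) : DGBimod.IsQis (compModι G) :=
  fun a => isQis_modι (G.obj a)

/-- The morphism `G.comp (modRes B) → bimodRes G`. -/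
noncomputable def compModResι (G : DGFunctor A B.dgMod) :
    (⟨G.comp (modRes B)⟩ : (DGBimod A B).Z0) ⟶ ⟨bimodRes G⟩ :=
  ⟨cobarObjι (hasWProd_dgMod A B) (hasTot_dgMod B) (G.comp (modRes B)),
    Subtype.ext (funext fun a => d_cobarObjι _ _ _ a)⟩

lemma isQis_compModResι (G : DGFunctor A B.dgMod) : DGBimod.IsQis (compModResι G) := by
  intro a b
  obtain ⟨ρ, h, hρ, h₁, h₂⟩ := exists_cobarObj_contraction (hasWProd_dgMod A B) (hasTot_dgMod B)
    (G.comp (modRes B)) a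
  exact quasiIso_of_contraction _ _ (ρ.1 b) (congrFun (congrArg Subtype.val hρ) b) (h.1 b)
    (congrFun (congrArg Subtype.val h₁) b) (congrFun (congrArg Subtype.val h₂) b)

/-- The morphism `G → bimodRes G`. -/
noncomputable def bimodι (G : DGFunctor A B.dgMod) :
    (⟨G⟩ : (DGBimod A B).Z0) ⟶ ⟨bimodRes G⟩ :=
  compModι G ≫ compModResι G

lemma isQis_bimodι (G : DGFunctor A B.dgMod) : DGBimod.IsQis (bimodι G) :=
  (isQis_compModι G).comp (isQis_compModResι G)

/-- The values of `bimodRes` are h-injective. -/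
lemma isQuasiIso_precompHom_bimodRes {F F' : (DGBimod A B).Z0} (φ : F ⟶ F')
    (hφ : DGBimod.IsQis φ) (G : DGFunctor A B.dgMod) :
    ((DGBimod A B).precompHom φ.1 φ.2 (bimodRes G)).IsQuasiIso :=
  isQuasiIso_precompHom_cobarObj (hasWProd_dgMod A B) (hasTot_dgMod B) φ.1
    (fun a => congrFun (congrArg Subtype.val φ.2) a)
    fun a a' => isQuasiIso_precompHom_modRes _ _ (hφ a) (G.obj a')

end bimodules

end DGCat

/-! ### Sequential limits of complexes -/

namespace Cplx

variable {k : Type w} [Field k]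

/-- The limit of a tower of complexes. -/
abbrev lim (K : ℕ → Cplx.{w, v} k) (t : ∀ n, (K (n + 1)).Hom (K n)) : Cplx.{w, v} k where
  X m := ({ carrier := { x | ∀ n, (t n).f m (x (n + 1)) = x n }
            add_mem' := fun hx hy n => by simp only [Pi.add_apply, map_add, hx n, hy n]
            zero_mem' := fun n => by simp
            smul_mem' := fun r x hx n => by simp only [Pi.smul_apply, map_smul, hx n] } :
      Submodule k (∀ n, (K n).X m))
  d m m' :=
    { toFun x := ⟨fun n => if m + 1 = m' then (K n).d m m' (x.1 n) else 0, fun n => by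
        split_ifs with h
        · rw [(t n).comm _ _ h, x.2 n]
        · exact map_zero _⟩
      map_add' x y := Subtype.ext (funext fun n => by
        dsimp only [Submodule.coe_add, Pi.add_apply]
        split_ifs <;> simp)
      map_smul' r x := Subtype.ext (funext fun n => by
        dsimp only [Submodule.coe_smul, Pi.smul_apply]
        split_ifs <;> simp) }
  d_d a b c x h₁ h₂ := Subtype.ext (funext fun n => by
    simp only [LinearMap.coe_mk, AddHom.coe_mk, if_pos h₁, if_pos h₂, (K n).d_d _ _ _ _ h₁ h₂]
    rfl)

/-- The inclusion of the limit of a tower in the product. -/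
def limι (K : ℕ → Cplx.{w, v} k) (t : ∀ n, (K (n + 1)).Hom (K n)) : (lim K t).Hom (Cplx.pi K) where
  f _ := Submodule.subtype _
  comm _ _ h _ := funext fun _ => if_pos h

/-- The difference of the identity and the shift on the product of a tower. -/
def limδ (K : ℕ → Cplx.{w, v} k) (t : ∀ n, (K (n + 1)).Hom (K n)) :
    (Cplx.pi K).Hom (Cplx.pi K) where
  f m :=
    { toFun x n := x n - (t n).f m (x (n + 1))
      map_add' x y := funext fun n => by
        change x n + y n - (t n).f m (x (n + 1) + y (n + 1)) =
          x n - (t n).f m (x (n + 1)) + (y n - (t n).f m (y (n + 1)))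
        rw [map_add]
        abel
      map_smul' r x := funext fun n => by
        change r • x n - (t n).f m (r • x (n + 1)) = r • (x n - (t n).f m (x (n + 1)))
        rw [map_smul, smul_sub] }
  comm m m' h x := funext fun n => by
    have e := (t n).comm m m' h (x (n + 1))
    change (K n).d m m' (x n) - (t n).f m' ((K (n + 1)).d m m' (x (n + 1))) =
      (K n).d m m' (x n - (t n).f m (x (n + 1)))
    rw [e, map_sub]

/-- For a tower with surjective transition maps `lim¹` vanishes. -/
lemma limδ_surjective {K : ℕ → Cplx.{w, v} k} {t : ∀ n, (K (n + 1)).Hom (K n)}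
    (ht : ∀ n m, Function.Surjective ((t n).f m)) (m : ℤ) :
    Function.Surjective ((limδ K t).f m) := by
  intro y
  choose s hs using ht
  let x : ∀ n, (K n).X m := fun n => Nat.rec 0 (fun n x => s n m (x - y n)) n
  refine ⟨x, funext fun n => ?_⟩
  change x n - (t n).f m (s n m (x n - y n)) = y n
  rw [hs, sub_sub_cancel]

/-- The kernel of `limδ` is the limit. -/
lemma exists_of_limδ_eq_zero {K : ℕ → Cplx.{w, v} k} {t : ∀ n, (K (n + 1)).Hom (K n)} (m : ℤ)
    (x : (Cplx.pi K).X m) (hx : (limδ K t).f m x = 0) : ∃ y, (limι K t).f m y = x :=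
  ⟨⟨x, fun n => (sub_eq_zero.1 (congrFun hx n)).symm⟩, rfl⟩

lemma limδ_limι {K : ℕ → Cplx.{w, v} k} {t : ∀ n, (K (n + 1)).Hom (K n)} (m : ℤ)
    (x : (lim K t).X m) : (limδ K t).f m ((limι K t).f m x) = 0 :=
  funext fun n => sub_eq_zero.2 (x.2 n).symm

/-- The map on limits induced by a map of towers. -/
def Hom.lim {K : ℕ → Cplx.{w, v₁} k} {t : ∀ n, (K (n + 1)).Hom (K n)}
    {L : ℕ → Cplx.{w, v₂} k} {s : ∀ n, (L (n + 1)).Hom (L n)} (u : ∀ n, (K n).Hom (L n))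
    (h : ∀ n m x, (s n).f m ((u (n + 1)).f m x) = (u n).f m ((t n).f m x)) :
    (Cplx.lim K t).Hom (Cplx.lim L s) where
  f m := (LinearMap.pi fun n => (u n).f m ∘ₗ LinearMap.proj n).restrict fun x hx n => by
    change (s n).f m ((u (n + 1)).f m (x (n + 1))) = (u n).f m (x n)
    rw [h, hx n]
  comm m m' hm x := Subtype.ext (funext fun n => by
    change (u n).f m' (if m + 1 = m' then (K n).d m m' (x.1 n) else 0) =
      if m + 1 = m' then (L n).d m m' ((u n).f m (x.1 n)) else 0
    rw [if_pos hm, if_pos hm, (u n).comm _ _ hm])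

/-- Limits of towers with surjective transition maps preserve quasi-isomorphisms, by the short exact
sequence `0 → lim → ∏ → ∏ → 0`. -/
lemma Hom.IsQuasiIso.lim {K : ℕ → Cplx.{w, v₁} k} {t : ∀ n, (K (n + 1)).Hom (K n)}
    {L : ℕ → Cplx.{w, v₂} k} {s : ∀ n, (L (n + 1)).Hom (L n)} {u : ∀ n, (K n).Hom (L n)}
    {h : ∀ n m x, (s n).f m ((u (n + 1)).f m x) = (u n).f m ((t n).f m x)}
    (ht : ∀ n m, Function.Surjective ((t n).f m)) (hs : ∀ n m, Function.Surjective ((s n).f m))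
    (hu : ∀ n, (u n).IsQuasiIso) : (Hom.lim u h).IsQuasiIso :=
  Hom.IsQuasiIso.of_shortExact (limι K t) (limδ K t) (limι L s) (limδ L s)
    (fun _ => Subtype.val_injective) (fun _ => Subtype.val_injective) (limδ_surjective ht)
    (limδ_surjective hs) limδ_limι limδ_limι exists_of_limδ_eq_zero exists_of_limδ_eq_zero
    (fun _ _ => rfl)
    (fun m x => funext fun n => by
      change (u n).f m (x n) - (s n).f m ((u (n + 1)).f m (x (n + 1))) =
        (u n).f m (x n - (t n).f m (x (n + 1)))
      rw [h, map_sub])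
    (Hom.IsQuasiIso.pi hu) (Hom.IsQuasiIso.pi hu)

end Cplx

/-! ### Exhaustions by objects of a full dg-subcategory -/

namespace DGCat

variable {k : Type w} [Field k]

/-- An exhaustion of the object `Y` by objects `Y n` satisfying `P`: closed morphisms
`j n : Y n → Y` with retractions `r n`, which need not be closed, such that `j n` factors through
`j m` for `n ≤ m`, and each morphism from an object satisfying `P` to `Y` factors through some
`j n`. -/
structure Exhaustion (A : DGCat.{w, v, u} k) (P : A.Obj → Prop) (Y : A.Obj) where
  obj : ℕ → A.Obj
  prop : ∀ n, P (obj n)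
  j : ∀ n, A.Hom (obj n) Y 0
  d_j : ∀ n, A.d 0 1 (j n) = 0
  r : ∀ n, A.Hom Y (obj n) 0
  j_r : ∀ n, A.comp (add_zero 0) (j n) (r n) = A.id _
  j_r_j : ∀ {n m : ℕ} (_ : n ≤ m),
    A.comp (add_zero 0) (A.comp (add_zero 0) (j n) (r m)) (j m) = j n
  factor : ∀ {X : A.Obj} (_ : P X) {p : ℤ} (g : A.Hom X Y p), ∃ n,
    A.comp (add_zero p) (A.comp (add_zero p) g (r n)) (j n) = g

namespace Exhaustion

variable {A : DGCat.{w, v₁, u₁} k} {P : A.Obj → Prop} {Y : A.Obj} (E : Exhaustion A P Y)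

/-- The transition morphisms `Y n → Y (n + 1)`. -/
def t (n : ℕ) : A.Hom (E.obj n) (E.obj (n + 1)) 0 := A.comp (add_zero 0) (E.j n) (E.r (n + 1))

lemma t_j (n : ℕ) : A.comp (add_zero 0) (E.t n) (E.j (n + 1)) = E.j n := E.j_r_j n.le_succ

lemma d_t (n : ℕ) : A.d 0 1 (E.t n) = 0 := by
  have e : A.comp (add_zero 1) (A.d 0 1 (E.t n)) (E.j (n + 1)) = 0 := by
    rw [← A.d_comp_closed (zero_add 1) _ (E.d_j _), t_j, E.d_j]
  have e' := congrArg (fun z => A.comp (add_zero 1) z (E.r (n + 1))) e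
  rwa [A.assoc _ _ _ _ _ (add_zero 0) (add_zero 1), E.j_r, A.comp_id, map_zero,
    LinearMap.zero_apply] at e'

lemma exists_retraction (n : ℕ) : ∃ s, A.comp (add_zero 0) (E.t n) s = A.id _ := by
  refine ⟨A.comp (add_zero 0) (E.j (n + 1)) (E.r n), ?_⟩
  rw [← A.assoc _ _ _ (add_zero 0) (add_zero 0) (add_zero 0) (add_zero 0), t_j, E.j_r]

end Exhaustion

end DGCat

/-! ### Natural transformations on a full dg-subcategory to a coinduced dg-functor -/

namespace DGCat

variable {k : Type w} [Field k] {A : DGCat.{w, v₁, u₁} k} {C : DGCat.{w, v₂, u₂} k}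
  {P : A.Obj → Prop}

/-- The action on morphisms of a dg-functor on a full dg-subcategory. -/
def mapSub (M : DGFunctor (A.fullSub P) C) {X Y : A.Obj} (hX : P X) (hY : P Y) {n : ℤ} :
    A.Hom X Y n →ₗ[k] C.Hom (M.obj ⟨X, hX⟩) (M.obj ⟨Y, hY⟩) n :=
  M.map (X := ⟨X, hX⟩) (Y := ⟨Y, hY⟩)

lemma mapSub_id (M : DGFunctor (A.fullSub P) C) {X : A.Obj} (hX : P X) :
    mapSub M hX hX (A.id X) = C.id _ := M.map_id ⟨X, hX⟩

lemma mapSub_comp (M : DGFunctor (A.fullSub P) C) {X Y Z : A.Obj} (hX : P X) (hY : P Y) (hZ : P Z)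
    {p q n : ℤ} (h : p + q = n) (f : A.Hom X Y p) (g : A.Hom Y Z q) :
    mapSub M hX hZ (A.comp h f g) = C.comp h (mapSub M hX hY f) (mapSub M hY hZ g) :=
  M.map_comp (X := ⟨X, hX⟩) (Y := ⟨Y, hY⟩) (Z := ⟨Z, hZ⟩) h f g

lemma d_mapSub (M : DGFunctor (A.fullSub P) C) {X Y : A.Obj} (hX : P X) (hY : P Y)
    {f : A.Hom X Y 0} (hf : A.d 0 1 f = 0) : C.d 0 1 (mapSub M hX hY f) = 0 :=
  (M.map_d (X := ⟨X, hX⟩) (Y := ⟨Y, hY⟩) 0 1 (zero_add 1) f).symm.trans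
    ((congrArg (mapSub M hX hY) hf).trans (map_zero _))

namespace Exhaustion

variable {Y : A.Obj} (E : Exhaustion A P Y) (M : DGFunctor (A.fullSub P) C) (N : C.Obj)

/-- The tower of complexes of morphisms `M (Y n) → N`. -/
abbrev homTower (n : ℕ) : (C.homCplx (M.obj ⟨E.obj (n + 1), E.prop (n + 1)⟩) N).Hom
    (C.homCplx (M.obj ⟨E.obj n, E.prop n⟩) N) :=
  C.precompHom (mapSub M (E.prop n) (E.prop (n + 1)) (E.t n)) (d_mapSub M _ _ (E.d_t n)) N

/-- The limit of the complexes of morphisms `M (Y n) → N`. -/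
abbrev homLim : Cplx.{w, v₂} k :=
  Cplx.lim (fun n => C.homCplx (M.obj ⟨E.obj n, E.prop n⟩) N) (E.homTower M N)

/-- The transition maps are surjective because the transition morphisms of the exhaustion split. -/
lemma homTower_surjective (n : ℕ) (m : ℤ) : Function.Surjective ((E.homTower M N n).f m) := by
  intro x
  obtain ⟨s, hs⟩ := E.exists_retraction n
  refine ⟨C.comp (zero_add m) (mapSub M (E.prop (n + 1)) (E.prop n) s) x, ?_⟩
  change C.comp (zero_add m) (mapSub M _ _ (E.t n)) (C.comp (zero_add m) (mapSub M _ _ s) x) = x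
  rw [← C.assoc _ _ _ (add_zero 0) (zero_add m) (zero_add m) (zero_add m), ← mapSub_comp, hs,
    mapSub_id, C.id_comp]

variable {M N}

/-- In a compatible family the `l`-th member determines the earlier ones. -/
lemma homLim_comp {m : ℤ} (x : (E.homLim M N).X m) {n l : ℕ} (h : n ≤ l) :
    C.comp (zero_add m)
      (mapSub M (E.prop n) (E.prop l) (A.comp (add_zero 0) (E.j n) (E.r l))) (x.1 l) = x.1 n := by
  induction l, h using Nat.le_induction with
  | base => rw [E.j_r, mapSub_id, C.id_comp]
  | succ l h ih =>
    rw [← E.j_r_j h, A.assoc _ _ _ (add_zero 0) (add_zero 0) (add_zero 0) (add_zero 0),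
      mapSub_comp M _ (E.prop l), C.assoc _ _ _ (add_zero 0) (zero_add m) (zero_add m) (zero_add m)]
    exact (congrArg _ (x.2 l)).trans ih

/-- A compatible family of morphisms `x n : M (Y n) → N` defines a `k`-linear map
`A(X, Y) → C(M X, N)` for each object `X` that satisfies `P`. -/
lemma exists_linear {m : ℤ} (x : (E.homLim M N).X m) {X : A.Obj} (hX : P X) (p q : ℤ)
    (hq : p + m = q) : ∃ θ : A.Hom X Y p →ₗ[k] C.Hom (M.obj ⟨X, hX⟩) N q, ∀ (g : A.Hom X Y p)
      (n : ℕ) (_ : A.comp (add_zero p) (A.comp (add_zero p) g (E.r n)) (E.j n) = g),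
      θ g = C.comp hq (mapSub M hX (E.prop n) (A.comp (add_zero p) g (E.r n))) (x.1 n) := by
  let V (n : ℕ) : A.Hom X Y p →ₗ[k] C.Hom (M.obj ⟨X, hX⟩) N q :=
    (C.comp hq).flip (x.1 n) ∘ₗ mapSub M hX (E.prop n) ∘ₗ (A.comp (add_zero p)).flip (E.r n)
  have hV : ∀ g n l, n ≤ l →
      A.comp (add_zero p) (A.comp (add_zero p) g (E.r n)) (E.j n) = g → V l g = V n g := by
    intro g n l h hg
    change C.comp hq (mapSub M hX (E.prop l) (A.comp (add_zero p) g (E.r l))) (x.1 l) =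
      C.comp hq (mapSub M hX (E.prop n) (A.comp (add_zero p) g (E.r n))) (x.1 n)
    conv_lhs => rw [← hg]
    rw [A.assoc _ (E.j n) _ (add_zero p) (add_zero p) (add_zero 0) (add_zero p),
      mapSub_comp M hX (E.prop n), C.assoc _ _ _ (add_zero p) hq (zero_add m) hq, E.homLim_comp x h]
  choose N hN using fun g : A.Hom X Y p => E.factor hX g
  refine ⟨{ toFun g := V (N g) g, map_add' g g' := ?_, map_smul' a g := ?_ }, fun g n hn => ?_⟩
  · let l := max (N (g + g')) (max (N g) (N g'))
    rw [← hV _ _ l (le_max_left _ _) (hN _),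
      ← hV g _ l ((le_max_left _ _).trans (le_max_right _ _)) (hN _),
      ← hV g' _ l ((le_max_right _ _).trans (le_max_right _ _)) (hN _), map_add]
  · let l := max (N (a • g)) (N g)
    rw [← hV _ _ l (le_max_left _ _) (hN _), ← hV g _ l (le_max_right _ _) (hN _), map_smul,
      RingHom.id_apply]
  · let l := max (N g) n
    exact (hV _ _ l (le_max_left _ _) (hN _)).symm.trans (hV g _ l (le_max_right _ _) hn)

end Exhaustion

section coind

lemma comp_comp_of_square {X X' Y Y' Z : C.Obj} {m p q n l : ℤ} {s : ℤˣ} (φ : C.Hom X X' m)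
    (F : C.Hom X' Y' p) (f : C.Hom X Y p) (ψ : C.Hom Y Y' m) (g : C.Hom Y' Z q)
    (e : C.comp rfl φ F = s • C.comp (add_comm p m) f ψ) (h₁ : m + l = n) (h : p + q = l)
    (h₂ : p + (m + q) = n) :
    C.comp h₁ φ (C.comp h F g) = s • C.comp h₂ f (C.comp rfl ψ g) := by
  rw [← C.assoc (pq := m + p) _ _ _ rfl (by omega) h h₁, e, C.units_smul_comp,
    C.assoc _ _ _ _ _ rfl h₂]

variable (hW : HasWProd A C)

/-- Naturality of `φ` along `f`, evaluated at the projection to `g`. -/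
lemma sub_coind_π {M : DGFunctor (A.fullSub P) C} {N : A.Obj → C.Obj} {m : ℤ}
    (φ : M.natTrans ((DGFunctor.ofFullSub A P).comp (coind hW N)) m) {X Y Z : A.Obj} (hX : P X)
    (hY : P Y) {p q l n : ℤ} (f : A.Hom X Y p) (g : A.Hom Y Z q) (h : p + q = l)
    (h₁ : m + l = n) (h₂ : p + (m + q) = n) :
    C.comp h₁ (φ.1 ⟨X, hX⟩) (coindπ hW N X (A.comp h f g)) =
      (m * p).negOnePow • C.comp h₂ (mapSub M hX hY f)
        (C.comp rfl (φ.1 ⟨Y, hY⟩) (coindπ hW N Y g)) := by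
  have e : C.comp rfl (φ.1 ⟨X, hX⟩) ((coind hW N).map f) =
      (m * p).negOnePow • C.comp (add_comm p m) (mapSub M hX hY f) (φ.1 ⟨Y, hY⟩) :=
    DGFunctor.natTrans_comm φ (X := ⟨X, hX⟩) (Y := ⟨Y, hY⟩) rfl (add_comm p m) f
  rw [← coind_map_π (hW := hW) h]
  exact comp_comp_of_square _ _ _ _ _ e h₁ h h₂

variable (E : ∀ Y, Exhaustion A P Y) (M : DGFunctor (A.fullSub P) C) (N : A.Obj → C.Obj)

/-- The members of the family attached to a natural transformation. -/
noncomputable def subCoindApp (m : ℤ) (Y : A.Obj) (n : ℕ) :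
    M.natTrans ((DGFunctor.ofFullSub A P).comp (coind hW N)) m →ₗ[k]
      C.Hom (M.obj ⟨(E Y).obj n, (E Y).prop n⟩) (N Y) m where
  toFun φ := C.comp (Y := (coind hW N).obj ((E Y).obj n)) (add_zero m)
    (φ.1 ⟨(E Y).obj n, (E Y).prop n⟩) (coindπ hW N _ ((E Y).j n))
  map_add' _ _ := LinearMap.map_add₂ (C.comp (add_zero m)) _ _ _
  map_smul' _ _ := LinearMap.map_smul₂ (C.comp (add_zero m)) _ _ _

lemma subCoindApp_mem (m : ℤ) (Y : A.Obj) (n : ℕ)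
    (φ : M.natTrans ((DGFunctor.ofFullSub A P).comp (coind hW N)) m) :
    C.comp (zero_add m) (mapSub M ((E Y).prop n) ((E Y).prop (n + 1)) ((E Y).t n))
      (subCoindApp hW E M N m Y (n + 1) φ) = subCoindApp hW E M N m Y n φ := by
  have e := sub_coind_π hW φ ((E Y).prop n) ((E Y).prop (n + 1)) ((E Y).t n) ((E Y).j (n + 1))
    (add_zero 0) (add_zero m) (by omega)
  rw [(E Y).t_j, mul_zero, Int.negOnePow_zero, one_smul] at e
  refine Eq.trans ?_ e.symm
  have key : ∀ (l : ℤ) (hl : m + 0 = l) (h : 0 + l = m),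
      C.comp h (mapSub M ((E Y).prop n) ((E Y).prop (n + 1)) ((E Y).t n))
        (C.comp hl (φ.1 ⟨(E Y).obj (n + 1), (E Y).prop (n + 1)⟩)
          (coindπ hW N _ ((E Y).j (n + 1)))) = C.comp (zero_add m)
      (mapSub M ((E Y).prop n) ((E Y).prop (n + 1)) ((E Y).t n))
      (subCoindApp hW E M N m Y (n + 1) φ) := by
    intro l hl h
    obtain rfl : l = m := by omega
    rfl
  exact (key _ _ _).symm

/-- The compatible families attached to a natural transformation. -/
noncomputable def subCoindₗ (m : ℤ) :
    M.natTrans ((DGFunctor.ofFullSub A P).comp (coind hW N)) m →ₗ[k]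
      ∀ Y, ((E Y).homLim M (N Y)).X m :=
  LinearMap.pi fun Y => (LinearMap.pi fun n => subCoindApp hW E M N m Y n).codRestrict _
    fun φ n => subCoindApp_mem hW E M N m Y n φ

/-- The complex of natural transformations from `M` to (the restriction of) a coinduced dg-functor
maps to a product of limits of complexes of morphisms `M (Y n) → N Y`. -/
noncomputable def subCoindHom :
    (((A.fullSub P).dgFun C).homCplx M ((DGFunctor.ofFullSub A P).comp (coind hW N))).Hom
      (Cplx.pi fun Y => (E Y).homLim M (N Y)) where
  f m := subCoindₗ hW E M N m
  comm m m' h φ := funext fun Y => Subtype.ext <| funext fun n => by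
    have e : C.d 0 1 (coindπ hW N _ ((E Y).j n)) = 0 := by
      rw [d_coindπ (zero_add 1), (E Y).d_j, map_zero]
    exact (C.d_comp_closed h (φ.1 ⟨(E Y).obj n, (E Y).prop n⟩) e).symm.trans (if_pos h).symm

/-- A natural transformation is determined by its members `subCoindApp`. -/
lemma natTrans_sub_coind_π {m : ℤ}
    (φ : M.natTrans ((DGFunctor.ofFullSub A P).comp (coind hW N)) m) {X Y : A.Obj} (hX : P X)
    {p q : ℤ} (h : m + p = q) (h' : p + m = q) (g : A.Hom X Y p) {n : ℕ}
    (hn : A.comp (add_zero p) (A.comp (add_zero p) g ((E Y).r n)) ((E Y).j n) = g) :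
    C.comp h (φ.1 ⟨X, hX⟩) (coindπ hW N X g) =
      (m * p).negOnePow • C.comp h'
        (mapSub M hX ((E Y).prop n) (A.comp (add_zero p) g ((E Y).r n)))
        (subCoindApp hW E M N m Y n φ) := by
  have e := sub_coind_π hW φ hX ((E Y).prop n) (A.comp (add_zero p) g ((E Y).r n)) ((E Y).j n)
    (add_zero p) h (by omega)
  rw [hn] at e
  refine e.trans (congrArg _ ?_)
  have key : ∀ (l : ℤ) (hl : m + 0 = l) (h : p + l = q),
      C.comp h (mapSub M hX ((E Y).prop n) (A.comp (add_zero p) g ((E Y).r n)))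
        (C.comp hl (φ.1 ⟨(E Y).obj n, (E Y).prop n⟩)
          (coindπ hW N _ ((E Y).j n))) = C.comp h'
      (mapSub M hX ((E Y).prop n) (A.comp (add_zero p) g ((E Y).r n)))
      (subCoindApp hW E M N m Y n φ) := by
    intro l hl h
    obtain rfl : l = m := by omega
    rfl
  exact key _ _ _

/-- Natural transformations from `M` to the restriction of a coinduced dg-functor amount to families
of morphisms in `lim n, C(M (Y n), N Y)`: since each `g : X → Y` with `X` satisfying `P` factors
through some `j n`, this limit is the complex of natural transformations from `A(-, Y)` to
`C(M -, N Y)` over the full dg-subcategory. -/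
lemma bijective_subCoindₗ (m : ℤ) : Function.Bijective (subCoindₗ hW E M N m) := by
  constructor
  · intro φ φ' h
    have h' : ∀ Y n, subCoindApp hW E M N m Y n φ = subCoindApp hW E M N m Y n φ' := fun Y n =>
      congrFun (congrArg Subtype.val (congrFun h Y)) n
    refine Subtype.ext (funext fun X => coind_ext (X := X.1) fun Y p q hq g => ?_)
    obtain ⟨n, hn⟩ := (E Y).factor X.2 g
    refine (natTrans_sub_coind_π hW E M N φ X.2 hq (by omega) g hn).trans ?_
    rw [h']
    exact (natTrans_sub_coind_π hW E M N φ' X.2 hq (by omega) g hn).symm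
  · intro x
    choose θ hθ using fun (X : (A.fullSub P).Obj) Y p q hq =>
      (E Y).exists_linear (x Y) X.2 p q hq
    choose φ hφ using fun X : (A.fullSub P).Obj =>
      coind_lift (hW := hW) (N := N) (X := X.1) (Z := M.obj X) (m := m)
      fun Y p q hq => (m * p).negOnePow • θ X Y p q (by omega)
    have hφ' : ∀ (X : A.Obj) (hX : P X) Y p q (hq : m + p = q) (hq' : p + m = q) (g : A.Hom X Y p)
      (n : ℕ) (_ : A.comp (add_zero p) (A.comp (add_zero p) g ((E Y).r n)) ((E Y).j n) = g),
        C.comp hq (φ ⟨X, hX⟩) (coindπ hW N X g) = (m * p).negOnePow • C.comp hq'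
          (mapSub M hX ((E Y).prop n) (A.comp (add_zero p) g ((E Y).r n))) ((x Y).1 n) :=
      fun X hX Y p q hq hq' g n hn => (hφ ⟨X, hX⟩ Y p q hq g).trans
        (congrArg _ (hθ ⟨X, hX⟩ Y p q hq' g n hn))
    have hnat : ∀ (X X' : A.Obj) (hX : P X) (hX' : P X') (p q : ℤ) (h₁ : m + p = q)
        (h₂ : p + m = q) (f : A.Hom X X' p), C.comp h₁ (φ ⟨X, hX⟩) ((coind hW N).map f) =
        (m * p).negOnePow • C.comp h₂ (mapSub M hX hX' f) (φ ⟨X', hX'⟩) := by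
      intro X X' hX hX' p q h₁ h₂ f
      refine coind_ext fun Y r s hs g => ?_
      obtain ⟨n, hn⟩ := (E Y).factor hX' g
      have hn' : A.comp (add_zero (p + r)) (A.comp (add_zero (p + r)) (A.comp rfl f g) ((E Y).r n))
          ((E Y).j n) = A.comp rfl f g := by
        rw [A.assoc _ _ _ _ _ (add_zero r) rfl, A.assoc _ _ _ _ _ (add_zero r) rfl, hn]
      rw [C.assoc _ _ _ h₁ hs rfl (by omega), coind_map_π, hφ' X hX Y _ s _ (by omega) _ n hn',
        A.assoc _ _ _ _ _ (add_zero r) rfl, mapSub_comp M hX hX',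
        C.units_smul_comp, C.assoc _ _ _ h₂ hs rfl (by omega),
        hφ' X' hX' Y _ _ rfl (by omega) g n hn, C.comp_units_smul, smul_smul,
        ← Int.negOnePow_add, mul_add,
        C.assoc (qr := m + r) _ _ _ rfl (by omega) (by omega) (by omega)]
    refine ⟨⟨φ, fun X X' p q h₁ h₂ f => hnat X.1 X'.1 X.2 X'.2 p q h₁ h₂ f⟩,
      funext fun Y => Subtype.ext <| funext fun n => ?_⟩
    have hn : A.comp (add_zero 0) (A.comp (add_zero 0) ((E Y).j n) ((E Y).r n)) ((E Y).j n) =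
        (E Y).j n := (E Y).j_r_j le_rfl
    refine (hφ' _ ((E Y).prop n) Y 0 m (add_zero m) (zero_add m) ((E Y).j n) n hn).trans ?_
    rw [mul_zero, Int.negOnePow_zero, one_smul, (E Y).j_r, mapSub_id, C.id_comp]

end coind

end DGCat

/-! ### Restriction to a full dg-subcategory -/

namespace DGCat

variable {k : Type w} [Field k] {A : DGCat.{w, v₁, u₁} k} {C : DGCat.{w, v₂, u₂} k}
  {P : A.Obj → Prop}

section

variable (hW : HasWProd A C) (hC : HasTot C) (E : ∀ Y, Exhaustion A P Y)

include E in
/-- The restriction of a coinduced dg-functor to the full dg-subcategory inherits orthogonality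
properties from its values, since morphisms to it are products of limits of towers. -/
lemma isQuasiIso_precompHom_sub_coind {Z S : DGFunctor (A.fullSub P) C} (φ : Z.natTrans S 0)
    (hφ : ∀ X, C.d 0 1 (φ.1 X) = 0) {N : A.Obj → C.Obj}
    (h : ∀ X Y, (C.precompHom (φ.1 X) (hφ X) (N Y)).IsQuasiIso) :
    (((A.fullSub P).dgFun C).precompHom (X := Z) (X' := S) φ (Subtype.ext (funext hφ))
      ((DGFunctor.ofFullSub A P).comp (coind hW N))).IsQuasiIso := by
  refine Cplx.Hom.IsQuasiIso.of_bijective (subCoindHom hW E S N) (subCoindHom hW E Z N)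
    (bijective_subCoindₗ hW E S N) (bijective_subCoindₗ hW E Z N)
    (u' := Cplx.Hom.pi fun Y => Cplx.Hom.lim
      (fun n => C.precompHom (φ.1 ⟨(E Y).obj n, (E Y).prop n⟩) (hφ _) (N Y)) fun n m x => ?_)
    (fun m x => funext fun Y => Subtype.ext <| funext fun n => C.assoc _ _ _ _ _ _ _)
    (Cplx.Hom.IsQuasiIso.pi fun Y => Cplx.Hom.IsQuasiIso.lim ((E Y).homTower_surjective _ _)
      ((E Y).homTower_surjective _ _) fun n => h _ Y)
  have e := DGFunctor.natTrans_comm φ (X := ⟨(E Y).obj n, (E Y).prop n⟩)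
    (Y := ⟨(E Y).obj (n + 1), (E Y).prop (n + 1)⟩) (add_zero 0) (add_zero 0) ((E Y).t n)
  rw [mul_zero, Int.negOnePow_zero, one_smul] at e
  refine (C.assoc _ _ _ (add_zero 0) (zero_add m) (zero_add m) (zero_add m)).symm.trans
    (Eq.trans ?_ (C.assoc _ _ _ (add_zero 0) (zero_add m) (zero_add m) (zero_add m)))
  exact congrArg (fun z => C.comp (zero_add m) z x) e.symm

lemma isTot_sub_cobarObj (M : DGFunctor A C) :
    IsTot (C := (A.fullSub P).dgFun C)
      (fun n => (DGFunctor.ofFullSub A P).comp (cofreeIter hW (n + 1) M))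
      (fun n => (DGFunctor.ofFullSub A P).restrictNatTrans _ _ 0 (cofreeD hW (n + 1) M))
      ((DGFunctor.ofFullSub A P).comp (cobarObj hW hC M))
      fun n => (DGFunctor.ofFullSub A P).restrictNatTrans _ _ _ (cobarObjP hW hC n M) :=
  IsTot.of_objectwise (D := fun n =>
    (DGFunctor.ofFullSub A P).restrictNatTrans _ _ 0 (cofreeD hW (n + 1) M))
    fun X => isTot_cobarObj hW hC M X.1

include E in
/-- Precomposition with `φ` is a quasi-isomorphism on morphisms to the restriction of the cobar
resolution of `M` if precomposition with the components of `φ` is a quasi-isomorphism on morphisms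
to the values of `M`. -/
lemma isQuasiIso_precompHom_sub_cobarObj {Z S : DGFunctor (A.fullSub P) C} (φ : Z.natTrans S 0)
    (hφ : ∀ X, C.d 0 1 (φ.1 X) = 0) {M : DGFunctor A C}
    (h : ∀ X Y, (C.precompHom (φ.1 X) (hφ X) (M.obj Y)).IsQuasiIso) :
    (((A.fullSub P).dgFun C).precompHom (X := Z) (X' := S) φ (Subtype.ext (funext hφ))
      ((DGFunctor.ofFullSub A P).comp (cobarObj hW hC M))).IsQuasiIso :=
  IsTot.isQuasiIso_precompHom (isTot_sub_cobarObj hW hC M)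
    (fun n => Subtype.ext (funext fun X => d_cofreeD hW (n + 1) M X.1))
    (fun n => Subtype.ext (funext fun X => cofreeD_comp hW (n + 1) M X.1)) fun n =>
      isQuasiIso_precompHom_sub_coind hW E φ hφ fun X =>
        isQuasiIso_precompHom_cofreeIter hW (h X) n

end

/-- The closed morphisms `inc n` exhibit `S` as the coproduct of the objects `Z n` in the graded
category underlying `A` (hence also in the dg-category `A`). -/
structure IsCoprod (A : DGCat.{w, v, u} k) {ι : Type u₁} (Z : ι → A.Obj) (S : A.Obj)
    (inc : ∀ n, A.Hom (Z n) S 0) : Prop where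
  d_inc : ∀ n, A.d 0 1 (inc n) = 0
  ext : ∀ {T : A.Obj} {m : ℤ} {x y : A.Hom S T m},
    (∀ n, A.comp (zero_add m) (inc n) x = A.comp (zero_add m) (inc n) y) → x = y
  lift : ∀ {T : A.Obj} {m : ℤ} (θ : ∀ n, A.Hom (Z n) T m),
    ∃ x : A.Hom S T m, ∀ n, A.comp (zero_add m) (inc n) x = θ n

namespace Exhaustion

variable {Y : A.Obj} (E : Exhaustion A P Y)

/-- A presentation of `Y` as the sequential colimit of its exhaustion: a coproduct `S` of the
objects `Y n` such that `S → S → Y` (the difference of the identity and the shift,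
and the morphism induced by the `j n`) is a short exact sequence, split by `γ` and `δ`, which need
not be closed. -/
structure Presentation where
  S : A.Obj
  inc : ∀ n, A.Hom (E.obj n) S 0
  isCoprod : IsCoprod A E.obj S inc
  α : A.Hom S S 0
  d_α : A.d 0 1 α = 0
  β : A.Hom S Y 0
  d_β : A.d 0 1 β = 0
  γ : A.Hom Y S 0
  δ : A.Hom S S 0
  inc_α : ∀ n, A.comp (add_zero 0) (inc n) α =
    inc n - A.comp (add_zero 0) (E.t n) (inc (n + 1))
  inc_β : ∀ n, A.comp (add_zero 0) (inc n) β = E.j n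
  α_β : A.comp (add_zero 0) α β = 0
  α_δ : A.comp (add_zero 0) α δ = A.id S
  γ_β : A.comp (add_zero 0) γ β = A.id Y
  split : A.comp (add_zero 0) β γ + A.comp (add_zero 0) δ α = A.id S

/-- A closed morphism of degree `0` is preserved by dg-functors. -/
lemma _root_.DGFunctor.d_map (F : DGFunctor A C) {X X' : A.Obj} {f : A.Hom X X' 0}
    (hf : A.d 0 1 f = 0) : C.d 0 1 (F.map f) = 0 := by
  rw [← F.map_d 0 1 (zero_add 1), hf, map_zero]

/-- The members of the family `n ↦ F (j n) ; x`. -/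
def homLimₗ (F : DGFunctor A C) (J : C.Obj) (m : ℤ) : C.Hom (F.obj Y) J m →ₗ[k]
    (E.homLim ((DGFunctor.ofFullSub A P).comp F) J).X m :=
  (LinearMap.pi fun n => C.comp (zero_add m) (F.map (E.j n))).codRestrict _ fun x n => by
    change C.comp (zero_add m) (F.map (E.t n)) (C.comp (zero_add m) (F.map (E.j (n + 1))) x) =
      C.comp (zero_add m) (F.map (E.j n)) x
    rw [← C.assoc _ _ _ (add_zero 0) (zero_add m) (zero_add m) (zero_add m), ← F.map_comp, E.t_j]

/-- The restriction of morphisms `F Y → J` to the objects `F (Y n)`. -/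
def homLimHom (F : DGFunctor A C) (J : C.Obj) :
    (C.homCplx (F.obj Y) J).Hom (E.homLim ((DGFunctor.ofFullSub A P).comp F) J) where
  f m := E.homLimₗ F J m
  comm _ _ h x := Subtype.ext <| funext fun n =>
    (C.d_comp_of_closed h (F.d_map (E.d_j n)) x).symm.trans (if_pos h).symm

/-- If `F S` is the homotopy coproduct of the objects `F (Y n)` with respect to morphisms to `J`,
then `F Y` is their homotopy colimit. -/
lemma isQuasiIso_homLimHom (p : E.Presentation) (F : DGFunctor A C) (J : C.Obj)
    (h : (C.precompPi (fun n => F.map (p.inc n)) (fun n => F.d_map (p.isCoprod.d_inc n))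
      J).IsQuasiIso) :
    (E.homLimHom F J).IsQuasiIso := by
  have key : ∀ {X X' X'' : A.Obj} (f : A.Hom X X' 0) (g : A.Hom X' X'' 0) {m : ℤ}
      (x : C.Hom (F.obj X'') J m), C.comp (zero_add m) (F.map f) (C.comp (zero_add m) (F.map g) x) =
        C.comp (zero_add m) (F.map (A.comp (add_zero 0) f g)) x := by
    intro X X' X'' f g m x
    rw [F.map_comp, C.assoc _ _ _ _ _ (zero_add m) (zero_add m)]
  have keyid : ∀ {X : A.Obj} {m : ℤ} (x : C.Hom (F.obj X) J m),
      C.comp (zero_add m) (F.map (A.id X)) x = x := by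
    intro X m x
    rw [F.map_id, C.id_comp]
  refine Cplx.Hom.IsQuasiIso.of_shortExact (C.precompHom (F.map p.β) (F.d_map p.d_β) J)
    (C.precompHom (F.map p.α) (F.d_map p.d_α) J) (Cplx.limι _ _) (Cplx.limδ _ _)
    (fun m x y hxy => ?_) (fun _ => Subtype.val_injective) (fun m x => ⟨_, (key _ p.δ x).trans ?_⟩)
    (Cplx.limδ_surjective (E.homTower_surjective _ _)) (fun m x => (key _ _ x).trans ?_)
    Cplx.limδ_limι (fun m x hx => ⟨C.comp (zero_add m) (F.map p.γ) x, (key _ _ x).trans ?_⟩)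
    Cplx.exists_of_limδ_eq_zero (fun m x => funext fun n => ?_)
    (fun m x => funext fun n => ?_) h h
  · have e := congrArg (C.comp (zero_add m) (F.map p.γ)) hxy
    dsimp only at e
    rwa [key, key, p.γ_β, keyid, keyid] at e
  · rw [p.α_δ, keyid]
  · rw [p.α_β, map_zero, map_zero, LinearMap.zero_apply]
  · have e := keyid x
    rw [← p.split, map_add, map_add, LinearMap.add_apply, ← key p.δ] at e
    have hx' : C.comp (zero_add m) (F.map p.α) x = 0 := hx
    rw [hx', map_zero, add_zero] at e
    exact e
  · exact ((key _ _ x).trans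
      (congrArg (fun z => C.comp (zero_add m) (F.map z) x) (p.inc_β n))).symm
  · refine Eq.trans ?_ ((key _ _ x).trans
      (congrArg (fun z => C.comp (zero_add m) (F.map z) x) (p.inc_α n))).symm
    dsimp only
    rw [map_sub, map_sub, LinearMap.sub_apply]
    exact congrArg (_ - ·) (key _ _ x)

end Exhaustion

section

variable (hW : HasWProd A C) (hC : HasTot C) (E : ∀ Y, Exhaustion A P Y)

/-- The restriction of natural transformations to a full dg-subcategory, as a chain map. -/
def restrictHom (P : A.Obj → Prop) (F G : DGFunctor A C) : ((A.dgFun C).homCplx F G).Hom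
    (((A.fullSub P).dgFun C).homCplx ((DGFunctor.ofFullSub A P).comp F)
      ((DGFunctor.ofFullSub A P).comp G)) where
  f n := (DGFunctor.ofFullSub A P).restrictNatTrans F G n
  comm _ _ _ _ := rfl

include E in
/-- Restriction to the full dg-subcategory on morphisms `F → coind N` amounts to the comparison of
`C(F Y, N Y)` with the limit of the complexes `C(F (Y n), N Y)`. -/
lemma isQuasiIso_restrictHom_coind {F : DGFunctor A C} {N : A.Obj → C.Obj}
    (h : ∀ Y, ((E Y).homLimHom F (N Y)).IsQuasiIso) :
    (restrictHom P F (coind hW N)).IsQuasiIso := by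
  refine Cplx.Hom.IsQuasiIso.of_bijective (natTransCoindHom hW F N)
    (subCoindHom hW E ((DGFunctor.ofFullSub A P).comp F) N)
    (bijective_natTrans_coind F N (hW := hW)) (bijective_subCoindₗ hW E _ N)
    (u' := Cplx.Hom.pi fun Y => (E Y).homLimHom F (N Y))
    (fun m x => funext fun Y => Subtype.ext <| funext fun n => ?_)
    (Cplx.Hom.IsQuasiIso.pi h)
  have e := natTrans_coind_π x (add_zero m) (zero_add m) ((E Y).j n)
  rw [mul_zero, Int.negOnePow_zero, one_smul] at e
  exact e

include E in
/-- Restriction to the full dg-subcategory is a quasi-isomorphism on morphisms from `F` to the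
cobar resolution of `M` if `F` is compatible with the presentations with respect to morphisms to
the values of `M`. -/
lemma isQuasiIso_restrictHom_cobarObj (p : ∀ Y, (E Y).Presentation) {F M : DGFunctor A C}
    (h : ∀ Y Y', (C.precompPi (fun n => F.map ((p Y).inc n))
      (fun n => F.d_map ((p Y).isCoprod.d_inc n)) (M.obj Y')).IsQuasiIso) :
    (restrictHom P F (cobarObj hW hC M)).IsQuasiIso := by
  let h₁ := (isTot_cobar hW hC M).totDecomp
    (fun n => d_cobarD (d_cofreeUnit hW) (n + 1) M)
    (fun n => cobarD_comp (W := cofree hW) (η := cofreeUnit hW) (n + 1) M) F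
  let h₂ := (isTot_sub_cobarObj (P := P) hW hC M).totDecomp
    (fun n => Subtype.ext (funext fun X => d_cofreeD hW (n + 1) M X.1))
    (fun n => Subtype.ext (funext fun X => cofreeD_comp hW (n + 1) M X.1))
    ((DGFunctor.ofFullSub A P).comp F)
  exact Cplx.TotDecomp.isQuasiIso h₁ h₂ _
    (fun n => (restrictHom P F (cofreeIter hW (n + 1) M)).shift (-n))
    (fun n m x => rfl) (fun n m m' h x => rfl) fun n =>
      (isQuasiIso_restrictHom_coind hW E fun Y => (E Y).isQuasiIso_homLimHom (p Y) F _
        (isQuasiIso_precompPi_cofreeIter hW (h Y) n Y)).shift _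

end

end DGCat

/-! ### Morphisms to local objects in a localization -/

namespace CategoryTheory.MorphismProperty

variable {H : Type u₁} [Category.{v₁} H] (W : MorphismProperty H)

/-- If precomposition with the morphisms of `W` is bijective on morphisms to `R`, then morphisms
to `R` in the localization come from unique morphisms. -/
lemma bijective_Q_map {R : H}
    (hR : ∀ ⦃X Y : H⦄ (s : X ⟶ Y), W s → Function.Bijective fun f : Y ⟶ R => s ≫ f) (M : H) :
    Function.Bijective fun f : M ⟶ R => W.Q.map f := by
  constructor
  · intro f f' h
    have hG : W.IsInvertedBy (yoneda.obj R).rightOp := fun X Y s hs => by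
      have : IsIso ((yoneda.obj R).map s.op) := (isIso_iff_bijective _).2 (hR s hs)
      exact inferInstanceAs (IsIso ((yoneda.obj R).map s.op).op)
    have e := Functor.congr_hom (Localization.Construction.fac (yoneda.obj R).rightOp hG) f
    have e' := Functor.congr_hom (Localization.Construction.fac (yoneda.obj R).rightOp hG) f'
    dsimp only at h
    rw [Functor.comp_map, h] at e
    rw [Functor.comp_map, e] at e'
    have e'' : (yoneda.obj R).rightOp.map f = (yoneda.obj R).rightOp.map f' := by
      simpa only [cancel_epi, cancel_mono] using e'
    simpa using congrArg (fun z => z.unop (𝟙 R)) e''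
  · let e := Localization.Construction.objEquiv W
    let P : MorphismProperty W.Localization := fun a b g =>
      ∀ f : e.symm b ⟶ R, ∃ f' : e.symm a ⟶ R, g ≫ (show b ⟶ W.Q.obj R from W.Q.map f) =
        (show a ⟶ W.Q.obj R from W.Q.map f')
    have : P.IsStableUnderComposition := ⟨fun g g' hg hg' f => by
      obtain ⟨f', hf'⟩ := hg' f
      obtain ⟨f'', hf''⟩ := hg f'
      exact ⟨f'', by rw [Category.assoc, hf', hf'']⟩⟩
    have hP : P = ⊤ := Localization.Construction.morphismProperty_eq_top P
      (fun X Y g f => ⟨g ≫ f, (W.Q.map_comp g f).symm⟩) fun X Y w hw f => by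
        obtain ⟨f', hf'⟩ := (hR w hw).2 f
        refine ⟨f', (Iso.inv_comp_eq _).2 ?_⟩
        exact (congrArg W.Q.map hf'.symm).trans (W.Q.map_comp w f')
    intro g
    have hg : P g := by rw [hP]; trivial
    obtain ⟨f, hf⟩ := hg (𝟙 R)
    refine ⟨f, hf.symm.trans ?_⟩
    exact (congrArg (g ≫ ·) (W.Q.map_id R)).trans (Category.comp_id g)

end CategoryTheory.MorphismProperty

/-! ### Restriction of morphisms in the derived category of bimodules -/

/-- A dg-functor that is a quasi-isomorphism on complexes of morphisms is bijective on morphisms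
of homotopy categories. -/
lemma DGFunctor.bijective_mapH0_map {k : Type w} [Field k] {A : DGCat.{w, v₁, u₁} k}
    {C : DGCat.{w, v₂, u₂} k} (T : DGFunctor A C) {X Y : A.Obj}
    (u : (A.homCplx X Y).Hom (C.homCplx (T.obj X) (T.obj Y)))
    (hu : ∀ n (f : A.Hom X Y n), u.f n f = T.map f) (h : u.IsQuasiIso) :
    Function.Bijective fun f : A.toH0.obj ⟨X⟩ ⟶ A.toH0.obj ⟨Y⟩ => T.mapH0.map f := by
  constructor
  · intro f g hfg
    obtain ⟨f, hf, rfl⟩ := DGCat.mkH0_surjective f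
    obtain ⟨g, hg, rfl⟩ := DGCat.mkH0_surjective g
    obtain ⟨η, hη⟩ := (DGCat.mkH0_eq_iff (T.d_map hf) (T.d_map hg)).1 hfg
    obtain ⟨c, hc⟩ := h.exists_boundary (n := -1) (m := 0) (by norm_num) (zero_add 1) (f - g)
      (by simp only [map_sub, hf, hg, sub_zero]) η (by rw [hu, ← hη, map_sub])
    exact (DGCat.mkH0_eq_iff hf hg).2 ⟨c, hc.symm⟩
  · intro f
    obtain ⟨f, hf, rfl⟩ := DGCat.mkH0_surjective f
    obtain ⟨c, y, hc, hy⟩ := h.exists_lift (l := -1) (n := 0) (by norm_num) (zero_add 1) f hf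
    refine ⟨A.mkH0 c hc, (DGCat.mkH0_eq_iff (T.d_map hc) hf).2 ⟨-y, ?_⟩⟩
    rw [map_neg, ← hy, hu]
    abel

namespace DGBimod

open DGCat

variable {k : Type u} [Field k] {A B : DGCat.{u, u, u} k} {P : A.Obj → Prop}

/-- The resolutions `bimodRes G` are local with respect to quasi-isomorphisms. -/
lemma bijective_qis_comp_bimodRes {F F' : (DGBimod A B).H0} (s : F ⟶ F') (hs : qis A B s)
    (G : DGFunctor A B.dgMod) :
    Function.Bijective fun f : F' ⟶ (DGBimod A B).toH0.obj ⟨bimodRes G⟩ => s ≫ f := by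
  obtain ⟨φ, hφ, rfl⟩ := hs
  exact (DGBimod A B).bijective_comp_of_isQuasiIso φ.1 φ.2 _
    (isQuasiIso_precompHom_bimodRes φ hφ G)

/-- The resolutions `bimodRes G` stay local after restriction to the full dg-subcategory. -/
lemma bijective_qis_comp_sub_bimodRes (E : ∀ Y, Exhaustion A P Y)
    {F F' : (DGBimod (A.fullSub P) B).H0} (s : F ⟶ F') (hs : qis (A.fullSub P) B s)
    (G : DGFunctor A B.dgMod) :
    Function.Bijective fun f : F' ⟶ (DGBimod (A.fullSub P) B).toH0.obj
      ⟨(DGFunctor.ofFullSub A P).comp (bimodRes G)⟩ => s ≫ f := by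
  obtain ⟨φ, hφ, rfl⟩ := hs
  exact (DGBimod (A.fullSub P) B).bijective_comp_of_isQuasiIso φ.1 φ.2 _
    (isQuasiIso_precompHom_sub_cobarObj (hasWProd_dgMod A B) (hasTot_dgMod B) E φ.1
      (fun a => congrFun (congrArg Subtype.val φ.2) a)
      fun a a' => isQuasiIso_precompHom_modRes _ _ (hφ a) (G.obj a'))

lemma restriction_map_Q {A' : DGCat.{u, u, u} k} (i : DGFunctor A' A) {F G : (DGBimod A B).H0}
    (f : F ⟶ G) : (restriction i).map ((qis A B).Q.map f) =
      (qis A' B).Q.map ((i.precomp B.dgMod).mapH0.map f) := by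
  have e := Functor.congr_hom (Localization.Construction.fac
    ((i.precomp B.dgMod).mapH0 ⋙ (qis A' B).Q) (qis_mapH0_precomp (B := B) i)) f
  exact e.trans ((Category.id_comp _).trans (Category.comp_id _))

/-- Restriction to a full dg-subcategory is bijective on morphisms `F → G` of the derived category
of bimodules if `F` is compatible with the presentations of objects. -/
lemma bijective_restriction_map (E : ∀ Y, Exhaustion A P Y) (p : ∀ Y, (E Y).Presentation)
    (F G : DGFunctor A B.dgMod)
    (h : ∀ Y Y', (B.dgMod.precompPi (fun n => F.map ((p Y).inc n))
      (fun n => F.d_map ((p Y).isCoprod.d_inc n)) ((modRes B).obj (G.obj Y'))).IsQuasiIso) :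
    Function.Bijective fun f : toDerived (A := A) (B := B) F ⟶ toDerived (A := A) (B := B) G =>
      (restriction (B := B) (DGFunctor.ofFullSub A P)).map f := by
  let i := DGFunctor.ofFullSub A P
  let R : (DGBimod A B).H0 := (DGBimod A B).toH0.obj ⟨bimodRes G⟩
  -- morphisms to the resolution of `G` can be computed in the homotopy categories
  have h₁ : Function.Bijective fun f : toDerived (A := A) (B := B) F ⟶ (qis A B).Q.obj R =>
      (restriction (B := B) i).map f := by
    have e₁ := (qis A B).bijective_Q_map (R := R)
      (fun _ _ s hs => bijective_qis_comp_bimodRes s hs G) ((DGBimod A B).toH0.obj ⟨F⟩)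
    have e₂ := (qis (A.fullSub P) B).bijective_Q_map
      (fun _ _ s hs => bijective_qis_comp_sub_bimodRes E s hs G)
      ((DGBimod (A.fullSub P) B).toH0.obj ⟨i.comp F⟩)
    have e₃ := (i.precomp B.dgMod).bijective_mapH0_map (restrictHom P F (bimodRes G))
      (fun _ _ => rfl)
      (isQuasiIso_restrictHom_cobarObj (hasWProd_dgMod A B) (hasTot_dgMod B) E p h)
    refine (Function.Bijective.of_comp_iff _ e₁).1 ?_
    refine Eq.mp (congrArg Function.Bijective (funext fun f => ?_)) (e₂.comp e₃)
    exact (restriction_map_Q i f).symm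
  let q : toDerived (A := A) (B := B) G ⟶ (qis A B).Q.obj R :=
    (qis A B).Q.map ((DGBimod A B).toH0.map (bimodι G))
  have hq : IsIso q := (qis A B).Q_inverts _ ⟨bimodι G, isQis_bimodι G, rfl⟩
  have h₂ : Function.Bijective fun f : toDerived (A := A) (B := B) F ⟶
      toDerived (A := A) (B := B) G => f ≫ q := (asIso q).homToEquiv.bijective
  have h₃ : Function.Bijective fun f : (restriction (B := B) i).obj (toDerived (A := A) (B := B) F) ⟶
      (restriction (B := B) i).obj (toDerived (A := A) (B := B) G) =>
      f ≫ (restriction (B := B) i).map q :=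
    (asIso ((restriction (B := B) i).map q)).homToEquiv.bijective
  refine (Function.Bijective.of_comp_iff' h₃ _).1 ?_
  refine Eq.mp (congrArg Function.Bijective (funext fun f => ?_)) (h₁.comp h₂)
  exact (restriction (B := B) i).map_comp f q

/-- If a functor is bijective on all morphisms between `X` and `Y`, isomorphisms between their
images lift. -/
lemma _root_.CategoryTheory.Functor.exists_mapIso_eq {𝒞 : Type u₁} [Category.{v₁} 𝒞] {𝒟 : Type u₂}
    [Category.{v₂} 𝒟] (T : 𝒞 ⥤ 𝒟) {X Y : 𝒞}
    (h : ∀ Z Z' : 𝒞, (Z = X ∨ Z = Y) → (Z' = X ∨ Z' = Y) →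
      Function.Bijective fun f : Z ⟶ Z' => T.map f) (e : T.obj X ≅ T.obj Y) :
    ∃ e' : X ≅ Y, T.mapIso e' = e := by
  obtain ⟨f, hf⟩ := (h X Y (.inl rfl) (.inr rfl)).2 e.hom
  obtain ⟨g, hg⟩ := (h Y X (.inr rfl) (.inl rfl)).2 e.inv
  dsimp only at hf hg
  refine ⟨⟨f, g, (h X X (.inl rfl) (.inl rfl)).1 ?_, (h Y Y (.inr rfl) (.inr rfl)).1 ?_⟩,
    Iso.ext hf⟩
  · simp [hf, hg]
  · simp [hf, hg]

end DGBimod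

/-! ### Coproducts -/

namespace DGCat

variable {k : Type w} [Field k]

section

variable {A : DGCat.{w, v, u} k} {ι : Type u₁} {Z : ι → A.Obj} {S : A.Obj}
  {inc : ∀ n, A.Hom (Z n) S 0}

/-- Universal property of a coproduct in the homotopy category. -/
lemma IsCoprod.existsUnique (h : IsCoprod A Z S inc) (T : A.Obj)
    (f : ∀ n, A.toH0.obj ⟨Z n⟩ ⟶ A.toH0.obj ⟨T⟩) :
    ∃! g : A.toH0.obj ⟨S⟩ ⟶ A.toH0.obj ⟨T⟩, ∀ n, A.mkH0 (inc n) (h.d_inc n) ≫ g = f n := by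
  apply existsUnique_of_exists_of_unique
  · choose x hx hxf using fun n => mkH0_surjective (f n)
    obtain ⟨y, hy⟩ := h.lift x
    refine ⟨A.mkH0 y (h.ext fun n => ?_), fun n => ?_⟩
    · rw [← A.d_comp_of_closed (zero_add 1) (h.d_inc n), hy, hx, map_zero]
    · rw [mkH0_comp, ← hxf, mkH0_eq_iff]
      exact ⟨0, by rw [hy, sub_self, map_zero]⟩
  · intro g g' hg hg'
    obtain ⟨g, hd, rfl⟩ := mkH0_surjective g
    obtain ⟨g', hd', rfl⟩ := mkH0_surjective g'
    have e : ∀ n, ∃ η : A.Hom (Z n) T (-1), A.comp (add_zero 0) (inc n) g -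
        A.comp (add_zero 0) (inc n) g' = A.d (-1) 0 η := fun n => by
      have e := (hg n).trans (hg' n).symm
      rwa [mkH0_comp, mkH0_comp, mkH0_eq_iff] at e
    choose η hη using e
    obtain ⟨y, hy⟩ := h.lift η
    exact (mkH0_eq_iff hd hd').2 ⟨y, h.ext fun n => by
      rw [← A.d_comp_of_closed (neg_add_cancel 1) (h.d_inc n), hy, ← hη, map_sub]⟩

/-- A coproduct of the dg-category is a coproduct of its homotopy category. -/
lemma IsCoprod.nonempty_isColimit (h : IsCoprod A Z S inc) :
    Nonempty (IsColimit (Cofan.mk (A.toH0.obj ⟨S⟩) fun n => A.mkH0 (inc n) (h.d_inc n))) :=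
  ⟨Cofan.IsColimit.mk _ (fun s => (h.existsUnique s.pt.as.obj s.inj).choose)
    (fun s n => (h.existsUnique s.pt.as.obj s.inj).choose_spec.1 n)
    fun s m hm => (h.existsUnique s.pt.as.obj s.inj).choose_spec.2 m hm⟩

end

/-- Shifts are preserved by dg-functors. -/
lemma IsShift.map {A : DGCat.{w, v₁, u₁} k} {C : DGCat.{w, v₂, u₂} k} {n : ℤ} {X Y : A.Obj}
    (h : A.IsShift n X Y) (F : DGFunctor A C) : C.IsShift n (F.obj X) (F.obj Y) := by
  obtain ⟨f, g, hf, hg, hfg, hgf⟩ := h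
  refine ⟨F.map f, F.map g, ?_, ?_, ?_, ?_⟩
  · rw [← F.map_d _ _ rfl, hf, map_zero]
  · rw [← F.map_d _ _ rfl, hg, map_zero]
  · rw [← F.map_comp, hfg, F.map_id]
  · rw [← F.map_comp, hgf, F.map_id]

/-- If the shifts of `J` see `S` as the coproduct of the objects `Z n` in the homotopy category,
the complex of morphisms `S → J` is quasi-isomorphic to the product of the complexes of morphisms
`Z n → J`. -/
lemma isQuasiIso_precompPi_of_existsUnique {C : DGCat.{w, v, u} k} {ι : Type u₁} {Z : ι → C.Obj}
    {S J : C.Obj} {a : ∀ n, C.Hom (Z n) S 0} {ha : ∀ n, C.d 0 1 (a n) = 0}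
    (h : ∀ m, ∃ J', C.IsShift m J J' ∧ ∀ f : ∀ n, C.toH0.obj ⟨Z n⟩ ⟶ C.toH0.obj ⟨J'⟩,
      ∃! g : C.toH0.obj ⟨S⟩ ⟶ C.toH0.obj ⟨J'⟩, ∀ n, C.mkH0 (a n) (ha n) ≫ g = f n) :
    (C.precompPi a ha J).IsQuasiIso := by
  have surj : ∀ (l m m' : ℤ) (_ : l + 1 = m) (_ : m + 1 = m') (x : ∀ n, C.Hom (Z n) J m),
      (∀ n, C.d m m' (x n) = 0) → ∃ (c : C.Hom S J m) (y : ∀ n, C.Hom (Z n) J l),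
        C.d m m' c = 0 ∧ ∀ n, C.comp (zero_add m) (a n) c + C.d l m (y n) = x n := by
    intro l m m' hl hm x hx
    obtain ⟨J', ⟨f, g, hf, hg, hfg, hgf⟩, hJ'⟩ := h m
    have hxf : ∀ n, C.d 0 1 (C.comp (add_neg_cancel m) (x n) f) = 0 := fun n => by
      rw [C.leibniz (x n) f _ hm rfl (zero_add 1) (by omega) (by omega), hx, hf]
      simp
    obtain ⟨u, hu, -⟩ := hJ' fun n => C.mkH0 _ (hxf n)
    obtain ⟨u, hdu, rfl⟩ := mkH0_surjective u
    have e : ∀ n, ∃ η : C.Hom (Z n) J' (-1), C.comp (add_zero 0) (a n) u -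
        C.comp (add_neg_cancel m) (x n) f = C.d (-1) 0 η := fun n => by
      have e := hu n
      rwa [mkH0_comp, mkH0_eq_iff] at e
    choose η hη using e
    refine ⟨C.comp (zero_add m) u g, fun n => -(m.negOnePow • C.comp (by omega) (η n) g), ?_,
      fun n => ?_⟩
    · rw [C.d_comp_of_closed hm hdu, ← hm, hg, map_zero]
    · rw [map_neg, C.d_units_smul, C.leibniz (η n) g _ (neg_add_cancel 1) rfl hl (by omega)
        (zero_add m), hg, map_zero, zero_add, smul_smul, ← Int.negOnePow_add,
        Int.negOnePow_even _ ⟨m, rfl⟩, one_smul, ← hη, map_sub, LinearMap.sub_apply,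
        C.assoc _ _ _ (add_zero 0) (zero_add m) (zero_add m) (zero_add m),
        C.assoc _ _ _ (add_neg_cancel m) (zero_add m) (neg_add_cancel m) (add_zero m), hfg,
        C.comp_id]
      abel
  have inj : ∀ (l m m' : ℤ) (_ : l + 1 = m) (_ : m + 1 = m') (b : C.Hom S J m),
      C.d m m' b = 0 → (∃ x : ∀ n, C.Hom (Z n) J l, ∀ n,
        C.d l m (x n) = C.comp (zero_add m) (a n) b) → ∃ c, C.d l m c = b := by
    rintro l m m' hl hm b hb ⟨x, hx⟩
    obtain ⟨J', ⟨f, g, hf, hg, hfg, hgf⟩, hJ'⟩ := h m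
    have hbf : C.d 0 1 (C.comp (add_neg_cancel m) b f) = 0 := by
      rw [C.leibniz b f _ hm rfl (zero_add 1) (by omega) (by omega), hb, hf]
      simp
    have e : C.mkH0 _ hbf = C.mkH0 0 (map_zero _) := by
      refine (hJ' fun n => C.mkH0 0 (map_zero _)).unique (fun n => ?_) fun n => ?_
      · rw [mkH0_comp, mkH0_eq_iff]
        refine ⟨m.negOnePow • C.comp (by omega) (x n) f, ?_⟩
        rw [C.d_units_smul, C.leibniz (x n) f _ hl rfl (neg_add_cancel 1) (by omega)
          (add_neg_cancel m), hf, map_zero, zero_add, smul_smul, ← Int.negOnePow_add,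
          Int.negOnePow_even _ (by simp), one_smul, hx, sub_zero,
          C.assoc _ _ _ (zero_add m) (add_neg_cancel m) _ (add_zero 0)]
      · rw [mkH0_comp, mkH0_eq_iff]
        exact ⟨0, by simp⟩
    obtain ⟨η, hη⟩ := (mkH0_eq_iff hbf (map_zero _)).1 e
    refine ⟨m.negOnePow • C.comp (by omega) η g, ?_⟩
    rw [C.d_units_smul, C.leibniz η g _ (neg_add_cancel 1) rfl hl (by omega)
      (zero_add m), hg, map_zero, zero_add, smul_smul, ← Int.negOnePow_add,
      Int.negOnePow_even _ ⟨m, rfl⟩, one_smul, ← hη, sub_zero,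
      C.assoc _ _ _ (add_neg_cancel m) (zero_add m) (neg_add_cancel m) (add_zero m), hfg, C.comp_id]
  intro l n m m' hl hn hm b x hb hx
  obtain ⟨c, hc⟩ := inj n m m' hn hm b hb ⟨x, fun i => congrFun hx i⟩
  obtain ⟨c', y, hc', hy⟩ := surj l n m hl hn (fun i => x i - C.comp (zero_add n) (a i) c) fun i => by
    rw [map_sub, C.d_comp_of_closed hn (ha i), hc]
    exact sub_eq_zero.2 (congrFun hx i)
  refine ⟨c + c', y, ?_, funext fun i => ?_⟩
  · exact (map_add _ _ _).trans (by rw [hc, hc', add_zero])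
  · have e : C.comp (zero_add n) (a i) (c + c') + C.d l n (y i) = x i := by
      rw [map_add, add_assoc, hy, add_sub_cancel]
    exact e

end DGCat

/-- Suppose that `q` exhibits `J` as represented by `b` on objects `Y x`, and that the morphisms
`p n : Y (x n) → K n` and `r : Y s → T` are local with respect to `J`. If `s` is the coproduct of
the `x n`, then `T` is the coproduct of the `K n` with respect to morphisms to `J`. -/
lemma CategoryTheory.Limits.existsUnique_of_isColimit_cofan {ℋ : Type u₁} [Category.{v₁} ℋ]
    {𝒦 : Type u₂} [Category.{v₂} 𝒦] (Y : ℋ ⥤ 𝒦) {b : ℋ} {J : 𝒦} (q : Y.obj b ⟶ J)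
    (hq : ∀ (x : ℋ) (φ : Y.obj x ⟶ J), ∃! g : x ⟶ b, Y.map g ≫ q = φ) {ι : Type} {x : ι → ℋ} {s : ℋ}
    (i : ∀ n, x n ⟶ s) (c : IsColimit (Cofan.mk s i)) {K : ι → 𝒦} {T : 𝒦} (a : ∀ n, K n ⟶ T)
    (p : ∀ n, Y.obj (x n) ⟶ K n) (r : Y.obj s ⟶ T)
    (hp : ∀ n, Function.Bijective fun g : K n ⟶ J => p n ≫ g)
    (hr : Function.Bijective fun g : T ⟶ J => r ≫ g) (h : ∀ n, Y.map (i n) ≫ r = p n ≫ a n)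
    (f : ∀ n, K n ⟶ J) : ∃! g : T ⟶ J, ∀ n, a n ≫ g = f n := by
  apply existsUnique_of_exists_of_unique
  · choose g hg _ using fun n => hq _ (p n ≫ f n)
    have hg' : ∀ n, i n ≫ Cofan.IsColimit.desc c g = g n := fun n => Cofan.IsColimit.fac c g n
    obtain ⟨u, hu⟩ := hr.2 (Y.map (Cofan.IsColimit.desc c g) ≫ q)
    refine ⟨u, fun n => (hp n).1 ?_⟩
    dsimp only at hu hg ⊢
    rw [← hg, ← hg', Functor.map_comp, Category.assoc, ← hu, ← Category.assoc, ← Category.assoc, h]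
  · intro u u' hu hu'
    obtain ⟨g, hg, -⟩ := hq _ (r ≫ u)
    obtain ⟨g', hg', -⟩ := hq _ (r ≫ u')
    have e : g = g' := Cofan.IsColimit.hom_ext c _ _ fun n =>
      (hq _ (p n ≫ f n)).unique
        (by rw [Functor.map_comp, Category.assoc, hg, ← hu n, ← Category.assoc, ← Category.assoc,
          ← h]; rfl)
        (by rw [Functor.map_comp, Category.assoc, hg', ← hu' n, ← Category.assoc, ← Category.assoc,
          ← h]; rfl)
    exact hr.1 (hg.symm.trans (by rw [e, hg']))

namespace QuasiFunctor

open DGCat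

variable {k : Type u} [Field k] {A B : DGCat.{u, u, u} k}

/-- The resolution of a quasi-representable dg-module is quasi-representable. -/
lemma exists_isQis_modRes (G : QuasiFunctor A B) (Y : A.Obj) :
    ∃ (b : B.Obj) (q : B.dgYoneda.mapZ0.obj ⟨b⟩ ⟶ ⟨(modRes B).obj (G.bimod.obj Y)⟩), IsQis q :=
  ⟨G.Φ Y, G.q Y ≫ ⟨(modι B).1 _, d_modι _⟩, (G.isQis_q Y).comp (isQis_modι _)⟩

/-- If `H⁰(F)` preserves coproducts, the resolutions of quasi-representable dg-modules see `F S` as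
the coproduct of the `F (Z n)` if `S` is the coproduct of the `Z n`. -/
lemma existsUnique_of_isCoprod (F G : QuasiFunctor A B) {ι : Type}
    [PreservesColimitsOfShape (Discrete ι) F.H0] {Z : ι → A.Obj} {S : A.Obj}
    {inc : ∀ n, A.Hom (Z n) S 0} (h : IsCoprod A Z S inc) (Y : A.Obj)
    (f : ∀ n, B.dgMod.toH0.obj ⟨F.bimod.obj (Z n)⟩ ⟶
      B.dgMod.toH0.obj ⟨(modRes B).obj (G.bimod.obj Y)⟩) :
    ∃! g : B.dgMod.toH0.obj ⟨F.bimod.obj S⟩ ⟶ B.dgMod.toH0.obj ⟨(modRes B).obj (G.bimod.obj Y)⟩,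
      ∀ n, B.dgMod.mkH0 (F.bimod.map (inc n)) (F.bimod.d_map (h.d_inc n)) ≫ g = f n := by
  obtain ⟨b, q, hq⟩ := G.exists_isQis_modRes Y
  obtain ⟨c⟩ := h.nonempty_isColimit
  have c' := isColimitCofanMkObjOfIsColimit F.H0 _ _ c
  -- morphisms to the resolution are morphisms to `b` in `H⁰(B)`
  have hF : ∀ X, Function.Bijective fun g : B.dgMod.toH0.obj ⟨F.bimod.obj X⟩ ⟶
      B.dgMod.toH0.obj ⟨(modRes B).obj (G.bimod.obj Y)⟩ => F.qH0 (A.toH0.obj ⟨X⟩) ≫ g := fun X =>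
    B.dgMod.bijective_comp_of_isQuasiIso (F.q X).1 (F.q X).2 _
      (isQuasiIso_precompHom_modRes _ _ (F.isQis_q X) _)
  have hnat : ∀ n, B.dgYoneda.mapH0.map (F.H0.map (A.mkH0 (inc n) (h.d_inc n))) ≫
      F.qH0 (A.toH0.obj ⟨S⟩) = F.qH0 (A.toH0.obj ⟨Z n⟩) ≫
        B.dgMod.mkH0 (F.bimod.map (inc n)) (F.bimod.d_map (h.d_inc n)) := fun n =>
    (F.existsUnique_map (A.mkH0 (inc n) (h.d_inc n))).choose_spec.1
  exact existsUnique_of_isColimit_cofan B.dgYoneda.mapH0 (B.dgMod.toH0.map q)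
    (fun _ => existsUnique_lift q hq) _ c' _ (fun n => F.qH0 (A.toH0.obj ⟨Z n⟩))
    (F.qH0 (A.toH0.obj ⟨S⟩)) (fun n => hF (Z n)) (hF S) hnat f

/-- If `H⁰(F)` preserves coproducts, `F S` is the homotopy coproduct of the `F (Z n)` with respect
to morphisms to the resolution of `G Y`. The shifts of `Y` turn the statement in degree `0` into one in
all degrees. -/
lemma isQuasiIso_precompPi (F G : QuasiFunctor A B) {ι : Type}
    [PreservesColimitsOfShape (Discrete ι) F.H0] {Z : ι → A.Obj} {S : A.Obj}
    {inc : ∀ n, A.Hom (Z n) S 0} (h : IsCoprod A Z S inc)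
    (hA : ∀ (n : ℤ) (Y : A.Obj), ∃ Y', A.IsShift n Y Y') (Y : A.Obj) :
    (B.dgMod.precompPi (fun n => F.bimod.map (inc n)) (fun n => F.bimod.d_map (h.d_inc n))
      ((modRes B).obj (G.bimod.obj Y))).IsQuasiIso := by
  refine isQuasiIso_precompPi_of_existsUnique fun m => ?_
  obtain ⟨Y', hY'⟩ := hA m Y
  exact ⟨_, (hY'.map G.bimod).map (modRes B), F.existsUnique_of_isCoprod G h Y'⟩

end QuasiFunctor

/-! ### Truncations of complexes -/

namespace DGCat

section abstract

variable {k : Type w} [Field k] {A : DGCat.{w, v₁, u₁} k} {P : A.Obj → Prop} {Y : A.Obj}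

/-- A presentation from a coproduct and a section `γ` of the induced morphism `S → Y`. The other
splitting is `-∑ l < n, inc l ∘ r l ∘ j n` on the `n`-th summand; it requires that `γ ∘ j n` and
the `n`-th inclusion differ by the telescoping sum of `hγ'`. -/
lemma Exhaustion.nonempty_presentation (E : Exhaustion A P Y) {S : A.Obj}
    {inc : ∀ n, A.Hom (E.obj n) S 0} (h : IsCoprod A E.obj S inc) (γ : A.Hom Y S 0)
    (hγ : ∀ β, (∀ n, A.comp (zero_add 0) (inc n) β = E.j n) →
      A.comp (add_zero 0) γ β = A.id Y)
    (hγ' : ∀ n, A.comp (add_zero 0) (E.j n) γ = inc n + ∑ l ∈ Finset.range n,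
      (A.comp (add_zero 0) (A.comp (add_zero 0) (E.j n) (E.r l)) (inc l) -
        A.comp (add_zero 0) (A.comp (add_zero 0) (A.comp (add_zero 0) (E.j n) (E.r l)) (E.t l))
          (inc (l + 1)))) :
    Nonempty E.Presentation := by
  have assoc : ∀ {W X Z T : A.Obj} (f : A.Hom W X 0) (g : A.Hom X Z 0) (l : A.Hom Z T 0),
      A.comp (add_zero 0) (A.comp (add_zero 0) f g) l =
        A.comp (add_zero 0) f (A.comp (add_zero 0) g l) := fun f g l => A.assoc f g l _ _ _ _
  obtain ⟨α, hα⟩ := h.lift fun n => inc n - A.comp (add_zero 0) (E.t n) (inc (n + 1))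
  obtain ⟨β, hβ⟩ := h.lift E.j
  obtain ⟨δ, hδ⟩ := h.lift fun n => -∑ l ∈ Finset.range n,
    A.comp (add_zero 0) (A.comp (add_zero 0) (E.j n) (E.r l)) (inc l)
  refine ⟨⟨S, inc, h, α, ?_, β, ?_, γ, δ, hα, hβ, ?_, ?_, hγ β hβ, ?_⟩⟩
  · refine h.ext fun n => ?_
    rw [← A.d_comp_of_closed (zero_add 1) (h.d_inc n), hα, map_sub, h.d_inc,
      A.d_comp_of_closed (zero_add 1) (E.d_t n), h.d_inc, map_zero, map_zero, sub_zero]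
  · refine h.ext fun n => ?_
    rw [← A.d_comp_of_closed (zero_add 1) (h.d_inc n), hβ, E.d_j, map_zero]
  · refine h.ext fun n => ?_
    rw [← assoc, hα, map_sub, LinearMap.sub_apply, assoc, hβ, hβ, E.t_j, sub_self, map_zero]
  · refine h.ext fun n => ?_
    rw [← assoc, hα, map_sub, LinearMap.sub_apply, assoc, hδ, hδ, map_neg, sub_neg_eq_add, map_sum,
      Finset.sum_range_succ]
    have e : ∀ l, A.comp (add_zero 0) (E.t n)
        (A.comp (add_zero 0) (A.comp (add_zero 0) (E.j (n + 1)) (E.r l)) (inc l)) =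
        A.comp (add_zero 0) (A.comp (add_zero 0) (E.j n) (E.r l)) (inc l) := fun l => by
      rw [← assoc, ← assoc, E.t_j]
    simp only [e]
    rw [neg_add_cancel_left, E.j_r, A.id_comp, A.comp_id]
  · refine h.ext fun n => ?_
    rw [map_add, ← assoc, ← assoc, hβ, hδ, hγ', map_neg, LinearMap.neg_apply, map_sum,
      LinearMap.sum_apply, A.comp_id, add_assoc, ← sub_eq_add_neg, ← Finset.sum_sub_distrib,
      add_eq_left]
    refine Finset.sum_eq_zero fun l _ => ?_
    rw [assoc _ _ α, hα, map_sub, ← assoc]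
    abel

end abstract

section telescope

variable {I : Type u₁} [Category.{v₁} I] [Preadditive I]

/-- The telescoping sum behind the splitting of the presentation, in a single degree, for an
exhaustion that is `0` before `c` and constant from `c` on. -/
lemma comp_section_eq {Y S : I} {T : ℕ → I} (j : ∀ n, T n ⟶ Y) (r : ∀ n, Y ⟶ T n)
    (inc : ∀ n, T n ⟶ S) (c : ℕ) (hj : ∀ n, j n ≫ r n = 𝟙 _)
    (hr : ∀ n, c ≤ n → r n ≫ j n = 𝟙 Y) (hr' : ∀ n, n < c → r n ≫ j n = 0) (n : ℕ) :
    j n ≫ r c ≫ inc c = inc n + ∑ l ∈ Finset.range n,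
      ((j n ≫ r l) ≫ inc l - ((j n ≫ r l) ≫ j l ≫ r (l + 1)) ≫ inc (l + 1)) := by
  let f (l : ℕ) : T n ⟶ S := j n ≫ r l ≫ inc l
  let g (l : ℕ) : T n ⟶ S := f (max l c)
  have hzero : ∀ l, l < c → r l = 0 := fun l hl => by
    rw [← Category.comp_id (r l), ← hj, ← Category.assoc, hr' l hl, zero_comp]
  have hg : ∀ l, (j n ≫ r l) ≫ inc l - ((j n ≫ r l) ≫ j l ≫ r (l + 1)) ≫ inc (l + 1) =
      g l - g (l + 1) := by
    intro l
    by_cases hl : l < c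
    · have e : g (l + 1) = g l := congrArg f (by omega)
      rw [e]
      simp only [hzero l hl, comp_zero, zero_comp, sub_self]
    · have e : g l = f l := congrArg f (by omega)
      have e' : g (l + 1) = f (l + 1) := congrArg f (by omega)
      have e'' : (j n ≫ r l) ≫ j l ≫ r (l + 1) = j n ≫ r (l + 1) := by
        rw [Category.assoc, ← Category.assoc (r l), hr l (by omega), Category.id_comp]
      rw [e, e', e'', Category.assoc, Category.assoc]
  have hn : g n = inc n := by
    by_cases hn : n < c
    · have : 𝟙 (T n) = 0 := by rw [← hj, hzero n hn, comp_zero]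
      rw [← Category.id_comp (inc n), ← Category.id_comp (g n), this, zero_comp, zero_comp]
    · have e : g n = f n := congrArg f (by omega)
      rw [e]
      simp only [f]
      rw [← Category.assoc, hj, Category.id_comp]
  have h0 : g 0 = j n ≫ r c ≫ inc c := congrArg f (Nat.zero_max c)
  rw [Finset.sum_congr rfl fun l _ => hg l, Finset.sum_range_sub', hn, h0, add_sub_cancel]

end telescope

section trunc

open CochainComplex CochainComplex.HomComplex

variable {I : Type u₁} [Category.{v₁} I] [Preadditive I] [HasZeroObject I]

/-- Objects `T` isomorphic to `X` if `p` holds and zero otherwise, with the evident split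
monomorphism to `X`. -/
lemma exists_truncX (X : I) (p : Prop) : ∃ (T : I) (j : T ⟶ X) (r : X ⟶ T), j ≫ r = 𝟙 T ∧
    (p → r ≫ j = 𝟙 X) ∧ (¬ p → r ≫ j = 0) := by
  by_cases hp : p
  · exact ⟨X, 𝟙 X, 𝟙 X, by simp, by simp, fun h => absurd hp h⟩
  · obtain ⟨Z, hZ⟩ := HasZeroObject.zero (C := I)
    exact ⟨Z, 0, 0, hZ.eq_of_src _ _, fun h => absurd h hp, by simp⟩

/-- The object `X` if `p` holds and a zero object otherwise. -/
noncomputable def truncX (X : I) (p : Prop) : I := (exists_truncX X p).choose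

/-- The split inclusion of `truncX X p`. -/
noncomputable def truncJ (X : I) (p : Prop) : truncX X p ⟶ X :=
  (exists_truncX X p).choose_spec.choose

/-- The projection to `truncX X p`. -/
noncomputable def truncR (X : I) (p : Prop) : X ⟶ truncX X p :=
  (exists_truncX X p).choose_spec.choose_spec.choose

lemma truncJ_truncR (X : I) (p : Prop) : truncJ X p ≫ truncR X p = 𝟙 _ :=
  (exists_truncX X p).choose_spec.choose_spec.choose_spec.1

lemma truncR_truncJ (X : I) {p : Prop} (hp : p) : truncR X p ≫ truncJ X p = 𝟙 X :=
  (exists_truncX X p).choose_spec.choose_spec.choose_spec.2.1 hp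

lemma truncR_truncJ_eq_zero (X : I) {p : Prop} (hp : ¬ p) : truncR X p ≫ truncJ X p = 0 :=
  (exists_truncX X p).choose_spec.choose_spec.choose_spec.2.2 hp

lemma truncJ_eq_zero (X : I) {p : Prop} (hp : ¬ p) : truncJ X p = 0 := by
  rw [← Category.id_comp (truncJ X p), ← truncJ_truncR, Category.assoc,
    truncR_truncJ_eq_zero X hp, comp_zero]

variable (Y : CochainComplex I ℤ) (n : ℕ)

lemma truncJ_d (i i' : ℤ) : (truncJ (Y.X i) (-n ≤ i) ≫ Y.d i i' ≫ truncR (Y.X i') (-n ≤ i')) ≫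
    truncJ (Y.X i') (-n ≤ i') = truncJ (Y.X i) (-n ≤ i) ≫ Y.d i i' := by
  by_cases h : i + 1 = i'
  · by_cases hi : -n ≤ i
    · rw [Category.assoc, Category.assoc, truncR_truncJ _ (by omega), Category.comp_id]
    · rw [truncJ_eq_zero _ hi, zero_comp, zero_comp, zero_comp]
  · rw [Y.shape _ _ h, zero_comp, comp_zero, zero_comp, comp_zero]

/-- The stupid truncation of `Y` in degrees `≥ -n`. -/
noncomputable def trunc : CochainComplex I ℤ where
  X i := truncX (Y.X i) (-n ≤ i)
  d i i' := truncJ _ _ ≫ Y.d i i' ≫ truncR _ _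
  shape i i' h := by rw [Y.shape _ _ h, zero_comp, comp_zero]
  d_comp_d' i i' i'' _ _ := by
    rw [← Category.assoc, truncJ_d, Category.assoc, ← Category.assoc (Y.d i i'), Y.d_comp_d,
      zero_comp, comp_zero]

/-- The inclusion of the stupid truncation. -/
noncomputable def truncι : trunc Y n ⟶ Y where
  f _ := truncJ _ _
  comm' i i' _ := (truncJ_d Y n i i').symm

/-- The projection to the stupid truncation: it is not compatible with the differentials. -/
noncomputable def truncπ : Cochain Y (trunc Y n) 0 := Cochain.ofHoms fun _ => truncR _ _

lemma truncπ_v (i : ℤ) : (truncπ Y n).v i i (add_zero i) = truncR (Y.X i) (-n ≤ i) :=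
  Cochain.ofHoms_v (G := trunc Y n) _ _

lemma plus_trunc : CochainComplex.plus I (trunc Y n) :=
  ⟨-n, (isStrictlyGE_iff _ _).2 fun i hi => by
    rw [IsZero.iff_id_eq_zero]
    refine (truncJ_truncR (Y.X i) (-n ≤ i)).symm.trans ?_
    exact (congrArg (· ≫ _) (truncJ_eq_zero _ (by omega))).trans zero_comp⟩

lemma truncι_truncπ : (Cochain.ofHom (truncι Y n)).comp (truncπ Y n) (add_zero 0) =
    Cochain.ofHom (𝟙 _) := by
  ext i
  rw [Cochain.comp_zero_cochain_v, Cochain.ofHom_v, Cochain.ofHom_v, truncπ_v]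
  exact truncJ_truncR (Y.X i) (-n ≤ i)

variable {Y n} in
lemma truncπ_truncι_v {i : ℤ} (hi : -n ≤ i) :
    ((truncπ Y n).v i i (add_zero i)) ≫ (truncι Y n).f i = 𝟙 _ := by
  rw [truncπ_v]
  exact truncR_truncJ (Y.X i) hi

variable {Y n} in
lemma truncι_eq_zero {i : ℤ} (hi : ¬ -n ≤ i) : (truncι Y n).f i = 0 :=
  truncJ_eq_zero (Y.X i) hi

variable {Y} in
/-- A cochain from a bounded below complex factors through a truncation. -/
lemma exists_comp_truncπ_truncι {X : CochainComplex I ℤ} (hX : CochainComplex.plus I X) {p : ℤ}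
    (g : Cochain X Y p) : ∃ n, (g.comp (truncπ Y n) (add_zero p)).comp
      (Cochain.ofHom (truncι Y n)) (add_zero p) = g := by
  obtain ⟨a, ha⟩ := hX
  -- the source vanishes in degrees `< a`, so that only the degrees `≥ a + p` of `Y` matter
  refine ⟨(-(a + p)).toNat, ?_⟩
  ext i j hij
  rw [Cochain.comp_zero_cochain_v, Cochain.comp_zero_cochain_v, Cochain.ofHom_v, Category.assoc]
  by_cases hi : i < a
  · exact (X.isZero_of_isStrictlyGE a i hi).eq_of_src _ _
  · rw [truncπ_truncι_v (by omega), Category.comp_id]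

end trunc

section coprod

open CochainComplex CochainComplex.HomComplex

variable {I : Type u₁} [Category.{v₁} I] [Preadditive I] [HasCountableCoproducts I]
  (T : ℕ → CochainComplex I ℤ)

/-- The coproduct of a sequence of complexes. -/
noncomputable def sumCplx : CochainComplex I ℤ where
  X i := ∐ fun n => (T n).X i
  d i i' := Limits.Sigma.map fun n => (T n).d i i'
  shape i i' h := Sigma.hom_ext _ _ fun n => by
    rw [Sigma.ι_map, (T n).shape _ _ h, zero_comp, comp_zero]
  d_comp_d' i i' i'' _ _ := Sigma.hom_ext _ _ fun n => by
    rw [Sigma.ι_map_assoc, Sigma.ι_map, ← Category.assoc, (T n).d_comp_d, zero_comp, comp_zero]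

/-- The inclusions of a sequence of complexes in its coproduct. -/
noncomputable def sumι (n : ℕ) : T n ⟶ sumCplx T where
  f i := Sigma.ι (fun n => (T n).X i) n
  comm' i i' _ := Sigma.ι_map (fun n => (T n).d i i') n

variable {T}

lemma sum_hom_ext {i : ℤ} {Z : I} {x y : (sumCplx T).X i ⟶ Z}
    (h : ∀ n, (sumι T n).f i ≫ x = (sumι T n).f i ≫ y) : x = y :=
  Sigma.hom_ext _ _ h

lemma exists_sum_desc {i : ℤ} {Z : I} (x : ∀ n, (T n).X i ⟶ Z) :
    ∃ y : (sumCplx T).X i ⟶ Z, ∀ n, (sumι T n).f i ≫ y = x n :=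
  ⟨Sigma.desc x, Sigma.ι_desc x⟩

lemma sum_cochain_ext {L : CochainComplex I ℤ} {m : ℤ} {x y : Cochain (sumCplx T) L m}
    (h : ∀ n, (Cochain.ofHom (sumι T n)).comp x (zero_add m) =
      (Cochain.ofHom (sumι T n)).comp y (zero_add m)) : x = y := by
  ext i j hij
  refine sum_hom_ext fun n => ?_
  have e := Cochain.congr_v (h n) i j hij
  rwa [Cochain.zero_cochain_comp_v, Cochain.zero_cochain_comp_v, Cochain.ofHom_v] at e

lemma exists_sum_cochain {L : CochainComplex I ℤ} {m : ℤ} (θ : ∀ n, Cochain (T n) L m) :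
    ∃ x : Cochain (sumCplx T) L m, ∀ n,
      (Cochain.ofHom (sumι T n)).comp x (zero_add m) = θ n := by
  choose x hx using fun i j hij => exists_sum_desc fun n => (θ n).v i j hij
  refine ⟨Cochain.mk x, fun n => ?_⟩
  ext i j hij
  rw [Cochain.zero_cochain_comp_v, Cochain.ofHom_v, Cochain.mk_v, hx]

end coprod

section presentation

open CochainComplex CochainComplex.HomComplex

variable {I : Type u₁} [Category.{v₁} I] [Preadditive I] [HasCountableCoproducts I]
  [HasZeroObject I] (Y : CochainComplex I ℤ)

/-- In degree `i`, the section `Y → ∐ n, trunc Y n` is the inclusion in the summand `n = -i` (or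
`n = 0` if `i` is positive), the first one that is not zero in degree `i`. -/
noncomputable def sumSection : Cochain Y (sumCplx (trunc Y)) 0 :=
  Cochain.ofHoms fun i => (truncπ Y (-i).toNat).v i i (add_zero i) ≫ (sumι (trunc Y) (-i).toNat).f i

lemma sumSection_v (i : ℤ) : (sumSection Y).v i i (add_zero i) =
    (truncπ Y (-i).toNat).v i i (add_zero i) ≫ (sumι (trunc Y) (-i).toNat).f i :=
  Cochain.ofHoms_v (G := sumCplx (trunc Y)) _ _

lemma sumSection_comp (β : Cochain (sumCplx (trunc Y)) Y 0)
    (hβ : ∀ n, (Cochain.ofHom (sumι (trunc Y) n)).comp β (zero_add 0) =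
      Cochain.ofHom (truncι Y n)) :
    (sumSection Y).comp β (add_zero 0) = Cochain.ofHom (𝟙 Y) := by
  ext i
  have e := Cochain.congr_v (hβ (-i).toNat) i i (add_zero i)
  rw [Cochain.zero_cochain_comp_v, Cochain.ofHom_v, Cochain.ofHom_v] at e
  rw [Cochain.comp_zero_cochain_v, sumSection_v, Category.assoc, e, Cochain.ofHom_v,
    truncπ_truncι_v (by omega)]
  rfl

lemma truncι_comp_sumSection (n : ℕ) :
    (Cochain.ofHom (truncι Y n)).comp (sumSection Y) (add_zero 0) =
      Cochain.ofHom (sumι (trunc Y) n) + ∑ l ∈ Finset.range n,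
        (((Cochain.ofHom (truncι Y n)).comp (truncπ Y l) (add_zero 0)).comp
            (Cochain.ofHom (sumι (trunc Y) l)) (add_zero 0) -
          (((Cochain.ofHom (truncι Y n)).comp (truncπ Y l) (add_zero 0)).comp
            ((Cochain.ofHom (truncι Y l)).comp (truncπ Y (l + 1)) (add_zero 0)) (add_zero 0)).comp
              (Cochain.ofHom (sumι (trunc Y) (l + 1))) (add_zero 0)) := by
  ext i
  have hsum : ∀ (s : Finset ℕ) (z : ℕ → Cochain (trunc Y n) (sumCplx (trunc Y)) 0),
      (∑ l ∈ s, z l).v i i (add_zero i) = ∑ l ∈ s, (z l).v i i (add_zero i) := fun s z => by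
    induction s using Finset.cons_induction with
    | empty => simp
    | cons a s ha ih => rw [Finset.sum_cons, Finset.sum_cons, Cochain.add_v, ih]
  rw [Cochain.add_v, hsum, Cochain.comp_zero_cochain_v, sumSection_v]
  simp only [Cochain.sub_v, Cochain.comp_zero_cochain_v, Cochain.ofHom_v]
  refine comp_section_eq (fun n => (truncι Y n).f i) (fun n => (truncπ Y n).v i i (add_zero i))
    (fun n => (sumι (trunc Y) n).f i) (-i).toNat (fun n => ?_) (fun n hn => ?_) (fun n hn => ?_) n
  · have e := Cochain.congr_v (truncι_truncπ Y n) i i (add_zero i)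
    rwa [Cochain.comp_zero_cochain_v, Cochain.ofHom_v, Cochain.ofHom_v] at e
  · exact truncπ_truncι_v (by omega)
  · rw [truncι_eq_zero (by omega), comp_zero]

end presentation

section Cdg

open CochainComplex CochainComplex.HomComplex

variable (k : Type w) [Field k] {I : Type u₁} [Category.{v₁} I] [Preadditive I] [Linear k I]

/-- The coproduct of a sequence of complexes, formed degreewise, is a coproduct in `C_dg(I)`. -/
lemma isCoprod_sumCplx [HasCountableCoproducts I]
    (T : ℕ → CochainComplex I ℤ) :
    IsCoprod (Cdg k I) T (sumCplx T) fun n => Cochain.ofHom (sumι T n) :=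
  ⟨fun _ => δ_ofHom _, sum_cochain_ext, exists_sum_cochain⟩

variable [HasZeroObject I] (Y : CochainComplex I ℤ)

/-- The exhaustion of a complex by its stupid truncations. -/
noncomputable def exhaustionTrunc : Exhaustion (Cdg k I) (CochainComplex.plus I) Y where
  obj n := trunc Y n
  prop n := plus_trunc Y n
  j n := Cochain.ofHom (truncι Y n)
  d_j n := δ_ofHom _
  r n := truncπ Y n
  j_r n := truncι_truncπ Y n
  j_r_j {n m} h := by
    change ((Cochain.ofHom (truncι Y n)).comp (truncπ Y m) (add_zero 0)).comp
      (Cochain.ofHom (truncι Y m)) (add_zero 0) = Cochain.ofHom (truncι Y n)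
    ext i
    simp only [Cochain.comp_zero_cochain_v, Cochain.ofHom_v, Category.assoc]
    by_cases hi : -(n : ℤ) ≤ i
    · rw [truncπ_truncι_v (by omega), Category.comp_id]
    · rw [truncι_eq_zero hi, zero_comp]
  factor hX _ g := exists_comp_truncπ_truncι hX g

variable [HasCountableCoproducts I]

/-- A complex is the degreewise split sequential colimit of its stupid truncations. -/
lemma nonempty_presentation_trunc : Nonempty (exhaustionTrunc k Y).Presentation :=
  (exhaustionTrunc k Y).nonempty_presentation (isCoprod_sumCplx k (trunc Y)) (sumSection Y)
    (sumSection_comp Y) (truncι_comp_sumSection Y)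

end Cdg

section shift

open CochainComplex CochainComplex.HomComplex

variable (k : Type w) [Field k] {I : Type u₁} [Category.{v₁} I] [Preadditive I] [Linear k I]

/-- The shift `Y⟦n⟧` is the shift in `C_dg(I)`; the closed isomorphisms are the identity of `Y`
with shifted degree. -/
lemma isShift_Cdg (n : ℤ) (Y : CochainComplex I ℤ) :
    (Cdg k I).IsShift n Y (show CochainComplex I ℤ from Y⟦n⟧) := by
  let Y' : CochainComplex I ℤ := Y⟦n⟧
  let f : Cochain Y Y' (-n) := (Cochain.ofHom (𝟙 Y)).rightShift n (-n) (neg_add_cancel n)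
  let g : Cochain Y' Y n := (Cochain.ofHom (𝟙 (Y⟦n⟧))).rightUnshift n (zero_add n)
  have hf : δ (-n) (-n + 1) f = 0 := by
    refine (Cochain.δ_rightShift _ n (-n) (-n + 1) _ 1 (by omega)).trans ?_
    rw [δ_ofHom, Cochain.rightShift_zero, smul_zero]
  have hg : δ n (n + 1) g = 0 := by
    refine (Cochain.δ_rightUnshift _ n _ (n + 1) 1 (by omega)).trans ?_
    rw [δ_ofHom, Cochain.rightUnshift_zero, smul_zero]
  have hfu : f.rightUnshift 0 (neg_add_cancel n) = Cochain.ofHom (𝟙 Y) :=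
    Cochain.rightUnshift_rightShift _ _ _ _
  have hfg : f.comp g (neg_add_cancel n) = Cochain.ofHom (𝟙 Y) := by
    refine (Cochain.rightUnshift_comp f _ (add_zero (-n)) 0 (neg_add_cancel n) n
      (zero_add n)).symm.trans ?_
    rw [Cochain.comp_id]
    exact hfu
  have hgf : g.comp f (add_neg_cancel n) = Cochain.ofHom (𝟙 Y') := by
    have e : (g.comp f (add_neg_cancel n)).rightUnshift n (zero_add n) = g := by
      refine (Cochain.rightUnshift_comp g f (add_neg_cancel n) n (zero_add n) 0
        (neg_add_cancel n)).trans ?_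
      rw [hfu, Cochain.comp_id]
    rw [← Cochain.rightShift_rightUnshift (g.comp f (add_neg_cancel n)) n (zero_add n), e]
    exact Cochain.rightShift_rightUnshift _ _ _
  exact ⟨f, g, hf, hg, hfg, hgf⟩

end shift

end DGCat

/-! ### Lifting isomorphisms of quasi-functors -/

namespace QuasiFunctor

open DGCat

variable {k : Type u} [Field k] {A B : DGCat.{u, u, u} k} {P : A.Obj → Prop}

/-- Restriction to the full dg-subcategory of objects satisfying `P` is bijective on morphisms
between quasi-functors, if every object is the sequential colimit of an exhaustion by objects
satisfying `P`, and the source preserves countable sums. -/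
lemma bijective_restriction_map (E : ∀ Y, Exhaustion A P Y) (p : ∀ Y, (E Y).Presentation)
    (hA : ∀ (n : ℤ) (Y : A.Obj), ∃ Y', A.IsShift n Y Y') (F G : QuasiFunctor A B)
    (hF : F.PreservesCountableSums) :
    Function.Bijective fun f : DGBimod.toDerived (A := A) (B := B) F.bimod ⟶
        DGBimod.toDerived (A := A) (B := B) G.bimod =>
      (DGBimod.restriction (B := B) (DGFunctor.ofFullSub A P)).map f :=
  have := hF ℕ
  DGBimod.bijective_restriction_map E p F.bimod G.bimod fun Y Y' =>
    F.isQuasiIso_precompPi G (p Y).isCoprod hA Y'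

/-- Isomorphisms of quasi-functors lift from the full dg-subcategory of objects satisfying `P`. -/
lemma exists_iso_restrict_eq (E : ∀ Y, Exhaustion A P Y) (p : ∀ Y, (E Y).Presentation)
    (hA : ∀ (n : ℤ) (Y : A.Obj), ∃ Y', A.IsShift n Y Y') (F G : QuasiFunctor A B)
    (hF : F.PreservesCountableSums) (hG : G.PreservesCountableSums)
    (φ₀ : Iso (F.restrict (DGFunctor.ofFullSub A P)) (G.restrict (DGFunctor.ofFullSub A P))) :
    ∃ φ : Iso F G, φ.restrict (DGFunctor.ofFullSub A P) = φ₀ := by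
  refine (DGBimod.restriction (B := B) (DGFunctor.ofFullSub A P)).exists_mapIso_eq
    (X := DGBimod.toDerived F.bimod) (Y := DGBimod.toDerived G.bimod) ?_ φ₀
  rintro _ _ (rfl | rfl) (rfl | rfl)
  exacts [bijective_restriction_map E p hA F F hF, bijective_restriction_map E p hA F G hF,
    bijective_restriction_map E p hA G F hG, bijective_restriction_map E p hA G G hG]

end QuasiFunctor

theorem proposition3p1 {k : Type u} [Field k]
    (I : Type u) [Category.{u} I] [Preadditive I] [Linear k I] [HasCountableCoproducts I]
    (B : DGCat.{u, u, u} k) (hB : B.IsPretriangulated) [HasCountableCoproducts B.H0]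
    (F G : QuasiFunctor (Cdg k I) B)
    (hF : F.PreservesCountableSums) (hG : G.PreservesCountableSums)
    (φ₀ : QuasiFunctor.Iso (F.restrict (CdgPlus.incl k I)) (G.restrict (CdgPlus.incl k I))) :
    ∃ φ : QuasiFunctor.Iso F G, φ.restrict (CdgPlus.incl k I) = φ₀ := by
  have : HasInitial I := HasCountableCoproducts.out PEmpty.{1}
  have : HasZeroObject I := hasZeroObject_of_hasInitial_object
  -- every complex is the sequential colimit of its stupid truncations, which are bounded below
  exact QuasiFunctor.exists_iso_restrict_eq (fun Y => DGCat.exhaustionTrunc k Y)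
    (fun Y => (DGCat.nonempty_presentation_trunc k Y).some)
    (fun n Y => ⟨_, DGCat.isShift_Cdg k n Y⟩) F G hF hG φ₀
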